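/- Let $k$ be a field of characteristic zero and let $P_+$ be a differential graded symmetric operad over $k$ (cochain complexes, $\mathbb Z$-graded) with $HP_+(0)\cong k$ and $HP_+(1)\cong k$ (in degree $0$). Let $P$ be its truncation: $P(0)=0$ and $P(n)=P_+(n)$ for $n>0$. A Sullivan minimal operad is the colimit of a sequence $I_0\to\Gamma(E(2))\to\Gamma(E(2)\oplus E(3))\to\cdots$, starting from the initial operad $I_0$ ($I_0(1)=k$, $I_0(n)=0$ otherwise), of free graded operads on graded $\Sigma_n$-modules $E(n)$, $n\ge2$, such that the differential maps $E(n)$ into the preceding stage. A unitary Sullivan minimal operad is defined in the same way, each stage being a unitary extension of such a free operad (it has $k$ in arity $0$ and agrees with the free operad in positive arities), with the differential and the restriction operations $e\mapsto e\circ_i 1$ mapping $E(n)$ into the preceding stage. A (unitary) Sullivan minimal model of a dg operad is a quasi-isomorphism to it from a (unitary) Sullivan minimal operad; write $(P_+)_\infty\to P_+$ for a unitary Sullivan minimal model of $P_+$ and $P_\infty\to P$ for a Sullivan minimal model of $P$. 1. If $P_+$ has a unitary multiplication (degree-$0$ cocycles $\mu\in P_+(2)$, $1\in P_+(0)$ with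 $\mu\circ_1\mu=\mu\circ_2\mu$ and $\mu\circ_1 1=\mathrm{id}=\mu\circ_2 1$), then a unitary Sullivan minimal model $(P_+)_\infty\to P_+$ exists. 2. Whenever $P_+$ has a unitary Sullivan minimal model $(P_+)_\infty\to P_+$, its truncation $P$ has a Sullivan minimal model, and for every such pair of models: $P_\infty$ admits a unitary extension $(P_\infty)_+$ (a dg operad with $(P_\infty)_+(0)\cong k$ and a morphism of dg operads $P_\infty\to(P_\infty)_+$ that is an isomorphism in positive arities) which underlies a unitary Sullivan minimal model of $P_+$, and there is an isomorphism of dg operads $$(P_+)_\infty\;\cong\;(P_\infty)_+ .$$ In particular $(P_+)_\infty\cong P_\infty\oplus k[1]$ as dg $\Sigma$-modules, where $k[1]$ is $k$ in arity $0$ and degree $0$, and zero elsewhere. -/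

import Mathlib

universe u

/-!
Conventions: `k` is a field, everything is `ℤ`-graded, differentials have degree `+1`. A graded
object is a family `X n p` indexed by the arity `n` and the degree `p`. The structure maps take
proofs of equations between arities and degrees as arguments (for example `l + 1 = m + n` for a
partial composition of operations of arities `m`, `n` that has arity `l`), so that no transport
along equalities is needed. Inputs are numbered from `0`.
-/

namespace OperadModels

/-! ### Bookkeeping of inputs in a partial composition -/

/-- The position, among the inputs of `x ∘ᵢ y`, of the input `j` of `y`. -/
def innerSlot {m n l : ℕ} (h : l + 1 = m + n) (i : Fin m) (j : Fin n) : Fin l :=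
  ⟨i + j, by omega⟩

/-- The position, among the inputs of `x ∘ᵢ y`, of the input `a ≠ i` of `x`. -/
def outerSlot {m n l : ℕ} (h : l + 1 = m + n) (i a : Fin m) (ha : a ≠ i) : Fin l :=
  ⟨if (a : ℕ) < i then a else a + n - 1, by
    have : (a : ℕ) ≠ i := fun e => ha (Fin.ext e)
    split <;> omega⟩

/-- The inputs of `x ∘ᵢ y` are those of `x` other than `i`, together with those of `y`. -/
noncomputable def slotEquiv {m n l : ℕ} (h : l + 1 = m + n) (i : Fin m) :
    {a : Fin m // a ≠ i} ⊕ Fin n ≃ Fin l :=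
  Equiv.ofBijective
    (Sum.elim (fun a => outerSlot h i a.1 a.2) (fun j => innerSlot h i j)) (by
      rw [Fintype.bijective_iff_injective_and_card]
      constructor
      · rintro (⟨a, ha⟩ | a) (⟨b, hb⟩ | b) hab
        · have ha' : (a : ℕ) ≠ i := fun e => ha (Fin.ext e)
          have hb' : (b : ℕ) ≠ i := fun e => hb (Fin.ext e)
          have := congrArg Fin.val hab
          simp only [Sum.elim_inl, outerSlot] at this
          congr 2
          apply Fin.ext
          split_ifs at this <;> omega
        · have ha' : (a : ℕ) ≠ i := fun e => ha (Fin.ext e)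
          have := congrArg Fin.val hab
          simp only [Sum.elim_inl, Sum.elim_inr, outerSlot, innerSlot] at this
          split_ifs at this <;> omega
        · have hb' : (b : ℕ) ≠ i := fun e => hb (Fin.ext e)
          have := congrArg Fin.val hab
          simp only [Sum.elim_inl, Sum.elim_inr, outerSlot, innerSlot] at this
          split_ifs at this <;> omega
        · have := congrArg Fin.val hab
          simp only [Sum.elim_inr, innerSlot] at this
          congr 1
          apply Fin.ext
          omega
      · have hi := i.2
        simp [Fintype.card_subtype_compl]
        omega)

/-- The permutation `σ ∘ᵢ τ` of the inputs of a partial composition: it acts as `τ` from the block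
inserted at `i` to the block inserted at `σ i`, and as `σ` on the other inputs. -/
noncomputable def blockPerm {m n l : ℕ} (h : l + 1 = m + n) (i : Fin m)
    (σ : Equiv.Perm (Fin m)) (τ : Equiv.Perm (Fin n)) : Equiv.Perm (Fin l) :=
  (slotEquiv h i).symm.trans
    ((Equiv.sumCongr (σ.subtypeEquiv fun a => by simp) τ).trans (slotEquiv h (σ i)))

/-- All of `V` if `c` holds, and `0` otherwise. -/
def supportedOn (k : Type u) [Field k] (V : Type u) [AddCommGroup V] [Module k V] (c : Prop) :
    Submodule k V where
  carrier := {x | ¬ c → x = 0}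
  zero_mem' := fun _ => rfl
  add_mem' := fun ha hb hc => by simp [ha hc, hb hc]
  smul_mem' := fun a x hx hc => by simp [hx hc]

/-- A graded vector space isomorphic to `k` (in degree `0`). -/
def IsGroundField (k : Type u) [Field k] (V : ℤ → Type u) [∀ p, AddCommGroup (V p)]
    [∀ p, Module k (V p)] : Prop :=
  Nonempty (V 0 ≃ₗ[k] k) ∧ ∀ p, p ≠ 0 → Subsingleton (V p)

/-! ### `Σ`-modules -/

/-- Graded `Σ`-modules: graded vector spaces `X n` with a right action of the symmetric group on
`n` letters. -/
structure GradedSigmaModule (k : Type u) [Field k] where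
  obj : ℕ → ℤ → Type u
  [addCommGroup : ∀ n p, AddCommGroup (obj n p)]
  [module : ∀ n p, Module k (obj n p)]
  act : ∀ {n : ℕ} {p : ℤ}, Equiv.Perm (Fin n) → obj n p →ₗ[k] obj n p
  act_one : ∀ {n : ℕ} {p : ℤ} (x : obj n p), act 1 x = x
  act_mul : ∀ {n : ℕ} {p : ℤ} (σ τ : Equiv.Perm (Fin n)) (x : obj n p),
    act (σ * τ) x = act τ (act σ x)

attribute [instance] GradedSigmaModule.addCommGroup GradedSigmaModule.module

/-- Differential graded `Σ`-modules. -/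
structure DGSigmaModule (k : Type u) [Field k] extends GradedSigmaModule k where
  d : ∀ {n : ℕ} {p q : ℤ}, p + 1 = q → obj n p →ₗ[k] obj n q
  d_d : ∀ {n : ℕ} {p q r : ℤ} (h : p + 1 = q) (h' : q + 1 = r) (x : obj n p), d h' (d h x) = 0
  d_act : ∀ {n : ℕ} {p q : ℤ} (h : p + 1 = q) (σ : Equiv.Perm (Fin n)) (x : obj n p),
    d h (act σ x) = act σ (d h x)

namespace DGSigmaModule

variable {k : Type u} [Field k]

/-- Morphisms of dg `Σ`-modules. -/
structure Hom (X Y : DGSigmaModule k) where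
  map : ∀ n p, X.obj n p →ₗ[k] Y.obj n p
  map_act : ∀ {n : ℕ} {p : ℤ} (σ : Equiv.Perm (Fin n)) (x : X.obj n p),
    map n p (X.act σ x) = Y.act σ (map n p x)
  map_d : ∀ {n : ℕ} {p q : ℤ} (h : p + 1 = q) (x : X.obj n p),
    map n q (X.d h x) = Y.d h (map n p x)

/-- Isomorphisms of dg `Σ`-modules. -/
def Hom.IsIso {X Y : DGSigmaModule k} (f : Hom X Y) : Prop :=
  ∀ n p, Function.Bijective (f.map n p)

/-- Cocycles of arity `n` and degree `p`. -/
def cocycles (X : DGSigmaModule k) (n : ℕ) (p : ℤ) : Submodule k (X.obj n p) :=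
  LinearMap.ker (X.d (rfl : p + 1 = p + 1))

/-- Coboundaries of arity `n` and degree `p`. -/
def coboundaries (X : DGSigmaModule k) (n : ℕ) (p : ℤ) : Submodule k (X.obj n p) :=
  LinearMap.range (X.d (sub_add_cancel p 1) : X.obj n (p - 1) →ₗ[k] X.obj n p)

/-- Cohomology in arity `n` and degree `p`. -/
abbrev cohomology (X : DGSigmaModule k) (n : ℕ) (p : ℤ) : Type u :=
  X.cocycles n p ⧸ (X.coboundaries n p).submoduleOf (X.cocycles n p)

/-- The map induced on cocycles. -/
def Hom.cocyclesMap {X Y : DGSigmaModule k} (f : Hom X Y) (n : ℕ) (p : ℤ) :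
    X.cocycles n p →ₗ[k] Y.cocycles n p :=
  (f.map n p).restrict fun x hx => by
    have hx' : X.d (rfl : p + 1 = p + 1) x = 0 := hx
    change Y.d (rfl : p + 1 = p + 1) (f.map n p x) = 0
    rw [← f.map_d, hx', map_zero]

/-- The map induced on cohomology. -/
def Hom.cohomologyMap {X Y : DGSigmaModule k} (f : Hom X Y) (n : ℕ) (p : ℤ) :
    X.cohomology n p →ₗ[k] Y.cohomology n p :=
  Submodule.mapQ _ _ (f.cocyclesMap n p) (by
    rintro ⟨x, hx⟩ ⟨y, hy⟩
    exact ⟨f.map n (p - 1) y, by rw [← f.map_d, hy]; rfl⟩)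

/-- Quasi-isomorphisms: isomorphisms on cohomology in every arity and degree. -/
def Hom.IsQuasiIso {X Y : DGSigmaModule k} (f : Hom X Y) : Prop :=
  ∀ n p, Function.Bijective (f.cohomologyMap n p)

/-- Direct sum of dg `Σ`-modules. -/
def directSum (X Y : DGSigmaModule k) : DGSigmaModule k where
  obj n p := X.obj n p × Y.obj n p
  act σ := (X.act σ).prodMap (Y.act σ)
  act_one x := by simp [X.act_one, Y.act_one]
  act_mul σ τ x := by simp [X.act_mul, Y.act_mul]
  d h := (X.d h).prodMap (Y.d h)
  d_d h h' x := by simp [X.d_d, Y.d_d]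
  d_act h σ x := by simp [X.d_act, Y.d_act]

/-- The dg `Σ`-module that is `k` in arity `0` and degree `0`, and zero elsewhere. -/
def groundInArityZero (k : Type u) [Field k] : DGSigmaModule k where
  obj n p := supportedOn k k (n = 0 ∧ p = 0)
  act _ := LinearMap.id
  act_one _ := rfl
  act_mul _ _ _ := rfl
  d _ := 0
  d_d _ _ _ := rfl
  d_act _ _ _ := rfl

end DGSigmaModule

/-! ### Operads -/

/-- Graded (symmetric) operads, through partial compositions; `circ h hr i x y` is `x ∘ᵢ y`. -/
structure GradedOperad (k : Type u) [Field k] extends GradedSigmaModule k where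
  one : obj 1 0
  circ : ∀ {m n l : ℕ} {p q r : ℤ}, l + 1 = m + n → p + q = r → Fin m →
    (obj m p →ₗ[k] obj n q →ₗ[k] obj l r)
  one_circ : ∀ {n : ℕ} {p : ℤ} (h : n + 1 = 1 + n) (hp : 0 + p = p) (x : obj n p),
    circ h hp 0 one x = x
  circ_one : ∀ {n : ℕ} {p : ℤ} (h : n + 1 = n + 1) (hp : p + 0 = p) (i : Fin n) (x : obj n p),
    circ h hp i x one = x
  /-- Sequential associativity: `(x ∘ᵢ y) ∘ z = x ∘ᵢ (y ∘ⱼ z)`, where `z` is inserted at the input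
  `j` of `y`. -/
  circ_circ_inner : ∀ {a b c ab bc abc : ℕ} {p q s pq qs pqs : ℤ}
    (h₁ : ab + 1 = a + b) (h₂ : abc + 1 = ab + c) (h₃ : bc + 1 = b + c) (h₄ : abc + 1 = a + bc)
    (e₁ : p + q = pq) (e₂ : pq + s = pqs) (e₃ : q + s = qs) (e₄ : p + qs = pqs)
    (i : Fin a) (j : Fin b) (x : obj a p) (y : obj b q) (z : obj c s),
    circ h₂ e₂ (innerSlot h₁ i j) (circ h₁ e₁ i x y) z = circ h₄ e₄ i x (circ h₃ e₃ j y z)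
  /-- Parallel associativity, for two different inputs `i` and `j` of `x`, with the Koszul sign. -/
  circ_circ_outer : ∀ {a b c ab ac abc : ℕ} {p q s pq ps pqs : ℤ}
    (h₁ : ab + 1 = a + b) (h₂ : abc + 1 = ab + c) (h₃ : ac + 1 = a + c) (h₄ : abc + 1 = ac + b)
    (e₁ : p + q = pq) (e₂ : pq + s = pqs) (e₃ : p + s = ps) (e₄ : ps + q = pqs)
    (i j : Fin a) (hij : i ≠ j) (x : obj a p) (y : obj b q) (z : obj c s),
    circ h₂ e₂ (outerSlot h₁ i j hij.symm) (circ h₁ e₁ i x y) z =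
      (q * s).negOnePow • circ h₄ e₄ (outerSlot h₃ j i hij) (circ h₃ e₃ j x z) y
  /-- Equivariance: `(x · σ) ∘ᵢ (y · τ) = (x ∘_{σ i} y) · (σ ∘ᵢ τ)`. -/
  circ_act : ∀ {m n l : ℕ} {p q r : ℤ} (h : l + 1 = m + n) (hr : p + q = r) (i : Fin m)
    (σ : Equiv.Perm (Fin m)) (τ : Equiv.Perm (Fin n)) (x : obj m p) (y : obj n q),
    circ h hr i (act σ x) (act τ y) = act (blockPerm h i σ τ) (circ h hr (σ i) x y)

/-- Differential graded operads. (The Leibniz rule implies that the identity is a cocycle.) -/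
structure DGOperad (k : Type u) [Field k] extends GradedOperad k, DGSigmaModule k where
  d_circ : ∀ {m n l : ℕ} {p q r p' q' r' : ℤ} (h : l + 1 = m + n) (hr : p + q = r)
    (hp' : p + 1 = p') (hq' : q + 1 = q') (hr' : r + 1 = r')
    (e₁ : p' + q = r') (e₂ : p + q' = r') (i : Fin m) (x : obj m p) (y : obj n q),
    d hr' (circ h hr i x y) =
      circ h e₁ i (d hp' x) y + p.negOnePow • circ h e₂ i x (d hq' y)

namespace GradedOperad

variable {k : Type u} [Field k]

/-- Morphisms of graded operads. -/
structure Hom (P Q : GradedOperad k) where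
  map : ∀ n p, P.obj n p →ₗ[k] Q.obj n p
  map_act : ∀ {n : ℕ} {p : ℤ} (σ : Equiv.Perm (Fin n)) (x : P.obj n p),
    map n p (P.act σ x) = Q.act σ (map n p x)
  map_one : map 1 0 P.one = Q.one
  map_circ : ∀ {m n l : ℕ} {p q r : ℤ} (h : l + 1 = m + n) (hr : p + q = r) (i : Fin m)
    (x : P.obj m p) (y : P.obj n q),
    map l r (P.circ h hr i x y) = Q.circ h hr i (map m p x) (map n q y)

/-- Membership in the graded suboperad of `P` generated by the elements `G`. -/
inductive Generated (P : GradedOperad k) (G : ∀ n p, Set (P.obj n p)) :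
    ∀ {n : ℕ} {p : ℤ}, P.obj n p → Prop
  | of {n : ℕ} {p : ℤ} (x : P.obj n p) : x ∈ G n p → Generated P G x
  | one : Generated P G P.one
  | zero {n : ℕ} {p : ℤ} : Generated P G (0 : P.obj n p)
  | add {n : ℕ} {p : ℤ} (x y : P.obj n p) :
      Generated P G x → Generated P G y → Generated P G (x + y)
  | smul {n : ℕ} {p : ℤ} (c : k) (x : P.obj n p) : Generated P G x → Generated P G (c • x)
  | act {n : ℕ} {p : ℤ} (σ : Equiv.Perm (Fin n)) (x : P.obj n p) :
      Generated P G x → Generated P G (P.act σ x)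
  | circ {m n l : ℕ} {p q r : ℤ} (h : l + 1 = m + n) (hr : p + q = r) (i : Fin m)
      (x : P.obj m p) (y : P.obj n q) :
      Generated P G x → Generated P G y → Generated P G (P.circ h hr i x y)

/-- `P` is the free graded operad on its graded `Σ`-submodule `E`: every morphism of graded
`Σ`-modules from `E` to a graded operad extends uniquely to a morphism of graded operads. -/
def IsFreeOn (P : GradedOperad k) (E : ∀ n p, Submodule k (P.obj n p)) : Prop :=
  (∀ (n : ℕ) (p : ℤ) (σ : Equiv.Perm (Fin n)) (e : P.obj n p), e ∈ E n p → P.act σ e ∈ E n p) ∧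
  ∀ (Q : GradedOperad k) (f : ∀ n p, E n p →ₗ[k] Q.obj n p),
    (∀ (n : ℕ) (p : ℤ) (σ : Equiv.Perm (Fin n)) (e e' : E n p),
      (e' : P.obj n p) = P.act σ e → f n p e' = Q.act σ (f n p e)) →
    ∃! φ : Hom P Q, ∀ (n : ℕ) (p : ℤ) (e : E n p), φ.map n p e = f n p e

end GradedOperad

namespace DGOperad

variable {k : Type u} [Field k]

/-- Morphisms of dg operads. -/
structure Hom (P Q : DGOperad k) extends GradedOperad.Hom P.toGradedOperad Q.toGradedOperad where
  map_d : ∀ {n : ℕ} {p q : ℤ} (h : p + 1 = q) (x : P.obj n p),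
    map n q (P.d h x) = Q.d h (map n p x)

/-- The underlying morphism of dg `Σ`-modules. -/
def Hom.toSigmaHom {P Q : DGOperad k} (f : Hom P Q) :
    DGSigmaModule.Hom P.toDGSigmaModule Q.toDGSigmaModule where
  map := f.map
  map_act := f.map_act
  map_d := f.map_d

/-- Isomorphisms of dg operads. -/
def Hom.IsIso {P Q : DGOperad k} (f : Hom P Q) : Prop :=
  f.toSigmaHom.IsIso

/-- Quasi-isomorphisms of dg operads. -/
def Hom.IsQuasiIso {P Q : DGOperad k} (f : Hom P Q) : Prop :=
  f.toSigmaHom.IsQuasiIso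

/-- `P(0) = 0`. -/
def IsNonUnitary (P : DGOperad k) : Prop :=
  ∀ p, Subsingleton (P.obj 0 p)

/-- `P(0) = k`. -/
def IsUnitary (P : DGOperad k) : Prop :=
  IsGroundField k (P.obj 0)

/-- `HP(0) = k`. -/
def IsCohomologicallyUnitary (P : DGOperad k) : Prop :=
  IsGroundField k (P.toDGSigmaModule.cohomology 0)

/-- `HP(1) = k`. -/
def IsCohomologicallyConnected (P : DGOperad k) : Prop :=
  IsGroundField k (P.toDGSigmaModule.cohomology 1)

/-- Operads with unitary multiplication, that is, operads `P` that receive a morphism from the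
operad of unital associative algebras: there are cocycles `μ` in `P(2)` and `u` in `P(0)`, of
degree `0`, such that `μ` is associative with two-sided unit `u`. -/
def HasUnitaryMultiplication (P : DGOperad k) : Prop :=
  ∃ (μ : P.obj 2 0) (u : P.obj 0 0),
    (P.circ (by norm_num : 3 + 1 = 2 + 2) (add_zero 0) 0 μ μ : P.obj 3 0) =
      P.circ (by norm_num : 3 + 1 = 2 + 2) (add_zero 0) 1 μ μ ∧
    (P.circ (by norm_num : 1 + 1 = 2 + 0) (add_zero 0) 0 μ u : P.obj 1 0) = P.one ∧
    (P.circ (by norm_num : 1 + 1 = 2 + 0) (add_zero 0) 1 μ u : P.obj 1 0) = P.one ∧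
    P.d (zero_add 1) μ = 0 ∧ P.d (zero_add 1) u = 0

/-- The truncation of `P`: the suboperad which is zero in arity `0` and `P(n)` in arities
`n > 0`. -/
def truncation (P : DGOperad k) : DGOperad k where
  obj n p := supportedOn k (P.obj n p) (n ≠ 0)
  act σ := (P.act σ).restrict fun x hx hc => by rw [hx hc, map_zero]
  act_one x := Subtype.ext (P.act_one x.1)
  act_mul σ τ x := Subtype.ext (P.act_mul σ τ x.1)
  one := ⟨P.one, fun hc => absurd one_ne_zero hc⟩
  circ {m n l p q r} h hr i :=
    LinearMap.mk₂ k
      (fun x y => ⟨P.circ h hr i x.1 y.1, fun hc => by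
        have hi := i.2
        rw [y.2 (by omega), map_zero]⟩)
      (fun x x' y => Subtype.ext (by simp))
      (fun c x y => Subtype.ext (by simp))
      (fun x y y' => Subtype.ext (by simp))
      (fun c x y => Subtype.ext (by simp))
  one_circ h hp x := Subtype.ext (P.one_circ h hp x.1)
  circ_one h hp i x := Subtype.ext (P.circ_one h hp i x.1)
  circ_circ_inner h₁ h₂ h₃ h₄ e₁ e₂ e₃ e₄ i j x y z :=
    Subtype.ext (P.circ_circ_inner h₁ h₂ h₃ h₄ e₁ e₂ e₃ e₄ i j x.1 y.1 z.1)
  circ_circ_outer h₁ h₂ h₃ h₄ e₁ e₂ e₃ e₄ i j hij x y z :=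
    Subtype.ext (P.circ_circ_outer h₁ h₂ h₃ h₄ e₁ e₂ e₃ e₄ i j hij x.1 y.1 z.1)
  circ_act h hr i σ τ x y := Subtype.ext (P.circ_act h hr i σ τ x.1 y.1)
  d h := (P.d h).restrict fun x hx hc => by rw [hx hc, map_zero]
  d_d h h' x := Subtype.ext (P.d_d h h' x.1)
  d_act h σ x := Subtype.ext (P.d_act h σ x.1)
  d_circ h hr hp' hq' hr' e₁ e₂ i x y :=
    Subtype.ext (P.d_circ h hr hp' hq' hr' e₁ e₂ i x.1 y.1)

/-- `i : P → Q` exhibits the unitary operad `Q` as a unitary extension of the non-unitary operad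
`P`: it identifies `P(n)` with `Q(n)` for `n > 0`, compatibly with the operad structures. -/
def Hom.IsUnitaryExtension {P Q : DGOperad k} (i : Hom P Q) : Prop :=
  P.IsNonUnitary ∧ Q.IsUnitary ∧ ∀ (n : ℕ) (p : ℤ), 0 < n → Function.Bijective (i.map n p)

/-! ### Sullivan minimal operads and minimal models -/

/-- Membership in the stage of `P` below `n`: the graded suboperad generated by the `E(m)` with
`m < n`. When `P` is free on `E`, it is the free operad on the sum of these `E(m)`. -/
def StageBelow (P : DGOperad k) (E : ∀ n p, Submodule k (P.obj n p)) (n : ℕ)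
    {l : ℕ} {p : ℤ} (x : P.obj l p) : Prop :=
  P.toGradedOperad.Generated (fun m q => {y | m < n ∧ y ∈ E m q}) x

/-- The generators `E` exhibit `P` as the colimit of successive principal extensions
`I → Γ(E(2)) → Γ(E(2) ⊕ E(3)) → ⋯` of strictly increasing arities: `E(0) = E(1) = 0`, as a graded
operad `P` is free on `E`, and the differential of `E(n)` takes values in the previous stage. -/
structure IsMinimalPresentation (P : DGOperad k) (E : ∀ n p, Submodule k (P.obj n p)) : Prop where
  arity_zero : ∀ p, E 0 p = ⊥
  arity_one : ∀ p, E 1 p = ⊥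
  free : P.toGradedOperad.IsFreeOn E
  d_mem : ∀ {n : ℕ} {p q : ℤ} (h : p + 1 = q) (e : P.obj n p), e ∈ E n p →
    P.StageBelow E n (P.d h e)

/-- (Non-unitary) Sullivan minimal operads. -/
def IsSullivanMinimal (P : DGOperad k) : Prop :=
  ∃ E : ∀ n p, Submodule k (P.obj n p), P.IsMinimalPresentation E

/-- Unitary Sullivan minimal operads: colimits of successive unitary principal extensions of
strictly increasing arities, starting from the initial unitary operad. Each stage is the unitary
extension of a free operad (so that `P(0) = k`, and in positive arities `P` is the free operad on
the generators `E`), and on `E(n)` both the differential and the restriction operations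
`e ↦ e ∘ᵢ u`, for `u` in `P(0) = k`, take values in the previous stage. -/
def IsUnitarySullivanMinimal (P : DGOperad k) : Prop :=
  P.IsUnitary ∧
  ∃ E : ∀ n p, Submodule k (P.truncation.obj n p),
    P.truncation.IsMinimalPresentation E ∧
    ∀ {n l : ℕ} {p : ℤ} (h : l + 1 = n + 0) (hp : p + 0 = p) (i : Fin n)
      (e : P.truncation.obj n p) (u : P.obj 0 0), e ∈ E n p →
      ∃ y : P.truncation.obj l p, P.truncation.StageBelow E n y ∧ y.1 = P.circ h hp i e.1 u

/-- (Non-unitary) Sullivan minimal models. -/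
def Hom.IsMinimalModel {S P : DGOperad k} (ρ : Hom S P) : Prop :=
  S.IsSullivanMinimal ∧ ρ.IsQuasiIso

/-- Unitary Sullivan minimal models. -/
def Hom.IsUnitaryMinimalModel {S P : DGOperad k} (ρ : Hom S P) : Prop :=
  S.IsUnitarySullivanMinimal ∧ ρ.IsQuasiIso

end DGOperad

end OperadModels

/-! ### Morphisms of graded operads, generated suboperads, formal consequences of freeness. -/

namespace OperadModels

variable {k : Type u} [Field k]

namespace GradedOperad

/-! The second assertion rests on the uniqueness of Sullivan minimal models. Minimality of a unitary
operad `S` is a condition on its truncation, so a unitary minimal model `S → P` truncates to a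
minimal model of `P.truncation`. Any other minimal model `M` of the truncation is therefore
isomorphic to `S.truncation`, and `S` itself, with the composite `M ≅ S.truncation → S`, is the
required unitary extension of `M`. As a dg `Σ`-module a unitary operad is the sum of its truncation
and of `k` in arity `0`.

Uniqueness (`exists_iso_of_isMinimalModel`) has three ingredients. A minimal operad lifts through
surjective quasi-isomorphisms (`IsMinimalPresentation.exists_lift`): values on generators are chosen
arity by arity, and characteristic zero makes the linear choices equivariant by averaging. A
quasi-isomorphism `ρ' : M' → Q` is replaced by the pullback of `ρ'` and of evaluation at `0` on the
path object `Q ⊗ Λ(t, dt)`; this pullback maps by surjective quasi-isomorphisms both to `M'` and,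
through evaluation at `1`, to `Q`. Lifting another model `ρ : M → Q` to the pullback and projecting
gives a quasi-isomorphism `M → M'`. Finally a quasi-isomorphism of minimal operads is an isomorphism
(`IsMinimalPresentation.isIso_of_isQuasiIso`), by induction on the arity: differentials of
operations of arity `n` only involve generators of smaller arity.

For the first assertion, a unitary operad whose truncation has only multiples of the identity in
arity `1` is encoded by its truncation `F` and the maps `x ↦ x ∘ᵢ u`, called restrictions; this is
the structure `RestrictedOperad`, and `RestrictedOperad.unitary` puts the unit back. If `F` is free,
differential and restrictions can be prescribed on generators. A derivation is a morphism from `F`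
to `F ⊕ ηF` with first component the identity, and a system of restrictions is a morphism from `F`
to the operad `jet` of operations with formal restrictions. The identities `d² = 0`, commutation of
restrictions with each other and with `d`, then only have to be checked on generators.

The model is built arity by arity, with a map `ρ` to `P` that strictly takes restrictions to
compositions with the unit `u` of `P`. It starts from one binary generator, sent to the symmetrized
multiplication, whose two restrictions are the identity. In arity `n` one has to kill the relative
cohomology of `ρ`, whose cocycles are pairs `(a, b)` with `da = 0` and `db = ρ a`. The binary
operation provides degeneracies, and as for simplicial objects every relative cocycle is
cohomologous to one whose restrictions all vanish (`Hom.exists_normalized`). So it suffices to add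
as generators the normalized relative cohomology, with zero restrictions; strict compatibility with
`u` is then automatic. An equivariant choice of representatives exists in characteristic zero
(`exists_isComplete`), and the enlarged `ρ` is a quasi-isomorphism in arity `n`
(`IsComplete.relLifts`). The construction is stationary in each arity, so its colimit
(`Tower.colimit`) is a minimal model in positive arities. Its unitary extension is right in arity
`0` as well, since `HP(0) = k` is spanned by the class of `u`. -/

/-- The identity morphism. -/
def Hom.id (P : GradedOperad k) : Hom P P where
  map _ _ := LinearMap.id
  map_act _ _ := rfl
  map_one := rfl
  map_circ _ _ _ _ _ := rfl

/-- Composition of morphisms. -/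
def Hom.comp {P Q R : GradedOperad k} (g : Hom Q R) (f : Hom P Q) : Hom P R where
  map n p := (g.map n p).comp (f.map n p)
  map_act σ x := by simp [f.map_act, g.map_act]
  map_one := by simp [f.map_one, g.map_one]
  map_circ h hr i x y := by simp [f.map_circ, g.map_circ]

@[simp] theorem Hom.id_map {P : GradedOperad k} {n p} (x : P.obj n p) :
    (Hom.id P).map n p x = x := rfl

@[simp] theorem Hom.comp_map {P Q R : GradedOperad k} (g : Hom Q R) (f : Hom P Q) {n p}
    (x : P.obj n p) : (g.comp f).map n p x = g.map n p (f.map n p x) := rfl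

theorem Hom.ext' {P Q : GradedOperad k} {f g : Hom P Q}
    (h : ∀ n p x, f.map n p x = g.map n p x) : f = g := by
  cases f; cases g
  congr
  funext n p
  exact LinearMap.ext (h n p)

/-- The inverse of a bijective morphism. -/
noncomputable def Hom.inverse {P Q : GradedOperad k} (f : Hom P Q)
    (hf : ∀ n p, Function.Bijective (f.map n p)) : Hom Q P where
  map n p := ((LinearEquiv.ofBijective (f.map n p) (hf n p)).symm : Q.obj n p →ₗ[k] P.obj n p)
  map_act {n p} σ x := by
    apply (hf n p).1
    have h (y : Q.obj n p) : f.map n p ((LinearEquiv.ofBijective (f.map n p) (hf n p)).symm y) = y :=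
      LinearEquiv.apply_symm_apply (LinearEquiv.ofBijective (f.map n p) (hf n p)) y
    simp only [LinearEquiv.coe_coe]
    rw [f.map_act, h, h]
  map_one := by
    apply (hf 1 0).1
    rw [f.map_one]
    exact LinearEquiv.apply_symm_apply (LinearEquiv.ofBijective (f.map 1 0) (hf 1 0)) _
  map_circ {m n l p q r} h hr i x y := by
    apply (hf l r).1
    have h (n p) (y : Q.obj n p) :
        f.map n p ((LinearEquiv.ofBijective (f.map n p) (hf n p)).symm y) = y :=
      LinearEquiv.apply_symm_apply (LinearEquiv.ofBijective (f.map n p) (hf n p)) y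
    simp only [LinearEquiv.coe_coe]
    rw [f.map_circ, h, h, h]

@[simp] theorem Hom.map_inverse {P Q : GradedOperad k} (f : Hom P Q)
    (hf : ∀ n p, Function.Bijective (f.map n p)) {n p} (y : Q.obj n p) :
    f.map n p ((f.inverse hf).map n p y) = y :=
  LinearEquiv.apply_symm_apply (LinearEquiv.ofBijective (f.map n p) (hf n p)) y

@[simp] theorem Hom.inverse_map {P Q : GradedOperad k} (f : Hom P Q)
    (hf : ∀ n p, Function.Bijective (f.map n p)) {n p} (x : P.obj n p) :
    (f.inverse hf).map n p (f.map n p x) = x :=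
  (hf n p).1 (by simp)

theorem Generated.mono {P : GradedOperad k} {G G' : ∀ n p, Set (P.obj n p)}
    (hG : ∀ n p x, x ∈ G n p → x ∈ G' n p) {n p} {x : P.obj n p} (hx : P.Generated G x) :
    P.Generated G' x := by
  induction hx with
  | of x hx => exact .of x (hG _ _ x hx)
  | one => exact .one
  | zero => exact .zero
  | add x y _ _ hx hy => exact .add x y hx hy
  | smul c x _ hx => exact .smul c x hx
  | act σ x _ hx => exact .act σ x hx
  | circ h hr i x y _ _ hx hy => exact .circ h hr i x y hx hy

theorem Generated.map {P Q : GradedOperad k} (f : Hom P Q) {G : ∀ n p, Set (P.obj n p)}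
    {G' : ∀ n p, Set (Q.obj n p)}
    (hG : ∀ n p x, x ∈ G n p → Q.Generated G' (f.map n p x)) {n p} {x : P.obj n p}
    (hx : P.Generated G x) : Q.Generated G' (f.map n p x) := by
  induction hx with
  | of x hx => exact hG _ _ x hx
  | one => rw [f.map_one]; exact .one
  | zero => rw [map_zero]; exact .zero
  | add x y _ _ hx hy => rw [map_add]; exact .add _ _ hx hy
  | smul c x _ hx => rw [map_smul]; exact .smul c _ hx
  | act σ x _ hx => rw [f.map_act]; exact .act σ _ hx
  | circ h hr i x y _ _ hx hy => rw [f.map_circ]; exact .circ h hr i _ _ hx hy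

theorem Generated.hom_eq {P Q : GradedOperad k} (f g : Hom P Q) {G : ∀ n p, Set (P.obj n p)}
    (hG : ∀ n p x, x ∈ G n p → f.map n p x = g.map n p x) {n p} {x : P.obj n p}
    (hx : P.Generated G x) : f.map n p x = g.map n p x := by
  induction hx with
  | of x hx => exact hG _ _ x hx
  | one => rw [f.map_one, g.map_one]
  | zero => rw [map_zero, map_zero]
  | add x y _ _ hx hy => rw [map_add, map_add, hx, hy]
  | smul c x _ hx => rw [map_smul, map_smul, hx]
  | act σ x _ hx => rw [f.map_act, g.map_act, hx]
  | circ h hr i x y _ _ hx hy => rw [f.map_circ, g.map_circ, hx, hy]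

/-- Graded suboperads. -/
def subOperad (P : GradedOperad k) (W : ∀ n p, Submodule k (P.obj n p)) (h1 : P.one ∈ W 1 0)
    (hact : ∀ {n p} (σ : Equiv.Perm (Fin n)) (x : P.obj n p), x ∈ W n p → P.act σ x ∈ W n p)
    (hcirc : ∀ {m n l p q r} (h : l + 1 = m + n) (hr : p + q = r) (i : Fin m) (x : P.obj m p)
      (y : P.obj n q), x ∈ W m p → y ∈ W n q → P.circ h hr i x y ∈ W l r) : GradedOperad k where
  obj n p := W n p
  act σ := (P.act σ).restrict (hact σ)
  act_one x := Subtype.ext (P.act_one x.1)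
  act_mul σ τ x := Subtype.ext (P.act_mul σ τ x.1)
  one := ⟨P.one, h1⟩
  circ h hr i := LinearMap.mk₂ k
      (fun x y => ⟨P.circ h hr i x.1 y.1, hcirc h hr i _ _ x.2 y.2⟩)
      (fun x x' y => Subtype.ext (by simp))
      (fun c x y => Subtype.ext (by simp))
      (fun x y y' => Subtype.ext (by simp))
      (fun c x y => Subtype.ext (by simp))
  one_circ h hp x := Subtype.ext (P.one_circ h hp x.1)
  circ_one h hp i x := Subtype.ext (P.circ_one h hp i x.1)
  circ_circ_inner h₁ h₂ h₃ h₄ e₁ e₂ e₃ e₄ i j x y z :=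
    Subtype.ext (P.circ_circ_inner h₁ h₂ h₃ h₄ e₁ e₂ e₃ e₄ i j x.1 y.1 z.1)
  circ_circ_outer h₁ h₂ h₃ h₄ e₁ e₂ e₃ e₄ i j hij x y z :=
    Subtype.ext (P.circ_circ_outer h₁ h₂ h₃ h₄ e₁ e₂ e₃ e₄ i j hij x.1 y.1 z.1)
  circ_act h hr i σ τ x y := Subtype.ext (P.circ_act h hr i σ τ x.1 y.1)

/-- The suboperad generated by `G`. -/
def generatedSuboperad (P : GradedOperad k) (G : ∀ n p, Set (P.obj n p)) : GradedOperad k :=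
  P.subOperad (fun n p =>
    { carrier := {x | P.Generated G x}
      zero_mem' := .zero
      add_mem' := fun ha hb => .add _ _ ha hb
      smul_mem' := fun c _ hx => .smul c _ hx })
    .one (fun σ x hx => .act σ x hx) (fun h hr i x y hx hy => .circ h hr i x y hx hy)

/-- The inclusion of the suboperad generated by `G`. -/
def generatedInclusion (P : GradedOperad k) (G : ∀ n p, Set (P.obj n p)) :
    Hom (P.generatedSuboperad G) P where
  map n p := Submodule.subtype _
  map_act _ _ := rfl
  map_one := rfl
  map_circ _ _ _ _ _ := rfl

/-- Uniqueness in the universal property, applied to the common restriction of `f` and `g` to the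
generators. -/
theorem IsFreeOn.hom_eq {P Q : GradedOperad k} {E : ∀ n p, Submodule k (P.obj n p)}
    (hE : P.IsFreeOn E) (f g : Hom P Q)
    (hfg : ∀ n p (e : P.obj n p), e ∈ E n p → f.map n p e = g.map n p e) : f = g := by
  obtain ⟨φ, -, hφ⟩ := hE.2 Q (fun n p => (f.map n p).comp (E n p).subtype) (by
    intro n p σ e e' he
    simp [he, f.map_act])
  rw [hφ f (fun n p e => rfl), hφ g (fun n p e => (hfg n p e e.2).symm)]

/-- The universal property gives a morphism from `P` to the suboperad generated by `E`, and its
composite with the inclusion fixes `E`, hence is the identity. This turns freeness, which is only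
defined by a universal property, into a principle of induction. -/
theorem IsFreeOn.generated {P : GradedOperad k} {E : ∀ n p, Submodule k (P.obj n p)}
    (hE : P.IsFreeOn E) {n p} (x : P.obj n p) :
    P.Generated (fun n p => (E n p : Set (P.obj n p))) x := by
  let G : ∀ n p, Set (P.obj n p) := fun n p => (E n p : Set (P.obj n p))
  obtain ⟨φ, hφ, -⟩ := hE.2 (P.generatedSuboperad G)
    (fun n p => (E n p).subtype.codRestrict _ fun e => Generated.of e.1 e.2) (by
    intro n p σ e e' he
    exact Subtype.ext he)
  have := hE.hom_eq ((P.generatedInclusion G).comp φ) (Hom.id P) (by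
    intro n p e he
    have := hφ n p ⟨e, he⟩
    simp only [Hom.comp_map, this]
    rfl)
  have h2 := congrArg (fun f : Hom P P => f.map n p x) this
  simp only [Hom.comp_map, Hom.id_map] at h2
  rw [← h2]
  exact (φ.map n p x).2

/-- Morphisms out of a free operad exist for any equivariant maps given below arity `n`; they are
extended by zero on the other generators. -/
theorem IsFreeOn.exists_hom_below {P Q : GradedOperad k} {E : ∀ n p, Submodule k (P.obj n p)}
    (hE : P.IsFreeOn E) (n : ℕ) (f : ∀ m p, m < n → (E m p →ₗ[k] Q.obj m p))
    (hf : ∀ (m : ℕ) (p : ℤ) (hm : m < n) (σ : Equiv.Perm (Fin m)) (e e' : E m p),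
      (e' : P.obj m p) = P.act σ e → f m p hm e' = Q.act σ (f m p hm e)) :
    ∃ φ : Hom P Q, (∀ m p (hm : m < n) (e : E m p), φ.map m p e = f m p hm e) ∧
      ∀ m p, n ≤ m → ∀ e ∈ E m p, φ.map m p e = 0 := by
  obtain ⟨φ, hφ, -⟩ := hE.2 Q (fun m p => if hm : m < n then f m p hm else 0) (by
    intro m p σ e e' he
    by_cases hm : m < n
    · simp only [hm, dite_true]
      exact hf m p hm σ e e' he
    · simp [hm])
  refine ⟨φ, fun m p hm e => ?_, fun m p hm e he => ?_⟩
  · rw [hφ]; simp [hm]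
  · rw [hφ m p ⟨e, he⟩]; simp [Nat.not_lt.mpr hm]

/-- A morphism out of a free operad may be changed on the generators of arity `n`. -/
theorem IsFreeOn.exists_update {P Q : GradedOperad k} {E : ∀ n p, Submodule k (P.obj n p)}
    (hE : P.IsFreeOn E) (φ : Hom P Q) (n : ℕ) (g : ∀ p, E n p →ₗ[k] Q.obj n p)
    (hg : ∀ (p : ℤ) (σ : Equiv.Perm (Fin n)) (e e' : E n p),
      (e' : P.obj n p) = P.act σ e → g p e' = Q.act σ (g p e)) :
    ∃ ψ : Hom P Q, (∀ m p, m ≠ n → ∀ e ∈ E m p, ψ.map m p e = φ.map m p e) ∧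
      ∀ p (e : E n p), ψ.map n p e = g p e := by
  obtain ⟨ψ, hψ, -⟩ := hE.2 Q (fun m p => if hm : m = n then by subst hm; exact g p
      else (φ.map m p).comp (E m p).subtype) (by
    intro m p σ e e' he
    by_cases hm : m = n
    · subst hm
      simpa using hg p σ e e' he
    · simp [hm, he, φ.map_act])
  refine ⟨ψ, fun m p hm e he => ?_, fun p e => ?_⟩
  · rw [hψ m p ⟨e, he⟩]; simp [hm]
  · rw [hψ]; simp

/-- Freeness is transported along isomorphisms. -/
theorem IsFreeOn.transport {P Q : GradedOperad k} {E : ∀ n p, Submodule k (P.obj n p)}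
    (hE : P.IsFreeOn E) (f : Hom P Q) (hf : ∀ n p, Function.Bijective (f.map n p)) :
    Q.IsFreeOn (fun n p => (E n p).map (f.map n p)) := by
  constructor
  · rintro n p σ _ ⟨e, he, rfl⟩
    exact ⟨_, hE.1 n p σ e he, f.map_act σ e⟩
  · intro R g hg
    obtain ⟨φ, hφ, -⟩ := hE.2 R
      (fun n p => (g n p).comp ((f.map n p).restrict fun x hx => Submodule.mem_map_of_mem hx)) (by
      intro n p σ e e' he
      exact hg n p σ _ _ (by simp [he, f.map_act]))
    refine ⟨φ.comp (f.inverse hf), ?_, ?_⟩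
    · rintro n p ⟨_, e, he, rfl⟩
      simp only [Hom.comp_map, Hom.inverse_map]
      rw [hφ n p ⟨e, he⟩]
      rfl
    · intro ψ hψ
      have : ψ.comp f = φ := by
        apply hE.hom_eq
        intro n p e he
        rw [Hom.comp_map, hψ n p ⟨_, Submodule.mem_map_of_mem he⟩, hφ n p ⟨e, he⟩]
        rfl
      apply Hom.ext'
      intro n p x
      rw [← this]
      simp

end GradedOperad
end OperadModels

/-! ### Reduced operads and the stages of a free operad. -/

namespace OperadModels

variable {k : Type u} [Field k]

namespace GradedOperad

/-- Scalar multiples of the identity operation. -/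
inductive IsScalar (P : GradedOperad k) : ∀ {n : ℕ} {p : ℤ}, P.obj n p → Prop
  | zero {n : ℕ} {p : ℤ} : IsScalar P (0 : P.obj n p)
  | smul_one (c : k) : IsScalar P (c • P.one)

/-- Operads with nothing in arity `0` and only multiples of the identity in arity `1`. -/
structure IsReduced (P : GradedOperad k) : Prop where
  eq_zero : ∀ {p : ℤ} (x : P.obj 0 p), x = 0
  isScalar : ∀ {p : ℤ} (x : P.obj 1 p), P.IsScalar x

theorem IsScalar.add {P : GradedOperad k} {n p} {x y : P.obj n p} (hx : P.IsScalar x)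
    (hy : P.IsScalar y) : P.IsScalar (x + y) := by
  cases hx with
  | zero => rwa [zero_add]
  | smul_one c =>
    cases hy with
    | zero => rw [add_zero]; exact .smul_one c
    | smul_one c' => rw [← add_smul]; exact .smul_one _

theorem IsScalar.smul {P : GradedOperad k} {n p} {x : P.obj n p} (hx : P.IsScalar x)
    (c : k) : P.IsScalar (c • x) := by
  cases hx with
  | zero => rw [smul_zero]; exact .zero
  | smul_one c' => rw [smul_smul]; exact .smul_one _

theorem IsScalar.act {P : GradedOperad k} {n p} {x : P.obj n p} (hx : P.IsScalar x)
    (σ : Equiv.Perm (Fin n)) : P.IsScalar (P.act σ x) := by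
  cases hx with
  | zero => rw [map_zero]; exact .zero
  | smul_one c' =>
    rw [Subsingleton.elim σ 1, P.act_one]; exact .smul_one _

/-- A property stable under scalars is stable under inserting scalar operations. -/
theorem IsScalar.circ_right {P : GradedOperad k} (C : ∀ n p, P.obj n p → Prop)
    (h0 : ∀ n p, C n p 0) (hs : ∀ n p (c : k) x, C n p x → C n p (c • x))
    {m n l p q r} (h : l + 1 = m + n) (hr : p + q = r) (i : Fin m)
    {x : P.obj m p} {y : P.obj n q} (hy : P.IsScalar y) (hx : C m p x) :
    C l r (P.circ h hr i x y) := by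
  cases hy with
  | zero => rw [map_zero]; exact h0 _ _
  | smul_one c =>
    obtain rfl : l = m := by omega
    obtain rfl : p = r := by omega
    rw [map_smul, P.circ_one]
    exact hs _ _ c x hx

/-- A property stable under scalars is stable under insertion in scalar operations. -/
theorem IsScalar.circ_left {P : GradedOperad k} (C : ∀ n p, P.obj n p → Prop)
    (h0 : ∀ n p, C n p 0) (hs : ∀ n p (c : k) x, C n p x → C n p (c • x))
    {m n l p q r} (h : l + 1 = m + n) (hr : p + q = r) (i : Fin m)
    {x : P.obj m p} {y : P.obj n q} (hx : P.IsScalar x) (hy : C n q y) :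
    C l r (P.circ h hr i x y) := by
  cases hx with
  | zero => rw [map_zero, LinearMap.zero_apply]; exact h0 _ _
  | smul_one c =>
    obtain rfl : l = n := by omega
    obtain rfl : q = r := by omega
    obtain rfl : i = 0 := Subsingleton.elim _ _
    rw [map_smul, LinearMap.smul_apply, P.one_circ]
    exact hs _ _ c y hy

theorem IsScalar.circ {P : GradedOperad k} {m n l p q r} (h : l + 1 = m + n) (hr : p + q = r)
    (i : Fin m) {x : P.obj m p} {y : P.obj n q} (hx : P.IsScalar x) (hy : P.IsScalar y) :
    P.IsScalar (P.circ h hr i x y) :=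
  hy.circ_right (fun _ _ x => P.IsScalar x) (fun _ _ => .zero) (fun _ _ c _ hx => hx.smul c) h hr i
    hx

/-- Without nonzero generators there are only scalar operations. -/
theorem Generated.isScalar {P : GradedOperad k} {G : ∀ n p, Set (P.obj n p)}
    (hG : ∀ n p x, x ∈ G n p → x = 0) {n p} {x : P.obj n p} (hx : P.Generated G x) :
    P.IsScalar x := by
  induction hx with
  | of x hx => rw [hG _ _ x hx]; exact .zero
  | one => rw [← one_smul k P.one]; exact .smul_one 1
  | zero => exact .zero
  | add x y _ _ hx hy => exact hx.add hy
  | smul c x _ hx => exact hx.smul c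
  | act σ x _ hx => exact hx.act σ
  | circ h hr i x y _ _ hx hy => exact hx.circ h hr i hy

/-- For `x ∘ᵢ y` one has `l + 1 = m + n` with `m ≥ 1`. So `l = 0` forces `n = 0`, and `l = 1` forces
`n = 0` or `m = n = 1`: the two claims have to be proved together. -/
theorem Generated.reduced {P : GradedOperad k} {G : ∀ n p, Set (P.obj n p)}
    (hG : ∀ n p x, x ∈ G n p → n < 2 → x = 0) {n p} {x : P.obj n p} (hx : P.Generated G x) :
    (n = 0 → x = 0) ∧ (n = 1 → P.IsScalar x) := by
  induction hx with
  | of x hx =>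
    refine ⟨fun h => hG _ _ x hx (by omega), fun h => ?_⟩
    rw [hG _ _ x hx (by omega)]; exact .zero
  | one => exact ⟨fun h => absurd h one_ne_zero, fun _ => by
      rw [← one_smul k P.one]; exact .smul_one 1⟩
  | zero => exact ⟨fun _ => rfl, fun _ => .zero⟩
  | add x y _ _ hx hy =>
    exact ⟨fun h => by rw [hx.1 h, hy.1 h, add_zero], fun h => (hx.2 h).add (hy.2 h)⟩
  | smul c x _ hx => exact ⟨fun h => by rw [hx.1 h, smul_zero], fun h => (hx.2 h).smul c⟩
  | act σ x _ hx => exact ⟨fun h => by rw [hx.1 h, map_zero], fun h => (hx.2 h).act σ⟩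
  | @circ m n l p q r h hr i x y _ _ hx hy =>
    have hi := i.2
    constructor
    · intro hl
      rw [hy.1 (by omega), map_zero]
    · intro hl
      by_cases hn : n = 0
      · rw [hy.1 hn, map_zero]; exact .zero
      · exact (hx.2 (by omega)).circ h hr i (hy.2 (by omega))

theorem IsFreeOn.isReduced {P : GradedOperad k} {E : ∀ n p, Submodule k (P.obj n p)}
    (hE : P.IsFreeOn E) (h0 : ∀ p, E 0 p = ⊥) (h1 : ∀ p, E 1 p = ⊥) : P.IsReduced := by
  have hG : ∀ n p x, x ∈ (E n p : Set (P.obj n p)) → n < 2 → x = 0 := by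
    intro n p x hx hn
    interval_cases n
    · rw [h0] at hx; exact hx
    · rw [h1] at hx; exact hx
  exact ⟨fun x => ((hE.generated x).reduced hG).1 rfl, fun x => ((hE.generated x).reduced hG).2 rfl⟩

/-- Induction on generated elements of a reduced operad, where only compositions of operations of
arity at least `2` need to be considered. -/
theorem IsReduced.induction {P : GradedOperad k} (hP : P.IsReduced) {G : ∀ n p, Set (P.obj n p)}
    (C : ∀ n p, P.obj n p → Prop) (of : ∀ n p x, x ∈ G n p → C n p x) (one : C 1 0 P.one)
    (zero : ∀ n p, C n p 0) (add : ∀ n p x y, C n p x → C n p y → C n p (x + y))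
    (smul : ∀ n p (c : k) x, C n p x → C n p (c • x))
    (act : ∀ n p (σ : Equiv.Perm (Fin n)) x, C n p x → C n p (P.act σ x))
    (circ : ∀ {m n l p q r} (h : l + 1 = m + n) (hr : p + q = r) (i : Fin m) (x : P.obj m p)
      (y : P.obj n q), 2 ≤ m → 2 ≤ n → C m p x → C n q y → C l r (P.circ h hr i x y))
    {n p} {x : P.obj n p} (hx : P.Generated G x) : C n p x := by
  induction hx with
  | of x hx => exact of _ _ x hx
  | one => exact one
  | zero => exact zero _ _
  | add x y _ _ hx hy => exact add _ _ x y hx hy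
  | smul c x _ hx => exact smul _ _ c x hx
  | act σ x _ hx => exact act _ _ σ x hx
  | @circ m n l p q r h hr i x y _ _ hx hy =>
    by_cases hm : 2 ≤ m
    · by_cases hn : 2 ≤ n
      · exact circ h hr i x y hm hn hx hy
      · obtain rfl | rfl : n = 0 ∨ n = 1 := by omega
        · rw [hP.eq_zero y, map_zero]; exact zero _ _
        · exact (hP.isScalar y).circ_right C zero smul h hr i hx
    · have hi := i.2
      obtain rfl : m = 1 := by omega
      exact (hP.isScalar x).circ_left C zero smul h hr i hy

/-- The stage of `P` below arity `n`. -/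
abbrev Below (P : GradedOperad k) (E : ∀ n p, Submodule k (P.obj n p)) (n : ℕ) {l : ℕ} {p : ℤ}
    (x : P.obj l p) : Prop :=
  P.Generated (fun m q => {y | m < n ∧ y ∈ E m q}) x

theorem Below.of {P : GradedOperad k} {E : ∀ n p, Submodule k (P.obj n p)} {n l p}
    {x : P.obj l p} (hl : l < n) (hx : x ∈ E l p) : P.Below E n x :=
  Generated.of x (show l < n ∧ x ∈ E l p from ⟨hl, hx⟩)

theorem Below.mono {P : GradedOperad k} {E : ∀ n p, Submodule k (P.obj n p)} {n n' : ℕ}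
    (hn : n ≤ n') {l p} {x : P.obj l p} (hx : P.Below E n x) : P.Below E n' x :=
  Generated.mono (fun m q y hy => show m < n' ∧ y ∈ E m q from ⟨hy.1.trans_le hn, hy.2⟩) hx

/-- Every operation is a sum of a generator and of an operation of the previous stage. -/
theorem Generated.exists_below_add {P : GradedOperad k} {E : ∀ n p, Submodule k (P.obj n p)}
    (hP : P.IsReduced)
    (hE : ∀ (n : ℕ) (p : ℤ) (σ : Equiv.Perm (Fin n)) (e : P.obj n p), e ∈ E n p → P.act σ e ∈ E n p)
    {n p} {x : P.obj n p} (hx : P.Generated (fun n p => (E n p : Set (P.obj n p))) x) :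
    ∃ y, P.Below E n y ∧ ∃ e ∈ E n p, x = y + e := by
  refine hP.induction (fun n p x => ∃ y, P.Below E n y ∧ ∃ e ∈ E n p, x = y + e)
    ?_ ?_ ?_ ?_ ?_ ?_ ?_ hx
  · exact fun n p x hx => ⟨0, .zero, x, hx, (zero_add x).symm⟩
  · exact ⟨P.one, .one, 0, zero_mem _, (add_zero _).symm⟩
  · exact fun n p => ⟨0, .zero, 0, zero_mem _, (add_zero _).symm⟩
  · rintro n p _ _ ⟨y, hy, e, he, rfl⟩ ⟨y', hy', e', he', rfl⟩
    exact ⟨y + y', .add _ _ hy hy', e + e', add_mem he he', by abel⟩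
  · rintro n p c _ ⟨y, hy, e, he, rfl⟩
    exact ⟨c • y, .smul _ _ hy, c • e, Submodule.smul_mem _ _ he, smul_add _ _ _⟩
  · rintro n p σ _ ⟨y, hy, e, he, rfl⟩
    exact ⟨P.act σ y, .act _ _ hy, P.act σ e, hE _ _ _ _ he, map_add _ _ _⟩
  · rintro m n l p q r h hr i _ _ hm hn ⟨y, hy, e, he, rfl⟩ ⟨y', hy', e', he', rfl⟩
    -- Since `m, n ≥ 2` and `l + 1 = m + n`, both factors have arity less than `l`: all their
    -- generators are available below `l`, and a proper composition has no component in `E l`.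
    have h₁ : P.Below E l (y + e) := .add _ _ (hy.mono (by omega)) (Below.of (by omega) he)
    have h₂ : P.Below E l (y' + e') := .add _ _ (hy'.mono (by omega)) (Below.of (by omega) he')
    exact ⟨_, .circ h hr i _ _ h₁ h₂, 0, zero_mem _, (add_zero _).symm⟩

theorem IsFreeOn.exists_below_add {P : GradedOperad k} {E : ∀ n p, Submodule k (P.obj n p)}
    (hE : P.IsFreeOn E) (hP : P.IsReduced) {n p} (x : P.obj n p) :
    ∃ y, P.Below E n y ∧ ∃ e ∈ E n p, x = y + e :=
  (hE.generated x).exists_below_add hP hE.1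

theorem IsFreeOn.below_of_lt {P : GradedOperad k} {E : ∀ n p, Submodule k (P.obj n p)}
    (hE : P.IsFreeOn E) (hP : P.IsReduced) {n l p} (hl : l < n) (x : P.obj l p) :
    P.Below E n x := by
  obtain ⟨y, hy, e, he, rfl⟩ := hE.exists_below_add hP x
  exact .add _ _ (hy.mono hl.le) (Below.of hl he)

end GradedOperad

namespace DGOperad

/-- The Leibniz rule for `1 ∘ 1 = 1` reads `d 1 = d 1 + d 1`. -/
theorem d_one (P : DGOperad k) {q : ℤ} (h : 0 + 1 = q) : P.d h P.one = 0 := by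
  subst h
  have h1 := P.d_circ (rfl : 1 + 1 = 1 + 1) (zero_add 0) rfl rfl rfl (by norm_num) (by norm_num)
    0 P.one P.one
  rw [P.one_circ, P.circ_one, P.one_circ] at h1
  simpa using h1

/-- The stages of a minimal presentation are stable under the differential. -/
theorem IsMinimalPresentation.below_d {P : DGOperad k} {E : ∀ n p, Submodule k (P.obj n p)}
    (hE : P.IsMinimalPresentation E) {n l : ℕ} {p q : ℤ} (h : p + 1 = q) {x : P.obj l p}
    (hx : P.StageBelow E n x) : P.StageBelow E n (P.d h x) := by
  unfold StageBelow at *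
  induction hx generalizing q with
  | of x hx => exact GradedOperad.Below.mono hx.1.le (hE.d_mem h x hx.2)
  | one => rw [P.d_one]; exact .zero
  | zero => rw [map_zero]; exact .zero
  | add x y _ _ hx hy => rw [map_add]; exact .add _ _ (hx h) (hy h)
  | smul c x _ hx => rw [map_smul]; exact .smul c _ (hx h)
  | act σ x _ hx => rw [P.d_act]; exact .act σ _ (hx h)
  | circ h' hr i x y hx' hy' hx hy =>
    rw [P.d_circ h' hr rfl rfl h (by omega) (by omega)]
    refine .add _ _ (.circ _ _ _ _ _ (hx rfl) hy') ?_
    -- The Koszul sign is a unit of `ℤ`, whereas generated operations are only known to be stable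
    -- under scalars of `k`.
    rcases Int.units_eq_one_or (Int.negOnePow _) with hs | hs <;> rw [hs]
    · rw [one_smul]; exact .circ _ _ _ _ _ hx' (hy rfl)
    · rw [Units.neg_smul, one_smul, ← neg_one_smul k]
      exact .smul _ _ (.circ _ _ _ _ _ hx' (hy rfl))

theorem IsMinimalPresentation.isReduced {P : DGOperad k} {E : ∀ n p, Submodule k (P.obj n p)}
    (hE : P.IsMinimalPresentation E) : P.toGradedOperad.IsReduced :=
  hE.free.isReduced hE.arity_zero hE.arity_one

end DGOperad
end OperadModels

/-! ### Cohomology in terms of elements; relative cocycles. -/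

namespace OperadModels

variable {k : Type u} [Field k]

namespace DGSigmaModule

theorem mem_coboundaries {X : DGSigmaModule k} {n : ℕ} {p t : ℤ} (ht : t + 1 = p)
    {x : X.obj n p} : x ∈ X.coboundaries n p ↔ ∃ w : X.obj n t, X.d ht w = x := by
  obtain rfl : t = p - 1 := by omega
  rfl

theorem mem_cocycles {X : DGSigmaModule k} {n : ℕ} {p q : ℤ} (h : p + 1 = q)
    {x : X.obj n p} : x ∈ X.cocycles n p ↔ X.d h x = 0 := by
  subst h
  rfl

theorem cohomology_mk_eq_zero {X : DGSigmaModule k} {n : ℕ} {p t : ℤ} (ht : t + 1 = p)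
    (x : X.cocycles n p) :
    (Submodule.Quotient.mk x : X.cohomology n p) = 0 ↔ ∃ w : X.obj n t, X.d ht w = x.1 := by
  rw [Submodule.Quotient.mk_eq_zero]
  exact mem_coboundaries ht

theorem Hom.cohomologyMap_injective_iff {X Y : DGSigmaModule k} (f : Hom X Y) {n : ℕ} {p t : ℤ}
    (ht : t + 1 = p) : Function.Injective (f.cohomologyMap n p) ↔
      ∀ (x : X.obj n p) (y : Y.obj n t), X.d (rfl : p + 1 = p + 1) x = 0 → Y.d ht y = f.map n p x →
        ∃ w : X.obj n t, X.d ht w = x := by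
  rw [injective_iff_map_eq_zero]
  constructor
  · intro h x y hx hy
    exact (cohomology_mk_eq_zero ht ⟨x, hx⟩).1
      (h (Submodule.Quotient.mk ⟨x, hx⟩) ((cohomology_mk_eq_zero ht _).2 ⟨y, hy⟩))
  · intro h a ha
    obtain ⟨⟨x, hx⟩, rfl⟩ := Submodule.Quotient.mk_surjective _ a
    obtain ⟨y, hy⟩ := (cohomology_mk_eq_zero ht (f.cocyclesMap n p ⟨x, hx⟩)).1 ha
    exact (cohomology_mk_eq_zero ht ⟨x, hx⟩).2 (h x y hx hy)

theorem Hom.cohomologyMap_surjective_iff {X Y : DGSigmaModule k} (f : Hom X Y) {n : ℕ} {p t : ℤ}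
    (ht : t + 1 = p) : Function.Surjective (f.cohomologyMap n p) ↔
      ∀ (y : Y.obj n p), Y.d (rfl : p + 1 = p + 1) y = 0 →
        ∃ (x : X.obj n p) (v : Y.obj n t), X.d (rfl : p + 1 = p + 1) x = 0 ∧
          f.map n p x = y + Y.d ht v := by
  constructor
  · intro h y hy
    obtain ⟨a, ha⟩ := h (Submodule.Quotient.mk ⟨y, hy⟩)
    obtain ⟨⟨x, hx⟩, rfl⟩ := Submodule.Quotient.mk_surjective _ a
    obtain ⟨v, hv⟩ := (cohomology_mk_eq_zero ht (f.cocyclesMap n p ⟨x, hx⟩ - ⟨y, hy⟩)).1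
      (by rw [Submodule.Quotient.mk_sub, ← ha]; exact sub_self _)
    exact ⟨x, v, hx, by rw [hv]; exact (add_sub_cancel y (f.map n p x)).symm⟩
  · intro h a
    obtain ⟨⟨y, hy⟩, rfl⟩ := Submodule.Quotient.mk_surjective _ a
    obtain ⟨x, v, hx, hv⟩ := h y hy
    refine ⟨Submodule.Quotient.mk ⟨x, hx⟩, ?_⟩
    rw [← sub_eq_zero]
    exact (cohomology_mk_eq_zero ht (f.cocyclesMap n p ⟨x, hx⟩ - ⟨y, hy⟩)).2
      ⟨v, by
        change _ = f.map n p x - y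
        rw [hv, add_sub_cancel_left]⟩

/-- The mapping cone of `f` is acyclic in arity `n`. -/
def Hom.RelLifts {X Y : DGSigmaModule k} (f : Hom X Y) (n : ℕ) : Prop :=
  ∀ ⦃p q t : ℤ⦄ (h : p + 1 = q) (ht : t + 1 = p) (a : X.obj n q) (b : Y.obj n p),
    X.d (rfl : q + 1 = q + 1) a = 0 → Y.d h b = f.map n q a →
    ∃ (a' : X.obj n p) (b' : Y.obj n t), X.d h a' = a ∧ f.map n p a' = b + Y.d ht b'

/-- Relative cocycles `(a, b)` with `a = 0` give surjectivity in cohomology, and the existence of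
`a'` with `d a' = a` gives injectivity. Conversely a primitive `w` of `a`, found by injectivity, is
corrected by a cocycle representing the class of `b - f w`. -/
theorem Hom.relLifts_iff {X Y : DGSigmaModule k} (f : Hom X Y) (n : ℕ) :
    f.RelLifts n ↔ ∀ p, Function.Bijective (f.cohomologyMap n p) := by
  constructor
  · intro hf p
    constructor
    · rw [f.cohomologyMap_injective_iff (sub_add_cancel p 1)]
      intro x y hx hy
      obtain ⟨a, -, ha, -⟩ := hf (sub_add_cancel p 1) (sub_add_cancel _ 1) x y hx hy
      exact ⟨a, ha⟩
    · rw [f.cohomologyMap_surjective_iff (sub_add_cancel p 1)]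
      intro y hy
      obtain ⟨a, b, ha, hb⟩ := hf rfl (sub_add_cancel p 1) 0 y (map_zero _) (by rw [hy, map_zero])
      exact ⟨a, b, ha, hb⟩
  · intro hf p q t h ht a b ha hb
    subst h
    obtain ⟨w, hw⟩ := (f.cohomologyMap_injective_iff rfl).1 (hf (p + 1)).1 a b ha hb
    obtain ⟨x, v, hx, hv⟩ := (f.cohomologyMap_surjective_iff ht).1 (hf p).2 (b - f.map n p w)
      (by rw [map_sub, hb, ← f.map_d, hw, sub_self])
    refine ⟨w + x, v, by rw [map_add, hx, hw, add_zero], ?_⟩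
    rw [map_add, hv]
    abel

theorem Hom.isQuasiIso_iff {X Y : DGSigmaModule k} (f : Hom X Y) :
    f.IsQuasiIso ↔ ∀ n, f.RelLifts n :=
  forall_congr' fun n => (f.relLifts_iff n).symm

/-- Surjective quasi-isomorphisms, expressed through lifting of cocycles of the cone. -/
def Hom.StrictLifts {X Y : DGSigmaModule k} (f : Hom X Y) : Prop :=
  ∀ ⦃n : ℕ⦄ ⦃p q : ℤ⦄ (h : p + 1 = q) (a : X.obj n q) (b : Y.obj n p),
    X.d (rfl : q + 1 = q + 1) a = 0 → Y.d h b = f.map n q a →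
    ∃ a' : X.obj n p, X.d h a' = a ∧ f.map n p a' = b

theorem Hom.StrictLifts.relLifts {X Y : DGSigmaModule k} {f : Hom X Y} (hf : f.StrictLifts)
    (n : ℕ) : f.RelLifts n := by
  intro p q t h ht a b ha hb
  obtain ⟨a', h1, h2⟩ := hf h a b ha hb
  exact ⟨a', 0, h1, by rw [h2, map_zero, add_zero]⟩

end DGSigmaModule

/-! ### Quasi-isomorphisms of dg operads; rigidity of minimal operads. -/

namespace DGOperad

/-- Composition of morphisms. -/
def Hom.comp {P Q R : DGOperad k} (g : Hom Q R) (f : Hom P Q) : Hom P R where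
  toHom := g.toHom.comp f.toHom
  map_d h x := by simp [f.map_d, g.map_d]

/-- The identity morphism. -/
def Hom.id (P : DGOperad k) : Hom P P where
  toHom := GradedOperad.Hom.id P.toGradedOperad
  map_d _ _ := rfl

/-- The inverse of a bijective morphism. -/
noncomputable def Hom.inverse {P Q : DGOperad k} (f : Hom P Q) (hf : f.IsIso) : Hom Q P where
  toHom := f.toHom.inverse hf
  map_d {n p q} h x := by
    apply (hf n q).1
    have e (p) (y : Q.obj n p) : f.map n p ((f.toHom.inverse hf).map n p y) = y :=
      f.toHom.map_inverse hf y
    exact (e _ _).trans ((f.map_d h _).trans (congrArg _ (e _ _))).symm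

theorem Hom.inverse_isIso {P Q : DGOperad k} (f : Hom P Q) (hf : f.IsIso) :
    (f.inverse hf).IsIso := fun n p =>
  (LinearEquiv.ofBijective (f.map n p) (hf n p)).symm.bijective

/-- Elementwise form of `RelLifts` for morphisms of dg operads. -/
def Hom.RelLifts {P Q : DGOperad k} (f : Hom P Q) (n : ℕ) : Prop :=
  ∀ ⦃p q t : ℤ⦄ (h : p + 1 = q) (ht : t + 1 = p) (a : P.obj n q) (b : Q.obj n p),
    P.d (rfl : q + 1 = q + 1) a = 0 → Q.d h b = f.map n q a →
    ∃ (a' : P.obj n p) (b' : Q.obj n t), P.d h a' = a ∧ f.map n p a' = b + Q.d ht b'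

theorem Hom.isQuasiIso_iff {P Q : DGOperad k} (f : Hom P Q) :
    f.IsQuasiIso ↔ ∀ n, f.RelLifts n :=
  f.toSigmaHom.isQuasiIso_iff

/-- Surjective quasi-isomorphisms, expressed through lifting of cocycles of the cone. -/
def Hom.StrictLifts {P Q : DGOperad k} (f : Hom P Q) : Prop :=
  ∀ ⦃n : ℕ⦄ ⦃p q : ℤ⦄ (h : p + 1 = q) (a : P.obj n q) (b : Q.obj n p),
    P.d (rfl : q + 1 = q + 1) a = 0 → Q.d h b = f.map n q a →
    ∃ a' : P.obj n p, P.d h a' = a ∧ f.map n p a' = b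

theorem Hom.StrictLifts.isQuasiIso {P Q : DGOperad k} {f : Hom P Q} (hf : f.StrictLifts) :
    f.IsQuasiIso :=
  f.toSigmaHom.isQuasiIso_iff.2 (DGSigmaModule.Hom.StrictLifts.relLifts (f := f.toSigmaHom) hf)

theorem Hom.cohomologyMap_comp {P Q R : DGOperad k} (g : Hom Q R) (f : Hom P Q) (n : ℕ) (p : ℤ)
    (x : P.toDGSigmaModule.cohomology n p) : (g.comp f).toSigmaHom.cohomologyMap n p x =
      g.toSigmaHom.cohomologyMap n p (f.toSigmaHom.cohomologyMap n p x) := by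
  obtain ⟨x, rfl⟩ := Submodule.Quotient.mk_surjective _ x
  rfl

theorem Hom.IsQuasiIso.of_comp_right {P Q R : DGOperad k} {g : Hom Q R} {f : Hom P Q}
    (hg : g.IsQuasiIso) (hgf : (g.comp f).IsQuasiIso) : f.IsQuasiIso := fun n p => by
  have h : (g.comp f).toSigmaHom.cohomologyMap n p =
      g.toSigmaHom.cohomologyMap n p ∘ f.toSigmaHom.cohomologyMap n p :=
    funext (g.cohomologyMap_comp f n p)
  have h' := hgf n p
  rw [h] at h'
  exact (Function.Bijective.of_comp_iff' (hg n p) _).1 h'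

theorem Hom.IsQuasiIso.comp {P Q R : DGOperad k} {g : Hom Q R} {f : Hom P Q}
    (hg : g.IsQuasiIso) (hf : f.IsQuasiIso) : (g.comp f).IsQuasiIso := fun n p => by
  have h : ⇑((g.comp f).toSigmaHom.cohomologyMap n p) =
      g.toSigmaHom.cohomologyMap n p ∘ f.toSigmaHom.cohomologyMap n p :=
    funext (g.cohomologyMap_comp f n p)
  rw [h]
  exact (hg n p).comp (hf n p)

/-- A quasi-isomorphism between Sullivan minimal operads which is bijective on the previous stages
is bijective in arity `n`. -/
theorem bijective_of_below {M M' : DGOperad k} {E : ∀ n p, Submodule k (M.obj n p)}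
    {E' : ∀ n p, Submodule k (M'.obj n p)} (hE : M.IsMinimalPresentation E)
    (hE' : M'.IsMinimalPresentation E') (f : Hom M M') (n : ℕ) (hf : f.RelLifts n)
    (inj : ∀ p (x : M.obj n p), M.StageBelow E n x → f.map n p x = 0 → x = 0)
    (surj : ∀ p (y : M'.obj n p), M'.StageBelow E' n y →
      ∃ x : M.obj n p, M.StageBelow E n x ∧ f.map n p x = y) (p : ℤ) :
    Function.Bijective (f.map n p) := by
  -- This is where minimality enters: the differential takes all of arity `n`, and not only the
  -- generators, into the stage below, where the behaviour of `f` is known.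
  have dbelow {p q : ℤ} (h : p + 1 = q) (x : M.obj n p) : M.StageBelow E n (M.d h x) := by
    obtain ⟨y, hy, e, he, rfl⟩ := hE.free.exists_below_add hE.isReduced x
    rw [map_add]
    exact .add _ _ (hE.below_d h hy) (hE.d_mem h e he)
  have dbelow' {p q : ℤ} (h : p + 1 = q) (x : M'.obj n p) : M'.StageBelow E' n (M'.d h x) := by
    obtain ⟨y, hy, e, he, rfl⟩ := hE'.free.exists_below_add hE'.isReduced x
    rw [map_add]
    exact .add _ _ (hE'.below_d h hy) (hE'.d_mem h e he)
  constructor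
  · rw [injective_iff_map_eq_zero]
    intro x hx
    have hdx : M.d (rfl : p + 1 = p + 1) x = 0 :=
      inj _ _ (dbelow rfl x) (by rw [f.map_d, hx, map_zero])
    -- An element of the kernel is a cocycle with trivial image, hence a coboundary, and so it lies
    -- in the stage below.
    obtain ⟨w, -, hw, -⟩ := hf (sub_add_cancel p 1) (sub_add_cancel _ 1) x 0 hdx
      (by rw [hx, map_zero])
    exact inj _ _ (hw ▸ dbelow _ w) hx
  · intro y
    obtain ⟨a, ha, ha'⟩ := surj _ _ (dbelow' (rfl : p + 1 = p + 1) y)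
    have hda : M.d (rfl : p + 1 + 1 = p + 1 + 1) a = 0 :=
      inj _ _ (dbelow rfl a) (by rw [f.map_d, ha', M'.d_d])
    -- The pair `(a, y)` is a relative cocycle, so `y` is in the image up to some `d v`; as a
    -- coboundary `d v` lies in the stage below and is in the image too.
    obtain ⟨x, v, -, hv⟩ := hf rfl (sub_add_cancel p 1) a y hda ha'.symm
    obtain ⟨b, -, hb⟩ := surj _ _ (dbelow' (sub_add_cancel p 1) v)
    exact ⟨x - b, by rw [map_sub, hv, hb, add_sub_cancel_right]⟩

/-- Quasi-isomorphisms between Sullivan minimal operads are isomorphisms. -/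
theorem IsMinimalPresentation.isIso_of_isQuasiIso {M M' : DGOperad k}
    {E : ∀ n p, Submodule k (M.obj n p)} {E' : ∀ n p, Submodule k (M'.obj n p)}
    (hE : M.IsMinimalPresentation E) (hE' : M'.IsMinimalPresentation E') (f : Hom M M')
    (hf : f.IsQuasiIso) : f.IsIso := by
  suffices H : ∀ n p, Function.Bijective (f.map n p) from H
  intro n
  induction n using Nat.strong_induction_on with
  | _ n ih =>
  have hf' := f.isQuasiIso_iff.1 hf n
  have eq {m p} (hm : m < n) (x : M'.obj m p) :
      f.map m p ((LinearEquiv.ofBijective (f.map m p) (ih m hm p)).symm x) = x :=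
    LinearEquiv.apply_symm_apply (LinearEquiv.ofBijective (f.map m p) (ih m hm p)) x
  -- The inverses of `f` in arities below `n`, restricted to generators, extend by freeness to a
  -- graded morphism `g`. On the stages below `n`, which contain operations of arity `n` too, `g` is
  -- inverse to `f`; compatibility of `g` with differentials plays no role.
  obtain ⟨g, hg, -⟩ := hE'.free.exists_hom_below (Q := M.toGradedOperad) n
    (fun m p hm => ((LinearEquiv.ofBijective (f.map m p) (ih m hm p)).symm :
      M'.obj m p →ₗ[k] M.obj m p).comp (E' m p).subtype) (by
    intro m p hm σ e e' he
    apply (ih m hm p).1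
    simp only [LinearMap.comp_apply, Submodule.subtype_apply, LinearEquiv.coe_coe]
    rw [f.map_act, eq hm, eq hm, he])
  have fg {l p} {y : M'.obj l p} (hy : M'.StageBelow E' n y) : f.map l p (g.map l p y) = y :=
    GradedOperad.Generated.hom_eq (f.toHom.comp g) (GradedOperad.Hom.id _) (by
      intro m p x hx
      rw [GradedOperad.Hom.comp_map, hg m p hx.1 ⟨x, hx.2⟩]
      exact eq hx.1 x) hy
  have gf {l p} {x : M.obj l p} (hx : M.StageBelow E n x) : g.map l p (f.map l p x) = x :=
    GradedOperad.Generated.hom_eq (g.comp f.toHom) (GradedOperad.Hom.id _) (by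
      intro m p x hx
      apply (ih m hx.1 p).1
      exact fg (hE'.free.below_of_lt hE'.isReduced hx.1 _)) hx
  refine fun p => bijective_of_below hE hE' f n hf' ?_ ?_ p
  · intro p x hx h0
    rw [← gf hx, h0, map_zero]
  · intro p y hy
    exact ⟨g.map n p y, GradedOperad.Generated.map g
      (fun m q x hx => hE.free.below_of_lt hE.isReduced hx.1 _) hy, fg hy⟩

end DGOperad
end OperadModels

/-! ### Equivariant choices in characteristic zero; lifting through surjective quasi-isomorphisms.
-/

namespace OperadModels

variable {k : Type u} [Field k]

/-- In characteristic zero, an equivariant map which lifts pointwise lifts equivariantly. -/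
theorem exists_equivariant_lift [CharZero k] {n : ℕ} {V W T : Type*} [AddCommGroup V] [Module k V]
    [AddCommGroup W] [Module k W] [AddCommGroup T] [Module k T]
    (aV : Equiv.Perm (Fin n) → V →ₗ[k] V) (aW : Equiv.Perm (Fin n) → W →ₗ[k] W)
    (aT : Equiv.Perm (Fin n) → T →ₗ[k] T)
    (hV : ∀ σ τ v, aV (σ * τ) v = aV τ (aV σ v)) (hW : ∀ σ τ v, aW (σ * τ) v = aW τ (aW σ v))
    (hT : ∀ σ τ v, aT (σ * τ) v = aT τ (aT σ v)) (hT1 : ∀ v, aT 1 v = v)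
    (Φ : W →ₗ[k] T) (hΦ : ∀ σ w, Φ (aW σ w) = aT σ (Φ w))
    (f : V →ₗ[k] T) (hf : ∀ σ v, f (aV σ v) = aT σ (f v)) (hex : ∀ v, ∃ w, Φ w = f v) :
    ∃ s : V →ₗ[k] W, (∀ v, Φ (s v) = f v) ∧ ∀ σ v, s (aV σ v) = aW σ (s v) := by
  -- A linear lift exists over a field; its average over the symmetric group is still a lift,
  -- because `Φ` and `f` are equivariant.
  obtain ⟨s, hs⟩ := Module.projective_lifting_property Φ.rangeRestrict
    (f.codRestrict (LinearMap.range Φ) hex) Φ.surjective_rangeRestrict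
  have hs' (v) : Φ (s v) = f v := congrArg Subtype.val (LinearMap.congr_fun hs v)
  have hc : (Fintype.card (Equiv.Perm (Fin n)) : k) ≠ 0 :=
    Nat.cast_ne_zero.2 Fintype.card_ne_zero
  refine ⟨(Fintype.card (Equiv.Perm (Fin n)) : k)⁻¹ • ∑ σ, (aW σ⁻¹).comp (s.comp (aV σ)),
    fun v => ?_, fun ρ v => ?_⟩
  · have h1 (σ : Equiv.Perm (Fin n)) : Φ (aW σ⁻¹ (s (aV σ v))) = f v := by
      rw [hΦ, hs', hf, ← hT, mul_inv_cancel, hT1]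
    simp only [LinearMap.smul_apply, LinearMap.sum_apply, LinearMap.comp_apply, map_smul, map_sum,
      h1, Finset.sum_const, Finset.card_univ]
    rw [← Nat.cast_smul_eq_nsmul k, smul_smul, inv_mul_cancel₀ hc, one_smul]
  · simp only [LinearMap.smul_apply, LinearMap.sum_apply, LinearMap.comp_apply, map_smul, map_sum]
    congr 1
    refine Fintype.sum_equiv (Equiv.mulLeft ρ) _ _ fun σ => ?_
    simp only [Equiv.coe_mulLeft]
    rw [hV, ← hW]
    simp

namespace DGOperad

/-- A morphism which commutes with the differentials on generators commutes with them. -/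
theorem map_d_of_generated {P Q : DGOperad k} (f : GradedOperad.Hom P.toGradedOperad Q.toGradedOperad)
    {G : ∀ n p, Set (P.obj n p)}
    (hf : ∀ {n p q} (h : p + 1 = q) (x : P.obj n p), x ∈ G n p →
      f.map n q (P.d h x) = Q.d h (f.map n p x))
    {n p q} (h : p + 1 = q) {x : P.obj n p} (hx : P.toGradedOperad.Generated G x) :
    f.map n q (P.d h x) = Q.d h (f.map n p x) := by
  induction hx generalizing q with
  | of x hx => exact hf h x hx
  | one => rw [P.d_one, f.map_one, Q.d_one, map_zero]
  | zero => simp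
  | add x y _ _ hx hy => simp only [map_add, hx, hy]
  | smul c x _ hx => simp only [map_smul, hx]
  | act σ x _ hx => rw [P.d_act, f.map_act, hx, f.map_act, Q.d_act]
  | circ h' hr i x y _ _ hx hy =>
    rw [P.d_circ h' hr rfl rfl h (by omega) (by omega), f.map_circ,
      Q.d_circ h' hr rfl rfl h (by omega) (by omega), map_add, f.map_circ, hx,
      Units.smul_def, Units.smul_def, map_zsmul, f.map_circ, hy]

section Lifting

variable [CharZero k] {M Y Q : DGOperad k} {E : ∀ n p, Submodule k (M.obj n p)}

/-- `h` lifts `g` through `π` compatibly with differentials, on the generators below `n`. -/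
def LiftsBelow (E : ∀ n p, Submodule k (M.obj n p)) (π : Hom Y Q) (g : Hom M Q) (n : ℕ)
    (h : GradedOperad.Hom M.toGradedOperad Y.toGradedOperad) : Prop :=
  ∀ m < n, ∀ p, ∀ e ∈ E m p, π.map m p (h.map m p e) = g.map m p e ∧
    ∀ {q} (hq : p + 1 = q), h.map m q (M.d hq e) = Y.d hq (h.map m p e)

/-- For a generator `e` of arity `n` the element `d e` lies in the stage below, so `h (d e)` is
already fixed. It is a cocycle with `π (h (d e)) = d (g e)`, and a strict lift of the pair `(h (d
e), g e)` is an admissible value at `e`. -/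
theorem LiftsBelow.step (hE : M.IsMinimalPresentation E) {π : Hom Y Q} (hπ : π.StrictLifts)
    {g : Hom M Q} {n : ℕ} {h : GradedOperad.Hom M.toGradedOperad Y.toGradedOperad}
    (hh : LiftsBelow E π g n h) :
    ∃ h' : GradedOperad.Hom M.toGradedOperad Y.toGradedOperad, LiftsBelow E π g (n + 1) h' ∧
      ∀ m < n, ∀ p, ∀ e ∈ E m p, h'.map m p e = h.map m p e := by
  have hd {l p q} (hq : p + 1 = q) {x : M.obj l p} (hx : M.StageBelow E n x) :
      h.map l q (M.d hq x) = Y.d hq (h.map l p x) :=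
    map_d_of_generated h (fun hq x hx => (hh _ hx.1 _ x hx.2).2 hq) hq hx
  have hg {l p} {x : M.obj l p} (hx : M.StageBelow E n x) :
      π.map l p (h.map l p x) = g.map l p x :=
    GradedOperad.Generated.hom_eq (π.toHom.comp h) g.toHom (fun _ _ x hx => (hh _ hx.1 _ x hx.2).1) hx
  -- The two conditions on the new values, on their images under `π` and on their differentials, are
  -- a single lifting problem through the map `(π, d)`, to which averaging applies.
  have key (p : ℤ) : ∃ s : E n p →ₗ[k] Y.obj n p,
      (∀ e : E n p, ((π.map n p).prod (Y.d (rfl : p + 1 = p + 1))) (s e) =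
        ((g.map n p).prod ((h.map n (p + 1)).comp (M.d (rfl : p + 1 = p + 1)))).comp
          (E n p).subtype e) ∧
      ∀ (σ : Equiv.Perm (Fin n)) (e : E n p),
        s ((M.act σ).restrict (hE.free.1 n p σ) e) = Y.act σ (s e) := by
    refine exists_equivariant_lift (fun σ => (M.act σ).restrict (hE.free.1 n p σ)) Y.act
      (fun σ => (Q.act σ).prodMap (Y.act σ)) ?_ Y.act_mul ?_ ?_ _ ?_ _ ?_ ?_
    · exact fun σ τ v => Subtype.ext (M.act_mul σ τ v.1)
    · exact fun σ τ v => Prod.ext (Q.act_mul σ τ v.1) (Y.act_mul σ τ v.2)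
    · exact fun v => Prod.ext (Q.act_one v.1) (Y.act_one v.2)
    · exact fun σ w => Prod.ext (π.map_act σ w) (Y.d_act _ σ w)
    · intro σ v
      refine Prod.ext (g.map_act σ _) ?_
      change h.map _ _ (M.d _ (M.act σ v.1)) = Y.act σ (h.map _ _ (M.d _ v.1))
      rw [M.d_act, h.map_act]
    · rintro ⟨e, he⟩
      have hb := hE.d_mem (rfl : p + 1 = p + 1) e he
      obtain ⟨y, hy, hy'⟩ := hπ (rfl : p + 1 = p + 1) (h.map n (p + 1) (M.d rfl e)) (g.map n p e)
        (by rw [← hd rfl hb, M.d_d, map_zero]) (by rw [← g.map_d, hg hb])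
      exact ⟨y, Prod.ext hy' hy⟩
  choose s hs hs' using key
  obtain ⟨ψ, h1, h2⟩ := hE.free.exists_update h n s (by
    intro p σ e e' he
    rw [← hs']
    exact congrArg _ (Subtype.ext he))
  have hψ {l p} {x : M.obj l p} (hx : M.StageBelow E n x) : ψ.map l p x = h.map l p x :=
    GradedOperad.Generated.hom_eq ψ h (fun m p x hx => h1 m p hx.1.ne x hx.2) hx
  refine ⟨ψ, fun m hm p e he => ?_, fun m hm p e he => h1 m p hm.ne e he⟩
  rcases Nat.lt_succ_iff_lt_or_eq.1 hm with hm | rfl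
  · rw [h1 m p hm.ne e he]
    refine ⟨(hh m hm p e he).1, fun hq => ?_⟩
    rw [hψ (GradedOperad.Below.mono hm.le (hE.d_mem hq e he)), (hh m hm p e he).2 hq]
  · rw [h2 p ⟨e, he⟩]
    have := hs p ⟨e, he⟩
    refine ⟨congrArg Prod.fst this, fun hq => ?_⟩
    subst hq
    rw [hψ (hE.d_mem rfl e he)]
    exact (congrArg Prod.snd this).symm

/-- Sullivan minimal operads lift through surjective quasi-isomorphisms. -/
theorem IsMinimalPresentation.exists_lift (hE : M.IsMinimalPresentation E) (π : Hom Y Q)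
    (hπ : π.StrictLifts) (g : Hom M Q) :
    ∃ h : Hom M Y, ∀ n p x, π.map n p (h.map n p x) = g.map n p x := by
  obtain ⟨h0, -, -⟩ := hE.free.exists_hom_below (Q := Y.toGradedOperad) 0
    (fun m p hm => absurd hm (Nat.not_lt_zero m)) (fun m p hm => absurd hm (Nat.not_lt_zero m))
  choose! next hnext hnext' using fun n h => LiftsBelow.step (n := n) (h := h) (g := g) hE hπ
  let s : ℕ → GradedOperad.Hom M.toGradedOperad Y.toGradedOperad := fun n =>
    Nat.rec h0 (fun n h => next n h) n
  have hs : ∀ n, LiftsBelow E π g n (s n) := by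
    intro n
    induction n with
    | zero => exact fun m hm => absurd hm (Nat.not_lt_zero m)
    | succ n ih => exact hnext n _ ih
  -- The values on generators of arity `m` are final from the step `m + 1` on; the limit morphism
  -- `φ` below takes its values on `E m` from that step.
  have hs' : ∀ d m p, ∀ e ∈ E m p, (s (m + 1 + d)).map m p e = (s (m + 1)).map m p e := by
    intro d m p e he
    induction d with
    | zero => rfl
    | succ d ih =>
      rw [← ih]
      exact hnext' (m + 1 + d) _ (hs _) m (by omega) p e he
  obtain ⟨φ, hφ, -⟩ := hE.free.2 Y.toGradedOperad (fun m p => ((s (m + 1)).map m p).comp (E m p).subtype)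
    (by
      intro n p σ e e' he
      simp only [LinearMap.comp_apply, Submodule.subtype_apply, he]
      rw [(s (n + 1)).map_act])
  have hφs : ∀ n l p (x : M.obj l p), M.StageBelow E n x → φ.map l p x = (s n).map l p x := by
    intro n l p x hx
    refine GradedOperad.Generated.hom_eq φ (s n) (fun m p e he' => ?_) hx
    obtain ⟨hm, he⟩ := he'
    obtain ⟨d, rfl⟩ := Nat.exists_eq_add_of_lt hm
    refine (hφ m p ⟨e, he⟩).trans ?_
    rw [show m + d + 1 = m + 1 + d by omega, hs' _ _ _ _ he]
    rfl
  have hgen : ∀ m p, ∀ e ∈ E m p, π.map m p (φ.map m p e) = g.map m p e ∧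
      ∀ {q} (hq : p + 1 = q), φ.map m q (M.d hq e) = Y.d hq (φ.map m p e) := by
    intro m p e he
    have h1 := hs (m + 1) m (Nat.lt_succ_self m) p e he
    rw [hφs (m + 1) m p e (GradedOperad.Below.of (Nat.lt_succ_self m) he)]
    refine ⟨h1.1, fun hq => ?_⟩
    rw [hφs (m + 1) m _ _ (GradedOperad.Below.mono (Nat.le_succ m) (hE.d_mem hq e he)), h1.2 hq]
  refine ⟨{ toHom := φ
            map_d := fun h x => map_d_of_generated φ
              (fun hq x hx => (hgen _ _ x hx).2 hq) h (hE.free.generated x) }, fun n p x => ?_⟩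
  exact GradedOperad.Generated.hom_eq (π.toHom.comp φ) g.toHom (fun _ _ x hx => (hgen _ _ x hx).1)
    (hE.free.generated x)

end Lifting

end DGOperad
end OperadModels

/-! ### Auxiliary operads: odd extensions, extension of scalars, products. -/

namespace OperadModels

variable {k : Type u} [Field k]

open scoped TensorProduct
open Polynomial (X)

namespace GradedSigmaModule

/-- Transport along an equality of degrees. -/
def castDeg (X : GradedSigmaModule k) {n : ℕ} {p p' : ℤ} (h : p = p') : X.obj n p →ₗ[k] X.obj n p' :=
  h ▸ LinearMap.id

@[simp] theorem castDeg_rfl (X : GradedSigmaModule k) {n : ℕ} {p : ℤ} (h : p = p)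
    (x : X.obj n p) : X.castDeg h x = x := rfl

end GradedSigmaModule

theorem negOnePow_odd_mul {s : ℤ} (hs : Odd s) (t : ℤ) : (s * t).negOnePow = t.negOnePow := by
  obtain ⟨c, rfl⟩ := hs
  rw [show (2 * c + 1) * t = c * t + c * t + t by ring, Int.negOnePow_add, Int.negOnePow_add,
    Int.units_mul_self, one_mul]

theorem negOnePow_mul_odd {s : ℤ} (hs : Odd s) (t : ℤ) : (t * s).negOnePow = t.negOnePow := by
  rw [mul_comm, negOnePow_odd_mul hs]

namespace GradedOperad

/-- The operad `Q ⊕ η Q`, for a variable `η` of odd degree `-s` with `η² = 0`. -/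
def oddExtension (Q : GradedOperad k) (s : ℤ) (hs : Odd s) : GradedOperad k where
  obj n p := Q.obj n p × Q.obj n (p + s)
  act σ := (Q.act σ).prodMap (Q.act σ)
  act_one x := Prod.ext (Q.act_one _) (Q.act_one _)
  act_mul σ τ x := Prod.ext (Q.act_mul _ _ _) (Q.act_mul _ _ _)
  one := (Q.one, 0)
  -- A pair `(x, y)` stands for `x + η y`. Moving the odd variable `η` to the front past an
  -- operation of degree `p` costs the sign `(-1)^p`.
  circ {m n l p q r} h hr i := LinearMap.mk₂ k
    (fun x y => (Q.circ h hr i x.1 y.1,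
      Q.circ h (by omega : p + s + q = r + s) i x.2 y.1 +
        p.negOnePow • Q.circ h (by omega : p + (q + s) = r + s) i x.1 y.2))
    (fun x x' y => Prod.ext (by simp) (by
      simp only [Prod.snd_add, Prod.fst_add, map_add, LinearMap.add_apply, smul_add]; abel))
    (fun c x y => Prod.ext (by simp) (by
      simp only [Prod.smul_snd, Prod.smul_fst, map_smul, LinearMap.smul_apply, smul_add]
      rw [smul_comm c]))
    (fun x y y' => Prod.ext (by simp) (by
      simp only [Prod.snd_add, Prod.fst_add, map_add, smul_add]; abel))
    (fun c x y => Prod.ext (by simp) (by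
      simp only [Prod.smul_snd, Prod.smul_fst, map_smul, LinearMap.smul_apply, smul_add]
      rw [smul_comm c]))
  one_circ {n p} h hp x := by
    refine Prod.ext (Q.one_circ h hp x.1) ?_
    simp only [LinearMap.mk₂_apply, map_zero, LinearMap.zero_apply, zero_add, Int.negOnePow_zero,
      one_smul]
    exact Q.one_circ h _ x.2
  circ_one {n p} h hp i x := by
    refine Prod.ext (Q.circ_one h hp i x.1) ?_
    simp only [LinearMap.mk₂_apply, map_zero, smul_zero, add_zero]
    exact Q.circ_one h _ i x.2
  circ_circ_inner {a b c ab bc abc p q t pq qt pqt} h₁ h₂ h₃ h₄ e₁ e₂ e₃ e₄ i j x y z := by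
    refine Prod.ext (Q.circ_circ_inner h₁ h₂ h₃ h₄ e₁ e₂ e₃ e₄ i j x.1 y.1 z.1) ?_
    have A1 := Q.circ_circ_inner h₁ h₂ h₃ h₄ (by omega : p + s + q = pq + s)
      (by omega : pq + s + t = pqt + s) e₃ (by omega) i j x.2 y.1 z.1
    have A2 := Q.circ_circ_inner h₁ h₂ h₃ h₄ (by omega : p + (q + s) = pq + s)
      (by omega : pq + s + t = pqt + s) (by omega : q + s + t = qt + s) (by omega) i j x.1 y.2 z.1
    have A3 := Q.circ_circ_inner h₁ h₂ h₃ h₄ e₁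
      (by omega : pq + (t + s) = pqt + s) (by omega : q + (t + s) = qt + s) (by omega) i j x.1 y.1
      z.2
    subst e₁
    simp only [LinearMap.mk₂_apply, Int.negOnePow_add, map_add, LinearMap.add_apply, smul_add]
    rcases Int.units_eq_one_or p.negOnePow with hp | hp <;>
    rcases Int.units_eq_one_or q.negOnePow with hq | hq <;>
    simp [hp, hq, A1, A2, A3] <;> abel
  circ_circ_outer {a b c ab ac abc p q t pq pt pqt} h₁ h₂ h₃ h₄ e₁ e₂ e₃ e₄ i j hij x y z := by
    refine Prod.ext (Q.circ_circ_outer h₁ h₂ h₃ h₄ e₁ e₂ e₃ e₄ i j hij x.1 y.1 z.1) ?_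
    have A1 := Q.circ_circ_outer h₁ h₂ h₃ h₄ (by omega : p + s + q = pq + s)
      (by omega : pq + s + t = pqt + s) (by omega : p + s + t = pt + s) (by omega) i j hij x.2 y.1 z.1
    have A2 := Q.circ_circ_outer h₁ h₂ h₃ h₄ (by omega : p + (q + s) = pq + s)
      (by omega : pq + s + t = pqt + s) (by omega : p + t = pt) (by omega) i j hij x.1 y.2 z.1
    have A3 := Q.circ_circ_outer h₁ h₂ h₃ h₄ e₁
      (by omega : pq + (t + s) = pqt + s) (by omega : p + (t + s) = pt + s) (by omega) i j hij x.1
      y.1 z.2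
    rw [add_mul, Int.negOnePow_add, negOnePow_odd_mul hs] at A2
    rw [mul_add, Int.negOnePow_add, negOnePow_mul_odd hs] at A3
    subst e₁ e₃
    simp only [LinearMap.mk₂_apply, Int.negOnePow_add, map_add, LinearMap.add_apply, smul_add,
      Prod.smul_snd]
    rcases Int.units_eq_one_or p.negOnePow with hp | hp <;>
    rcases Int.units_eq_one_or q.negOnePow with hq | hq <;>
    rcases Int.units_eq_one_or t.negOnePow with ht | ht <;>
    rcases Int.units_eq_one_or (q * t).negOnePow with hqt | hqt <;>
    simp [hp, hq, ht, hqt, A1, A2, A3] <;> abel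
  circ_act h hr i σ τ x y := by
    refine Prod.ext (Q.circ_act h hr i σ τ x.1 y.1) ?_
    simp only [LinearMap.mk₂_apply, LinearMap.prodMap_apply, map_add, Q.circ_act, Units.smul_def,
      map_zsmul]

theorem oddExtension_circ (Q : GradedOperad k) (s : ℤ) (hs : Odd s) {m n l p q r}
    (h : l + 1 = m + n) (hr : p + q = r) (i : Fin m) (x : (Q.oddExtension s hs).obj m p)
    (y : (Q.oddExtension s hs).obj n q) : (Q.oddExtension s hs).circ h hr i x y =
      (Q.circ h hr i x.1 y.1,
      Q.circ h (by omega : p + s + q = r + s) i x.2 y.1 +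
        p.negOnePow • Q.circ h (by omega : p + (q + s) = r + s) i x.1 y.2) := rfl

/-- Extension of coefficients along a commutative `k`-algebra, as an operad over `k`. -/
noncomputable def extendScalars (A : Type u) [CommRing A] [Algebra k A] (Q : GradedOperad k) :
    GradedOperad k where
  obj n p := A ⊗[k] Q.obj n p
  act σ := (Q.act σ).lTensor A
  act_one x := by
    induction x using TensorProduct.induction_on with
    | zero => simp
    | tmul a x => simp [Q.act_one]
    | add x y hx hy => rw [map_add, hx, hy]
  act_mul σ τ x := by
    induction x using TensorProduct.induction_on with
    | zero => simp
    | tmul a x => simp [Q.act_mul]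
    | add x y hx hy => simp only [map_add, hx, hy]
  one := 1 ⊗ₜ Q.one
  circ h hr i := TensorProduct.map₂ (LinearMap.mul k A) (Q.circ h hr i)
  one_circ h hp x := by
    induction x using TensorProduct.induction_on with
    | zero => simp
    | tmul a x => simp [Q.one_circ]
    | add x y hx hy => rw [map_add, hx, hy]
  circ_one h hp i x := by
    induction x using TensorProduct.induction_on with
    | zero => simp
    | tmul a x => simp [Q.circ_one]
    | add x y hx hy => rw [map_add, LinearMap.add_apply, hx, hy]
  circ_circ_inner h₁ h₂ h₃ h₄ e₁ e₂ e₃ e₄ i j x y z := by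
    induction x using TensorProduct.induction_on with
    | zero => simp
    | add x y hx hy => simp only [map_add, LinearMap.add_apply, hx, hy]
    | tmul a x =>
      induction y using TensorProduct.induction_on with
      | zero => simp
      | add x y hx hy => simp only [map_add, LinearMap.add_apply, hx, hy]
      | tmul b y =>
        induction z using TensorProduct.induction_on with
        | zero => simp
        | add x y hx hy => simp only [map_add, hx, hy]
        | tmul c z =>
          simp [Q.circ_circ_inner h₁ h₂ h₃ h₄ e₁ e₂ e₃ e₄, mul_assoc]
  circ_circ_outer h₁ h₂ h₃ h₄ e₁ e₂ e₃ e₄ i j hij x y z := by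
    induction x using TensorProduct.induction_on with
    | zero => simp
    | add x y hx hy => simp only [map_add, LinearMap.add_apply, hx, hy, smul_add]
    | tmul a x =>
      induction y using TensorProduct.induction_on with
      | zero => simp
      | add x y hx hy => simp only [map_add, LinearMap.add_apply, hx, hy, smul_add]
      | tmul b y =>
        induction z using TensorProduct.induction_on with
        | zero => simp
        | add x y hx hy => simp only [map_add, LinearMap.add_apply, hx, hy, smul_add]
        | tmul c z =>
          simp only [TensorProduct.map₂_apply_tmul, TensorProduct.map_tmul, LinearMap.mul_apply',
            Q.circ_circ_outer h₁ h₂ h₃ h₄ e₁ e₂ e₃ e₄ i j hij]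
          rw [mul_right_comm, Units.smul_def, Units.smul_def, TensorProduct.tmul_smul]
  circ_act h hr i σ τ x y := by
    induction x using TensorProduct.induction_on with
    | zero => simp
    | add x y hx hy => simp only [map_add, LinearMap.add_apply, hx, hy]
    | tmul a x =>
      induction y using TensorProduct.induction_on with
      | zero => simp
      | add x y hx hy => simp only [map_add, hx, hy]
      | tmul b y => simp [Q.circ_act]

/-- Products of graded operads. -/
def prod (P Q : GradedOperad k) : GradedOperad k where
  obj n p := P.obj n p × Q.obj n p
  act σ := (P.act σ).prodMap (Q.act σ)
  act_one x := Prod.ext (P.act_one _) (Q.act_one _)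
  act_mul σ τ x := Prod.ext (P.act_mul _ _ _) (Q.act_mul _ _ _)
  one := (P.one, Q.one)
  circ h hr i := LinearMap.mk₂ k (fun x y => (P.circ h hr i x.1 y.1, Q.circ h hr i x.2 y.2))
    (fun x x' y => Prod.ext (by simp) (by simp)) (fun c x y => Prod.ext (by simp) (by simp))
    (fun x y y' => Prod.ext (by simp) (by simp)) (fun c x y => Prod.ext (by simp) (by simp))
  one_circ h hp x := Prod.ext (P.one_circ h hp x.1) (Q.one_circ h hp x.2)
  circ_one h hp i x := Prod.ext (P.circ_one h hp i x.1) (Q.circ_one h hp i x.2)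
  circ_circ_inner h₁ h₂ h₃ h₄ e₁ e₂ e₃ e₄ i j x y z :=
    Prod.ext (P.circ_circ_inner h₁ h₂ h₃ h₄ e₁ e₂ e₃ e₄ i j _ _ _)
      (Q.circ_circ_inner h₁ h₂ h₃ h₄ e₁ e₂ e₃ e₄ i j _ _ _)
  circ_circ_outer h₁ h₂ h₃ h₄ e₁ e₂ e₃ e₄ i j hij x y z :=
    Prod.ext (P.circ_circ_outer h₁ h₂ h₃ h₄ e₁ e₂ e₃ e₄ i j hij _ _ _)
      (Q.circ_circ_outer h₁ h₂ h₃ h₄ e₁ e₂ e₃ e₄ i j hij _ _ _)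
  circ_act h hr i σ τ x y := Prod.ext (P.circ_act h hr i σ τ _ _) (Q.circ_act h hr i σ τ _ _)

end GradedOperad
end OperadModels

/-! ### Calculus of polynomials with coefficients in a vector space. -/

namespace OperadModels

variable {k : Type u} [Field k]

open scoped TensorProduct
open Polynomial (X)

section PolynomialFamilies

/-- The primitive of a polynomial which vanishes at `0`. -/
noncomputable def primitive (k : Type u) [Field k] : Polynomial k →ₗ[k] Polynomial k :=
  (Polynomial.basisMonomials k).constr k fun n =>
    Polynomial.monomial (n + 1) ((n + 1 : k)⁻¹)

theorem primitive_monomial (n : ℕ) (c : k) :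
    primitive k (Polynomial.monomial n c) = Polynomial.monomial (n + 1) (c * (n + 1 : k)⁻¹) := by
  have h : Polynomial.monomial n c = c • Polynomial.basisMonomials k n := by
    simp [Polynomial.smul_monomial]
  rw [h, map_smul, primitive, Module.Basis.constr_basis, Polynomial.smul_monomial, smul_eq_mul]

theorem derivative_primitive [CharZero k] :
    Polynomial.derivative ∘ₗ primitive k = LinearMap.id := by
  refine Polynomial.lhom_ext' fun n => LinearMap.ext fun c => ?_
  have : (n + 1 : k) ≠ 0 := Nat.cast_add_one_ne_zero n
  simp [primitive_monomial, this]

/-- Together with `derivative_primitive` this contracts the polynomial de Rham complex of the line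
onto its constants, with evaluation at `0` as projection; the denominators `n + 1` require
characteristic zero. -/
theorem primitive_derivative [CharZero k] : primitive k ∘ₗ Polynomial.derivative =
    LinearMap.id - Polynomial.CAlgHom.toLinearMap ∘ₗ Polynomial.leval (0 : k) := by
  refine Polynomial.lhom_ext' fun n => LinearMap.ext fun c => ?_
  rcases n with _ | n
  · simp
  · have : (n + 1 : k) ≠ 0 := Nat.cast_add_one_ne_zero n
    simp [primitive_monomial, this, Polynomial.leval]

theorem leval_zero_primitive : Polynomial.leval (0 : k) ∘ₗ primitive k = 0 := by
  refine Polynomial.lhom_ext' fun n => LinearMap.ext fun c => ?_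
  simp [primitive_monomial, Polynomial.leval]

variable {V W : Type u} [AddCommGroup V] [Module k V] [AddCommGroup W] [Module k W]

/-- The derivative of polynomials with coefficients in `V`. -/
noncomputable def polyDeriv (V : Type u) [AddCommGroup V] [Module k V] :
    Polynomial k ⊗[k] V →ₗ[k] Polynomial k ⊗[k] V :=
  (Polynomial.derivative : Polynomial k →ₗ[k] Polynomial k).rTensor V

/-- The primitive of polynomials with coefficients in `V`. -/
noncomputable def polyPrim (V : Type u) [AddCommGroup V] [Module k V] :
    Polynomial k ⊗[k] V →ₗ[k] Polynomial k ⊗[k] V :=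
  (primitive k).rTensor V

/-- Evaluation of polynomials with coefficients in `V`. -/
noncomputable def polyEval (V : Type u) [AddCommGroup V] [Module k V] (c : k) :
    Polynomial k ⊗[k] V →ₗ[k] V :=
  (TensorProduct.lid k V).toLinearMap ∘ₗ (Polynomial.leval c).rTensor V

@[simp] theorem polyEval_tmul (c : k) (f : Polynomial k) (v : V) :
    polyEval V c (f ⊗ₜ v) = f.eval c • v := by
  simp [polyEval, Polynomial.leval]

@[simp] theorem polyDeriv_polyPrim [CharZero k] (x : Polynomial k ⊗[k] V) :
    polyDeriv V (polyPrim V x) = x := by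
  rw [polyDeriv, polyPrim, ← LinearMap.comp_apply, ← LinearMap.rTensor_comp, derivative_primitive,
    LinearMap.rTensor_id, LinearMap.id_apply]

theorem polyPrim_polyDeriv [CharZero k] (x : Polynomial k ⊗[k] V) :
    polyPrim V (polyDeriv V x) = x - 1 ⊗ₜ polyEval V 0 x := by
  rw [polyDeriv, polyPrim, ← LinearMap.comp_apply, ← LinearMap.rTensor_comp, primitive_derivative]
  induction x using TensorProduct.induction_on with
  | zero => simp
  | add x y hx hy => rw [map_add, hx, hy, map_add, TensorProduct.tmul_add]; abel
  | tmul f v =>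
    rw [polyEval_tmul, LinearMap.rTensor_tmul, LinearMap.sub_apply, TensorProduct.sub_tmul,
      ← TensorProduct.smul_tmul]
    congr 2
    simp [Polynomial.leval, Polynomial.smul_eq_C_mul]

@[simp] theorem polyEval_zero_polyPrim (x : Polynomial k ⊗[k] V) :
    polyEval V 0 (polyPrim V x) = 0 := by
  rw [polyEval, polyPrim, LinearMap.comp_apply, ← LinearMap.comp_apply (LinearMap.rTensor _ _),
    ← LinearMap.rTensor_comp, leval_zero_primitive, LinearMap.rTensor_zero, LinearMap.zero_apply,
    map_zero]

theorem polyDeriv_lTensor (f : V →ₗ[k] W) (x : Polynomial k ⊗[k] V) :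
    polyDeriv W (f.lTensor _ x) = f.lTensor _ (polyDeriv V x) := by
  induction x using TensorProduct.induction_on with
  | zero => simp
  | add x y hx hy => simp only [map_add, hx, hy]
  | tmul a v => simp [polyDeriv]

theorem polyPrim_lTensor (f : V →ₗ[k] W) (x : Polynomial k ⊗[k] V) :
    polyPrim W (f.lTensor _ x) = f.lTensor _ (polyPrim V x) := by
  induction x using TensorProduct.induction_on with
  | zero => simp
  | add x y hx hy => simp only [map_add, hx, hy]
  | tmul a v => simp [polyPrim]

theorem polyEval_lTensor (c : k) (f : V →ₗ[k] W) (x : Polynomial k ⊗[k] V) :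
    polyEval W c (f.lTensor _ x) = f (polyEval V c x) := by
  induction x using TensorProduct.induction_on with
  | zero => simp
  | add x y hx hy => simp only [map_add, hx, hy]
  | tmul a v => simp

theorem polyDeriv_map₂ {U : Type u} [AddCommGroup U] [Module k U] (f : V →ₗ[k] W →ₗ[k] U)
    (x : Polynomial k ⊗[k] V) (y : Polynomial k ⊗[k] W) :
    polyDeriv U (TensorProduct.map₂ (LinearMap.mul k (Polynomial k)) f x y) =
      TensorProduct.map₂ (LinearMap.mul k (Polynomial k)) f (polyDeriv V x) y +
      TensorProduct.map₂ (LinearMap.mul k (Polynomial k)) f x (polyDeriv W y) := by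
  induction x using TensorProduct.induction_on with
  | zero => simp
  | add x y hx hy => simp only [map_add, LinearMap.add_apply, hx, hy]; abel
  | tmul a x =>
    induction y using TensorProduct.induction_on with
    | zero => simp
    | add x y hx hy => simp only [map_add, hx, hy]; abel
    | tmul b y => simp [polyDeriv, TensorProduct.add_tmul]

theorem polyEval_map₂ {U : Type u} [AddCommGroup U] [Module k U] (c : k)
    (f : V →ₗ[k] W →ₗ[k] U) (x : Polynomial k ⊗[k] V) (y : Polynomial k ⊗[k] W) :
    polyEval U c (TensorProduct.map₂ (LinearMap.mul k (Polynomial k)) f x y) =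
      f (polyEval V c x) (polyEval W c y) := by
  induction x using TensorProduct.induction_on with
  | zero => simp
  | add x y hx hy => simp only [map_add, LinearMap.add_apply, hx, hy]
  | tmul a x =>
    induction y using TensorProduct.induction_on with
    | zero => simp
    | add x y hx hy => simp only [map_add, hx, hy]
    | tmul b y => simp [smul_smul, mul_comm]

end PolynomialFamilies

/-- The coefficients `A` sit in degree `0`, so the Leibniz rule passes to `A ⊗ -` with the same sign
`ε`. Arbitrary bilinear maps keep arities and degrees out of the induction on tensors. -/
theorem lTensor_map₂_leibniz {A V W U V' W' U' : Type u} [CommRing A] [Algebra k A]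
    [AddCommGroup V] [Module k V] [AddCommGroup W] [Module k W] [AddCommGroup U] [Module k U]
    [AddCommGroup V'] [Module k V'] [AddCommGroup W'] [Module k W'] [AddCommGroup U'] [Module k U']
    (f : V →ₗ[k] W →ₗ[k] U) (f₁ : V' →ₗ[k] W →ₗ[k] U') (f₂ : V →ₗ[k] W' →ₗ[k] U')
    (dV : V →ₗ[k] V') (dW : W →ₗ[k] W') (dU : U →ₗ[k] U') (ε : ℤˣ)
    (h : ∀ x y, dU (f x y) = f₁ (dV x) y + ε • f₂ x (dW y)) (x : A ⊗[k] V) (y : A ⊗[k] W) :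
    dU.lTensor A (TensorProduct.map₂ (LinearMap.mul k A) f x y) =
      TensorProduct.map₂ (LinearMap.mul k A) f₁ (dV.lTensor A x) y +
      ε • TensorProduct.map₂ (LinearMap.mul k A) f₂ x (dW.lTensor A y) := by
  induction x using TensorProduct.induction_on with
  | zero => simp
  | add x y hx hy => simp only [map_add, LinearMap.add_apply, hx, hy, smul_add]; abel
  | tmul a x =>
    induction y using TensorProduct.induction_on with
    | zero => simp
    | add x y hx hy => simp only [map_add, hx, hy, smul_add]; abel
    | tmul b y =>
      simp only [TensorProduct.map₂_apply_tmul, TensorProduct.map_tmul, LinearMap.lTensor_tmul, h,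
        TensorProduct.tmul_add, Units.smul_def, TensorProduct.tmul_smul]

/-! ### Path objects and uniqueness of minimal models. -/

namespace DGOperad

/-- Extension of coefficients along a commutative `k`-algebra. -/
noncomputable def extendScalars (A : Type u) [CommRing A] [Algebra k A] (Q : DGOperad k) :
    DGOperad k where
  toGradedOperad := Q.toGradedOperad.extendScalars A
  d h := (Q.d h).lTensor A
  d_d {n p q r} h h' (x : A ⊗[k] Q.obj n p) := by
    change (Q.d h').lTensor A ((Q.d h).lTensor A x) = 0
    rw [← LinearMap.comp_apply, ← LinearMap.lTensor_comp,
      show (Q.d h').comp (Q.d h) = 0 from LinearMap.ext (Q.d_d h h'), LinearMap.lTensor_zero]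
    rfl
  d_act {n p q} h σ (x : A ⊗[k] Q.obj n p) := by
    change (Q.d h).lTensor A ((Q.act σ).lTensor A x) = (Q.act σ).lTensor A ((Q.d h).lTensor A x)
    rw [← LinearMap.comp_apply, ← LinearMap.lTensor_comp, ← LinearMap.comp_apply,
      ← LinearMap.lTensor_comp, show (Q.d h).comp (Q.act σ) = (Q.act σ).comp (Q.d h) from
        LinearMap.ext (Q.d_act h σ)]
  d_circ h hr hp' hq' hr' e₁ e₂ i x y :=
    lTensor_map₂_leibniz _ _ _ _ _ _ _ (Q.d_circ h hr hp' hq' hr' e₁ e₂ i) x y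

/-- The dg operad `R ⊕ dt R` of a derivation `D` of a dg operad `R`. -/
def derivationPath (R : DGOperad k) (D : ∀ n p, R.obj n p →ₗ[k] R.obj n p)
    (D_act : ∀ {n p} (σ : Equiv.Perm (Fin n)) (x : R.obj n p), D n p (R.act σ x) = R.act σ (D n p x))
    (D_d : ∀ {n p q} (h : p + 1 = q) (x : R.obj n p), D n q (R.d h x) = R.d h (D n p x))
    (D_circ : ∀ {m n l p q r} (h : l + 1 = m + n) (hr : p + q = r) (i : Fin m) (x : R.obj m p)
      (y : R.obj n q), D l r (R.circ h hr i x y) =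
        R.circ h hr i (D m p x) y + R.circ h hr i x (D n q y)) : DGOperad k where
  toGradedOperad := R.toGradedOperad.oddExtension (-1) (by decide)
  -- In the notation `x + dt y` this is `d x + dt (D x - d y)`: the term `dt D x` differentiates
  -- along the path, and the minus sign comes from moving `d` past `dt`.
  d {n p q} h := LinearMap.prod
    ((R.d h).comp (LinearMap.fst k (R.obj n p) (R.obj n (p + -1))))
    ((R.castDeg (by omega : p = q + -1)).comp
      ((D n p).comp (LinearMap.fst k (R.obj n p) (R.obj n (p + -1)))) -
      (R.d (by omega : p + -1 + 1 = q + -1)).comp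
        (LinearMap.snd k (R.obj n p) (R.obj n (p + -1))))
  d_d {n p q r} h h' x := by
    obtain rfl : p = q + -1 := by omega
    obtain rfl : q = r + -1 := by omega
    refine Prod.ext (R.d_d h h' x.1) ?_
    change D _ _ (R.d _ x.1) - R.d _ (D _ _ x.1 - R.d _ x.2) = 0
    rw [map_sub, R.d_d, sub_zero, sub_eq_zero]
    exact D_d _ _
  d_act {n p q} h σ x := by
    obtain rfl : p = q + -1 := by omega
    refine Prod.ext (R.d_act h σ x.1) ?_
    change D _ _ (R.act σ x.1) - R.d _ (R.act σ x.2) = R.act σ (D _ _ x.1 - R.d _ x.2)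
    rw [map_sub, R.d_act, D_act]
  d_circ {m n l p q r p' q' r'} h hr hp' hq' hr' e₁ e₂ i x y := by
    obtain rfl : p = p' + -1 := by omega
    obtain rfl : q = q' + -1 := by omega
    obtain rfl : r = r' + -1 := by omega
    refine Prod.ext (R.d_circ h hr hp' hq' hr' e₁ e₂ i x.1 y.1) ?_
    have B1 := R.d_circ h
      (by omega : p' + -1 + -1 + (q' + -1) = r' + -1 + -1)
      (by omega : p' + -1 + -1 + 1 = p' + -1) hq' (by omega : r' + -1 + -1 + 1 = r' + -1)
      (by omega) (by omega) i x.2 y.1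
    have B2 := R.d_circ h
      (by omega : p' + -1 + (q' + -1 + -1) = r' + -1 + -1) hp'
      (by omega : q' + -1 + -1 + 1 = q' + -1) (by omega : r' + -1 + -1 + 1 = r' + -1)
      (by omega) (by omega) i x.1 y.2
    have B0 := D_circ h hr i x.1 y.1
    change D _ _ (R.circ h _ i x.1 y.1) -
      R.d _ (R.circ h _ i x.2 y.1 + (p' + -1).negOnePow • R.circ h _ i x.1 y.2) =
      (R.circ h _ i (D _ _ x.1 - R.d _ x.2) y.1 +
        p'.negOnePow • R.circ h _ i (R.d hp' x.1) y.2) +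
      (p' + -1).negOnePow • (R.circ h _ i x.2 (R.d hq' y.1) +
        (p' + -1).negOnePow • R.circ h _ i x.1 (D _ _ y.1 - R.d _ y.2))
    rw [map_add, Units.smul_def, map_zsmul, ← Units.smul_def, B0, B1, B2]
    simp only [map_sub, LinearMap.sub_apply, Int.negOnePow_add, smul_add, smul_sub]
    rcases Int.units_eq_one_or p'.negOnePow with hp | hp <;> simp [hp] <;> abel

/-- The path object `Q ⊗ Λ(t, dt)`. -/
noncomputable def pathObject (Q : DGOperad k) : DGOperad k :=
  derivationPath (Q.extendScalars (Polynomial k)) (fun n p => polyDeriv (Q.obj n p))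
    (fun σ x => polyDeriv_lTensor (Q.act σ) x) (fun h x => polyDeriv_lTensor (Q.d h) x)
    (fun h hr i x y => polyDeriv_map₂ (Q.circ h hr i) x y)

/-- Evaluation of paths. -/
noncomputable def pathEval (Q : DGOperad k) (c : k) : Hom Q.pathObject Q where
  map n p := (polyEval (Q.obj n p) c).comp
    (LinearMap.fst k (Polynomial k ⊗[k] Q.obj n p) (Polynomial k ⊗[k] Q.obj n (p + -1)))
  map_act σ x := polyEval_lTensor c (Q.act σ) _
  map_one := (polyEval_tmul c 1 Q.one).trans (by simp)
  map_circ h hr i x y := polyEval_map₂ c (Q.circ h hr i) x.1 y.1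
  map_d h x := polyEval_lTensor c (Q.d h) _

/-- The pairs with equal images. -/
def pullbackSubmodule {A B C : DGOperad k} (f : Hom A C) (g : Hom B C) (n : ℕ) (p : ℤ) :
    Submodule k (A.obj n p × B.obj n p) where
  carrier := {x | f.map n p x.1 = g.map n p x.2}
  zero_mem' := (map_zero (f.map n p)).trans (map_zero (g.map n p)).symm
  add_mem' := fun {x y} hx hy => by
    change f.map n p (x.1 + y.1) = g.map n p (x.2 + y.2)
    rw [map_add, map_add, show f.map n p x.1 = g.map n p x.2 from hx,
      show f.map n p y.1 = g.map n p y.2 from hy]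
  smul_mem' := fun c x hx => by
    change f.map n p (c • x.1) = g.map n p (c • x.2)
    rw [map_smul, map_smul, show f.map n p x.1 = g.map n p x.2 from hx]

/-- Pullbacks of dg operads. -/
def pullback {A B C : DGOperad k} (f : Hom A C) (g : Hom B C) : DGOperad k where
  toGradedOperad := (A.toGradedOperad.prod B.toGradedOperad).subOperad
    (pullbackSubmodule f g)
    (f.map_one.trans g.map_one.symm)
    (fun {n p} σ x hx => by
      change f.map n p (A.act σ x.1) = g.map n p (B.act σ x.2)
      rw [f.map_act, g.map_act, show f.map n p x.1 = g.map n p x.2 from hx])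
    (fun {m n l p q r} h hr i x y hx hy => by
      change f.map l r (A.circ h hr i x.1 y.1) = g.map l r (B.circ h hr i x.2 y.2)
      rw [f.map_circ, g.map_circ, show f.map m p x.1 = g.map m p x.2 from hx,
        show f.map n q y.1 = g.map n q y.2 from hy])
  d {n p q} h := ((A.d h).prodMap (B.d h)).restrict
      (p := pullbackSubmodule f g n p) (q := pullbackSubmodule f g n q) fun x hx => by
    change f.map n q (A.d h x.1) = g.map n q (B.d h x.2)
    rw [f.map_d, g.map_d, show f.map n p x.1 = g.map n p x.2 from hx]
  d_d h h' x := Subtype.ext (Prod.ext (A.d_d h h' x.1.1) (B.d_d h h' x.1.2))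
  d_act h σ x := Subtype.ext (Prod.ext (A.d_act h σ x.1.1) (B.d_act h σ x.1.2))
  d_circ h hr hp' hq' hr' e₁ e₂ i x y := Subtype.ext (Prod.ext
    (A.d_circ h hr hp' hq' hr' e₁ e₂ i x.1.1 y.1.1) (B.d_circ h hr hp' hq' hr' e₁ e₂ i x.1.2 y.1.2))

/-- The first projection of a pullback. -/
def pullbackFst {A B C : DGOperad k} (f : Hom A C) (g : Hom B C) : Hom (pullback f g) A where
  map n p := (LinearMap.fst k (A.obj n p) (B.obj n p)).comp
    (pullbackSubmodule f g n p).subtype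
  map_act _ _ := rfl
  map_one := rfl
  map_circ _ _ _ _ _ := rfl
  map_d _ _ := rfl

/-- The second projection of a pullback. -/
def pullbackSnd {A B C : DGOperad k} (f : Hom A C) (g : Hom B C) : Hom (pullback f g) B where
  map n p := (LinearMap.snd k (A.obj n p) (B.obj n p)).comp
    (pullbackSubmodule f g n p).subtype
  map_act _ _ := rfl
  map_one := rfl
  map_circ _ _ _ _ _ := rfl
  map_d _ _ := rfl

/-- A cocycle `a + dt b` of the path object is a family `a` of cocycles whose derivative in `t` is
the coboundary `d b`. -/
theorem path_cocycle {Q : DGOperad k} {n : ℕ} {q : ℤ} {x : Q.pathObject.obj n q}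
    (hx : Q.pathObject.d (rfl : q + 1 = q + 1) x = 0) (h : q + -1 + 1 = q) :
    (Q.d (rfl : q + 1 = q + 1)).lTensor (Polynomial k) x.1 = 0 ∧
      polyDeriv (Q.obj n q) x.1 = (Q.d h).lTensor (Polynomial k) x.2 := by
  have h' (r : ℤ) (hr : q + 1 = r) : Q.pathObject.d hr x = 0 := by subst hr; exact hx
  refine ⟨congrArg Prod.fst hx, ?_⟩
  obtain ⟨r, hr⟩ : ∃ r, r = q + 1 := ⟨_, rfl⟩
  obtain rfl : q = r + -1 := by omega
  exact sub_eq_zero.1 (congrArg Prod.snd (h' r (by omega)))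

section PathLifting

variable [CharZero k] {M Q : DGOperad k} (ρ : Hom M Q)

/-- Given `m'`, a path starting at `ρ m'` is obtained by integration: `w(t) = ρ m' + ∫₀ᵗ b`. Then
`dw/dt = b`, and `d w = a` because both sides have the same value at `0` and `d b = da/dt`. -/
theorem pullbackFst_strictLifts : (pullbackFst ρ (Q.pathEval 0)).StrictLifts := by
  rintro n p q h ⟨⟨m, (a : Polynomial k ⊗[k] Q.obj n q),
    (b : Polynomial k ⊗[k] Q.obj n (q + -1))⟩, hmx⟩ m' hx hm'
  obtain rfl : p = q + -1 := by omega
  have h4 : q + -1 + -1 + 1 = q + -1 := by omega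
  replace hmx : ρ.map n q m = polyEval _ 0 a := hmx
  replace hm' : M.d h m' = m := hm'
  have hx' : Q.pathObject.d (n := n) (p := q) rfl (a, b) = 0 := congrArg Prod.snd (congrArg Subtype.val hx)
  have h2 : polyDeriv _ a = (Q.d h).lTensor (Polynomial k) b := (path_cocycle hx' h).2
  let w : Polynomial k ⊗[k] Q.obj n (q + -1) :=
    1 ⊗ₜ ρ.map n (q + -1) m' + polyPrim (Q.obj n (q + -1)) b
  have hw0 : polyEval _ 0 w = ρ.map _ _ m' := by simp [w]
  have hw1 : polyDeriv _ w = b := by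
    simp only [w, map_add, polyDeriv_polyPrim]
    simp [polyDeriv]
  have hdw : (Q.d h).lTensor (Polynomial k) w = a := by
    simp only [w, map_add, LinearMap.lTensor_tmul]
    rw [← polyPrim_lTensor, ← h2, polyPrim_polyDeriv, ← hmx, ← ρ.map_d, hm']
    abel
  refine ⟨⟨(m', (w, 0)), hw0.symm⟩, Subtype.ext (Prod.ext hm' (Prod.ext hdw ?_)), rfl⟩
  change polyDeriv _ w - (Q.d h4).lTensor (Polynomial k) 0 = b
  rw [map_zero, sub_zero, hw1]

/-- Here the end point `z` of the path is prescribed and the starting point has to be found. As `ρ`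
is a quasi-isomorphism, there is an `m'` for which the integrated path ends at `z` up to a
coboundary `d z'`. Subtracting `t d z'` corrects the end point without moving the start, and the
component `-z'` along `dt` compensates for the derivative of this correction. -/
theorem pullbackSnd_strictLifts (hρ : ρ.IsQuasiIso) :
    ((Q.pathEval 1).comp (pullbackSnd ρ (Q.pathEval 0))).StrictLifts := by
  rintro n p q h ⟨⟨m, (a : Polynomial k ⊗[k] Q.obj n q),
    (b : Polynomial k ⊗[k] Q.obj n (q + -1))⟩, hmx⟩ z hx hz
  obtain rfl : p = q + -1 := by omega
  have h4 : q + -1 + -1 + 1 = q + -1 := by omega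
  replace hmx : ρ.map n q m = polyEval _ 0 a := hmx
  replace hz : Q.d h z = polyEval _ 1 a := hz
  have hx' : Q.pathObject.d (n := n) (p := q) rfl (a, b) = 0 := congrArg Prod.snd (congrArg Subtype.val hx)
  have hm : M.d rfl m = 0 := congrArg Prod.fst (congrArg Subtype.val hx)
  have h2 : polyDeriv _ a = (Q.d h).lTensor (Polynomial k) b := (path_cocycle hx' h).2
  have h3 : (Q.d h).lTensor (Polynomial k) (polyPrim _ b) = a - 1 ⊗ₜ ρ.map n q m := by
    rw [← polyPrim_lTensor, ← h2, polyPrim_polyDeriv, ← hmx]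
  obtain ⟨m', z', hm', hz'⟩ := ρ.isQuasiIso_iff.1 hρ n h h4 m
    (z - polyEval _ 1 (polyPrim _ b)) hm (by
      rw [map_sub, hz, ← polyEval_lTensor, h3, map_sub, polyEval_tmul, Polynomial.eval_one,
        one_smul, sub_sub_cancel])
  let w : Polynomial k ⊗[k] Q.obj n (q + -1) :=
    1 ⊗ₜ ρ.map n (q + -1) m' + polyPrim (Q.obj n (q + -1)) b - X ⊗ₜ Q.d h4 z'
  have hw0 : polyEval _ 0 w = ρ.map _ _ m' := by simp [w]
  have hw1 : polyEval _ 1 w = z := by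
    simp only [w, map_add, map_sub, polyEval_tmul, Polynomial.eval_one, one_smul,
      Polynomial.eval_X, hz']
    abel
  have hw2 : polyDeriv _ w = b - 1 ⊗ₜ Q.d h4 z' := by
    simp only [w, map_add, map_sub, polyDeriv_polyPrim]
    simp [polyDeriv]
  have hdw : (Q.d h).lTensor (Polynomial k) w = a := by
    simp only [w, map_add, map_sub, LinearMap.lTensor_tmul, Q.d_d, TensorProduct.tmul_zero, h3]
    rw [← ρ.map_d, hm']
    abel
  refine ⟨⟨(m', (w, -(1 ⊗ₜ z'))), hw0.symm⟩, Subtype.ext (Prod.ext hm' (Prod.ext hdw ?_)), hw1⟩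
  change polyDeriv _ w - (Q.d h4).lTensor (Polynomial k) (-(1 ⊗ₜ z')) = b
  rw [map_neg, LinearMap.lTensor_tmul, hw2]
  abel

end PathLifting

/-- Sullivan minimal models are unique up to isomorphism. -/
theorem exists_iso_of_isMinimalModel [CharZero k] {M M' Q : DGOperad k} (ρ : Hom M Q)
    (ρ' : Hom M' Q) (hρ : ρ.IsMinimalModel) (hρ' : ρ'.IsMinimalModel) :
    ∃ f : Hom M M', f.IsIso := by
  obtain ⟨⟨E, hE⟩, hq⟩ := hρ
  obtain ⟨⟨E', hE'⟩, hq'⟩ := hρ'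
  have hπ := pullbackSnd_strictLifts ρ' hq'
  obtain ⟨f, hf⟩ := hE.exists_lift _ hπ ρ
  -- The lift `f` is a quasi-isomorphism by two out of three, since it becomes `ρ` after composition
  -- with evaluation at `1`.
  refine ⟨(pullbackFst ρ' (Q.pathEval 0)).comp f, hE.isIso_of_isQuasiIso hE' _ ?_⟩
  refine (pullbackFst_strictLifts ρ').isQuasiIso.comp (hπ.isQuasiIso.of_comp_right ?_)
  intro n p
  have : (((Q.pathEval 1).comp (pullbackSnd ρ' (Q.pathEval 0))).comp f).toSigmaHom.cohomologyMap n p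
      = ρ.toSigmaHom.cohomologyMap n p := by
    refine LinearMap.ext fun x => ?_
    obtain ⟨x, rfl⟩ := Submodule.Quotient.mk_surjective _ x
    exact congrArg Submodule.Quotient.mk (Subtype.ext (hf n p x.1))
  rw [this]
  exact hq n p

end DGOperad
end OperadModels

/-! ### Truncation, and comparison of unitary with non-unitary minimal models. -/

namespace OperadModels

variable {k : Type u} [Field k]

namespace DGOperad

/-- The inclusion of the truncation. -/
def truncationInclusion (P : DGOperad k) : Hom P.truncation P where
  map n p := (supportedOn k (P.obj n p) (n ≠ 0)).subtype
  map_act _ _ := rfl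
  map_one := rfl
  map_circ _ _ _ _ _ := rfl
  map_d _ _ := rfl

theorem truncationInclusion_bijective (P : DGOperad k) {n : ℕ} (hn : n ≠ 0) (p : ℤ) :
    Function.Bijective (P.truncationInclusion.map n p) :=
  ⟨Subtype.val_injective, fun x => ⟨⟨x, fun h => absurd hn h⟩, rfl⟩⟩

theorem truncation_eq_zero (P : DGOperad k) {p : ℤ} (x : P.truncation.obj 0 p) : x = 0 :=
  Subtype.ext (x.2 (by simp))

/-- The morphism induced on truncations. -/
def Hom.truncation {P Q : DGOperad k} (f : Hom P Q) : Hom P.truncation Q.truncation where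
  map n p := (f.map n p).restrict fun x hx hn => by rw [hx hn, map_zero]
  map_act σ x := Subtype.ext (f.map_act σ x.1)
  map_one := Subtype.ext f.map_one
  map_circ h hr i x y := Subtype.ext (f.map_circ h hr i x.1 y.1)
  map_d h x := Subtype.ext (f.map_d h x.1)

theorem Hom.IsQuasiIso.truncation {P Q : DGOperad k} {f : Hom P Q} (hf : f.IsQuasiIso) :
    f.truncation.IsQuasiIso := by
  rw [Hom.isQuasiIso_iff] at hf ⊢
  intro n p q t h ht a b ha hb
  by_cases hn : n = 0
  · subst hn
    exact ⟨0, 0, (truncation_eq_zero _ _).trans (truncation_eq_zero _ _).symm,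
      (truncation_eq_zero _ _).trans (truncation_eq_zero _ _).symm⟩
  · obtain ⟨a', b', h1, h2⟩ := hf n h ht a.1 b.1 (congrArg Subtype.val ha) (congrArg Subtype.val hb)
    exact ⟨⟨a', fun h => absurd hn h⟩, ⟨b', fun h => absurd hn h⟩, Subtype.ext h1, Subtype.ext h2⟩

theorem Hom.IsUnitaryMinimalModel.truncation {S P : DGOperad k} {ρ : Hom S P}
    (hρ : ρ.IsUnitaryMinimalModel) : ρ.truncation.IsMinimalModel := by
  obtain ⟨⟨-, E, hE, -⟩, hq⟩ := hρ
  exact ⟨⟨E, hE⟩, hq.truncation⟩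

open Classical in
/-- The projection to `V` or to `0`. -/
noncomputable def supportedProj (k : Type u) [Field k] (V : Type u) [AddCommGroup V] [Module k V]
    (c : Prop) : V →ₗ[k] supportedOn k V c :=
  if hc : c then LinearMap.id.codRestrict (supportedOn k V c) (fun _ h => absurd hc h) else 0

theorem supportedProj_val {V : Type u} [AddCommGroup V] [Module k V] {c : Prop} (hc : c) (x : V) :
    (supportedProj k V c x).1 = x := by
  rw [supportedProj, dif_pos hc]
  rfl

theorem supportedOn_eq_zero {V : Type u} [AddCommGroup V] [Module k V] {c : Prop} (hc : ¬ c)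
    (x : supportedOn k V c) : x = 0 :=
  Subtype.ext (x.2 hc)

open Classical in
/-- The coordinate in arity and degree `0` of a unitary operad. -/
noncomputable def IsUnitary.coord {S : DGOperad k} (hS : S.IsUnitary) (n : ℕ) (p : ℤ) :
    S.obj n p →ₗ[k] k :=
  if h : n = 0 ∧ p = 0 then by
    obtain ⟨rfl, rfl⟩ := h
    exact hS.1.some.toLinearMap else 0

theorem IsUnitary.coord_zero {S : DGOperad k} (hS : S.IsUnitary) :
    hS.coord 0 0 = hS.1.some.toLinearMap := by
  rw [coord, dif_pos ⟨rfl, rfl⟩]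

/-- The projection of a unitary operad to its truncation and its unit, as `Σ`-modules. -/
noncomputable def IsUnitary.toTruncation {S : DGOperad k} (hS : S.IsUnitary) :
    S.toDGSigmaModule.Hom
      (S.truncation.toDGSigmaModule.directSum (DGSigmaModule.groundInArityZero k)) where
  map n p := (supportedProj k (S.obj n p) (n ≠ 0)).prod
    ((supportedProj k k (n = 0 ∧ p = 0)).comp (hS.coord n p))
  map_act {n p} σ x := by
    refine Prod.ext ?_ ?_
    · by_cases hn : n ≠ 0
      · exact Subtype.ext ((supportedProj_val hn (S.act σ x)).trans
          (congrArg (S.act σ) (supportedProj_val hn x).symm))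
      · exact (supportedOn_eq_zero hn _).trans (supportedOn_eq_zero hn _).symm
    · by_cases h : n = 0 ∧ p = 0
      · obtain ⟨rfl, rfl⟩ := h
        rw [show σ = 1 from Subsingleton.elim _ _, S.act_one]
        rfl
      · exact (supportedOn_eq_zero h _).trans (supportedOn_eq_zero h _).symm
  map_d {n p q} h x := by
    refine Prod.ext ?_ ?_
    · by_cases hn : n ≠ 0
      · exact Subtype.ext ((supportedProj_val hn (S.d h x)).trans
          (congrArg (S.d h) (supportedProj_val hn x).symm))
      · exact (supportedOn_eq_zero hn _).trans (supportedOn_eq_zero hn _).symm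
    · by_cases h' : n = 0 ∧ q = 0
      · obtain ⟨rfl, rfl⟩ := h'
        have := hS.2 p (by omega)
        obtain rfl : x = 0 := Subsingleton.elim (α := S.obj 0 p) x 0
        change supportedProj k k _ (hS.coord 0 0 (S.d h 0)) = 0
        rw [map_zero, map_zero, map_zero]
      · exact (supportedOn_eq_zero h' _).trans (supportedOn_eq_zero h' _).symm

theorem IsUnitary.toTruncation_isIso {S : DGOperad k} (hS : S.IsUnitary) :
    hS.toTruncation.IsIso := by
  intro n p
  by_cases hn : n = 0
  · subst hn
    by_cases hp : p = 0
    · subst hp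
      have hval (x : S.obj 0 0) :
          (supportedProj k k ((0 : ℕ) = 0 ∧ (0 : ℤ) = 0) (hS.coord 0 0 x)).1 = hS.1.some x := by
        rw [supportedProj_val ⟨rfl, rfl⟩, hS.coord_zero]
        rfl
      constructor
      · intro x y hxy
        apply hS.1.some.injective
        rw [← hval, ← hval]
        exact congrArg Subtype.val (congrArg Prod.snd hxy)
      · intro y
        refine ⟨hS.1.some.symm y.2.1, Prod.ext ((truncation_eq_zero _ _).trans
          (truncation_eq_zero _ _).symm) (Subtype.ext ?_)⟩
        exact (hval _).trans (LinearEquiv.apply_symm_apply _ _)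
    · have := hS.2 p hp
      refine ⟨fun x y _ => Subsingleton.elim (α := S.obj 0 p) x y, fun y => ⟨0, Prod.ext
        ((truncation_eq_zero _ _).trans (truncation_eq_zero _ _).symm)
        ((supportedOn_eq_zero ?_ _).trans (supportedOn_eq_zero ?_ _).symm)⟩⟩ <;> simp [hp]
  · refine ⟨fun x y hxy => ?_, fun y => ⟨y.1.1, Prod.ext
      (Subtype.ext (supportedProj_val hn _))
      ((supportedOn_eq_zero ?_ _).trans (supportedOn_eq_zero ?_ _).symm)⟩⟩
    · have := congrArg Subtype.val (congrArg Prod.fst hxy)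
      exact (supportedProj_val hn x).symm.trans (this.trans (supportedProj_val hn y))
    all_goals simp [hn]

/-- The comparison of a unitary Sullivan minimal model with the Sullivan minimal models of the
truncation. -/
theorem Hom.IsUnitaryMinimalModel.comparison [CharZero k] {S P : DGOperad k} {ρS : Hom S P}
    (hρS : ρS.IsUnitaryMinimalModel) (M : DGOperad k) (ρM : Hom M P.truncation)
    (hρM : ρM.IsMinimalModel) :
    (∃ (Mp : DGOperad k) (i : M.Hom Mp), i.IsUnitaryExtension ∧
      (∃ ρp : Mp.Hom P, ρp.IsUnitaryMinimalModel) ∧ ∃ φ : S.Hom Mp, φ.IsIso) ∧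
    ∃ ψ : S.toDGSigmaModule.Hom
      (M.toDGSigmaModule.directSum (DGSigmaModule.groundInArityZero k)), ψ.IsIso := by
  obtain ⟨f, hf⟩ := exists_iso_of_isMinimalModel ρM ρS.truncation hρM hρS.truncation
  constructor
  -- The unitary extension of `M` is `S` itself, reached through the isomorphism `f` from `M` to the
  -- truncation of `S`.
  · refine ⟨S, S.truncationInclusion.comp f, ⟨?_, hρS.1.1, ?_⟩, ⟨ρS, hρS⟩, Hom.id S,
      fun n p => Function.bijective_id⟩
    · intro p
      exact ⟨fun x y => (hf 0 p).1
        ((truncation_eq_zero _ _).trans (truncation_eq_zero _ _).symm)⟩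
    · intro n p hn
      exact (S.truncationInclusion_bijective hn.ne' p).comp (hf n p)
  · let g := f.inverse hf
    have hg : g.IsIso := f.inverse_isIso hf
    have hT := hρS.1.1.toTruncation_isIso
    refine ⟨{ map := fun n p => ((g.map n p).prodMap LinearMap.id).comp
                (hρS.1.1.toTruncation.map n p)
              map_act := fun {n p} σ x => ?_
              map_d := fun {n p q} h x => ?_ }, fun n p => ?_⟩
    · have := hρS.1.1.toTruncation.map_act σ x
      exact (congrArg ((g.map n p).prodMap LinearMap.id) this).trans
        (Prod.ext (g.map_act σ _) rfl)
    · have := hρS.1.1.toTruncation.map_d h x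
      exact (congrArg ((g.map n q).prodMap LinearMap.id) this).trans
        (Prod.ext (g.map_d h _) rfl)
    · exact (Function.Bijective.prodMap (hg n p) Function.bijective_id).comp (hT n p)

end DGOperad
end OperadModels

/-! ### Construction of free graded operads. -/

namespace OperadModels

variable {k : Type u} [Field k]

namespace GradedOperad

/-- Formal operadic expressions in the elements of a graded `Σ`-module. -/
inductive Term (X : GradedSigmaModule k) : ℕ → ℤ → Type u
  | gen {n : ℕ} {p : ℤ} (x : X.obj n p) : Term X n p
  | one : Term X 1 0
  | zero {n : ℕ} {p : ℤ} : Term X n p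
  | add {n : ℕ} {p : ℤ} (x y : Term X n p) : Term X n p
  | smul {n : ℕ} {p : ℤ} (c : k) (x : Term X n p) : Term X n p
  | act {n : ℕ} {p : ℤ} (σ : Equiv.Perm (Fin n)) (x : Term X n p) : Term X n p
  | circ {m n l : ℕ} {p q r : ℤ} (h : l + 1 = m + n) (hr : p + q = r) (i : Fin m)
      (x : Term X m p) (y : Term X n q) : Term X l r

namespace Term

variable {X : GradedSigmaModule k}

/-- Evaluation of operadic expressions in an operad. -/
def eval (Q : GradedOperad k) (f : ∀ n p, X.obj n p →ₗ[k] Q.obj n p) :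
    ∀ {n : ℕ} {p : ℤ}, Term X n p → Q.obj n p
  | _, _, gen x => f _ _ x
  | _, _, one => Q.one
  | _, _, zero => 0
  | _, _, add x y => eval Q f x + eval Q f y
  | _, _, smul c x => c • eval Q f x
  | _, _, act σ x => Q.act σ (eval Q f x)
  | _, _, circ h hr i x y => Q.circ h hr i (eval Q f x) (eval Q f y)

/-- Two expressions are identified if they have the same value in every operad. -/
instance setoid (X : GradedSigmaModule k) (n : ℕ) (p : ℤ) : Setoid (Term X n p) where
  r t t' := ∀ (Q : GradedOperad k) (f : ∀ n p, X.obj n p →ₗ[k] Q.obj n p),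
    (∀ (n : ℕ) (p : ℤ) (σ : Equiv.Perm (Fin n)) (x : X.obj n p),
      f n p (X.act σ x) = Q.act σ (f n p x)) → eval Q f t = eval Q f t'
  iseqv := ⟨fun _ _ _ _ => rfl, fun h Q f hf => (h Q f hf).symm,
    fun h h' Q f hf => (h Q f hf).trans (h' Q f hf)⟩

end Term

/-- The operations of the free operad. -/
def FreeObj (X : GradedSigmaModule k) (n : ℕ) (p : ℤ) : Type u := Quotient (Term.setoid X n p)

instance (X : GradedSigmaModule k) (n : ℕ) (p : ℤ) : Zero (FreeObj X n p) where
  zero := Quotient.mk _ .zero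

instance (X : GradedSigmaModule k) (n : ℕ) (p : ℤ) : Add (FreeObj X n p) where
  add := Quotient.map₂ .add fun _ _ h _ _ h' Q f hf => by
    simp only [Term.eval, h Q f hf, h' Q f hf]

instance (X : GradedSigmaModule k) (n : ℕ) (p : ℤ) : Neg (FreeObj X n p) where
  neg := Quotient.map (.smul (-1)) fun _ _ h Q f hf => by simp only [Term.eval, h Q f hf]

instance (X : GradedSigmaModule k) (n : ℕ) (p : ℤ) : AddCommGroup (FreeObj X n p) where
  add_assoc x y z := by
    induction x, y, z using Quotient.inductionOn₃
    exact Quotient.sound fun Q f hf => add_assoc _ _ _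
  zero_add x := by
    induction x using Quotient.inductionOn
    exact Quotient.sound fun Q f hf => zero_add _
  add_zero x := by
    induction x using Quotient.inductionOn
    exact Quotient.sound fun Q f hf => add_zero _
  add_comm x y := by
    induction x, y using Quotient.inductionOn₂
    exact Quotient.sound fun Q f hf => add_comm _ _
  neg_add_cancel x := by
    induction x using Quotient.inductionOn
    exact Quotient.sound fun Q f hf => by simp [Term.eval]
  nsmul := nsmulRec
  zsmul := zsmulRec

instance (X : GradedSigmaModule k) (n : ℕ) (p : ℤ) : Module k (FreeObj X n p) where
  smul c := Quotient.map (.smul c) fun _ _ h Q f hf => by simp only [Term.eval, h Q f hf]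
  one_smul x := by
    induction x using Quotient.inductionOn
    exact Quotient.sound fun Q f hf => one_smul _ _
  mul_smul c c' x := by
    induction x using Quotient.inductionOn
    exact Quotient.sound fun Q f hf => mul_smul _ _ _
  smul_zero c := Quotient.sound fun Q f hf => smul_zero _
  smul_add c x y := by
    induction x, y using Quotient.inductionOn₂
    exact Quotient.sound fun Q f hf => smul_add _ _ _
  add_smul c c' x := by
    induction x using Quotient.inductionOn
    exact Quotient.sound fun Q f hf => add_smul _ _ _
  zero_smul x := by
    induction x using Quotient.inductionOn
    exact Quotient.sound fun Q f hf => zero_smul _ _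

/-- The free graded operad on a graded `Σ`-module. -/
def free (X : GradedSigmaModule k) : GradedOperad k where
  obj := FreeObj X
  act σ :=
    { toFun := Quotient.map (.act σ) fun _ _ h Q f hf => by simp only [Term.eval, h Q f hf]
      map_add' := fun x y => by
        induction x, y using Quotient.inductionOn₂
        exact Quotient.sound fun Q f hf => map_add _ _ _
      map_smul' := fun c x => by
        induction x using Quotient.inductionOn
        exact Quotient.sound fun Q f hf => map_smul _ _ _ }
  -- Since expressions are identified when all their values agree, every axiom of operads holds in
  -- the quotient because it holds in each operad of values.
  act_one x := by
    induction x using Quotient.inductionOn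
    exact Quotient.sound fun Q f hf => Q.act_one _
  act_mul σ τ x := by
    induction x using Quotient.inductionOn
    exact Quotient.sound fun Q f hf => Q.act_mul _ _ _
  one := Quotient.mk _ .one
  circ h hr i := LinearMap.mk₂ k
    (Quotient.map₂ (.circ h hr i) fun _ _ h _ _ h' Q f hf => by
      simp only [Term.eval, h Q f hf, h' Q f hf])
    (fun x x' y => by
      induction x, x', y using Quotient.inductionOn₃
      exact Quotient.sound fun Q f hf => LinearMap.map_add₂ _ _ _ _)
    (fun c x y => by
      induction x, y using Quotient.inductionOn₂
      exact Quotient.sound fun Q f hf => LinearMap.map_smul₂ _ _ _ _)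
    (fun x y y' => by
      induction x, y, y' using Quotient.inductionOn₃
      exact Quotient.sound fun Q f hf => map_add _ _ _)
    (fun c x y => by
      induction x, y using Quotient.inductionOn₂
      exact Quotient.sound fun Q f hf => map_smul _ _ _)
  one_circ h hp x := by
    induction x using Quotient.inductionOn
    exact Quotient.sound fun Q f hf => Q.one_circ _ _ _
  circ_one h hp i x := by
    induction x using Quotient.inductionOn
    exact Quotient.sound fun Q f hf => Q.circ_one _ _ _ _
  circ_circ_inner h₁ h₂ h₃ h₄ e₁ e₂ e₃ e₄ i j x y z := by
    induction x, y, z using Quotient.inductionOn₃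
    exact Quotient.sound fun Q f hf => Q.circ_circ_inner h₁ h₂ h₃ h₄ e₁ e₂ e₃ e₄ i j _ _ _
  circ_circ_outer {a b c ab ac abc p q s pq ps pqs} h₁ h₂ h₃ h₄ e₁ e₂ e₃ e₄ i j hij x y z := by
    -- The sign acts on classes through their additive group, not through an expression; after the
    -- case distinction it is either absent or the negation, which is represented by the expression
    -- `(-1) • t`.
    have hs : (q * s).negOnePow = 1 ∨ (q * s).negOnePow = -1 := Int.units_eq_one_or _
    induction x, y, z using Quotient.inductionOn₃
    rcases hs with hs | hs
    · rw [hs, one_smul]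
      refine Quotient.sound fun Q f hf => ?_
      have := Q.circ_circ_outer h₁ h₂ h₃ h₄ e₁ e₂ e₃ e₄ i j hij
      simp only [hs, one_smul] at this
      exact this _ _ _
    · rw [hs, Units.neg_smul, one_smul]
      refine Quotient.sound fun Q f hf => ?_
      have := Q.circ_circ_outer h₁ h₂ h₃ h₄ e₁ e₂ e₃ e₄ i j hij
      simp only [hs, Units.neg_smul, one_smul] at this
      exact (this _ _ _).trans (neg_one_smul k _).symm
  circ_act h hr i σ τ x y := by
    induction x, y using Quotient.inductionOn₂
    exact Quotient.sound fun Q f hf => Q.circ_act h hr i σ τ _ _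

/-- The generators of the free operad. -/
def freeGen (X : GradedSigmaModule k) (n : ℕ) (p : ℤ) : X.obj n p →ₗ[k] (free X).obj n p where
  toFun x := Quotient.mk _ (.gen x)
  map_add' _ _ := Quotient.sound fun _ _ _ => map_add _ _ _
  map_smul' _ _ := Quotient.sound fun _ _ _ => map_smul _ _ _

theorem freeGen_act (X : GradedSigmaModule k) {n : ℕ} {p : ℤ} (σ : Equiv.Perm (Fin n))
    (x : X.obj n p) : freeGen X n p (X.act σ x) = (free X).act σ (freeGen X n p x) :=
  Quotient.sound fun _ _ hf => hf _ _ _ _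

/-- The morphism out of the free operad which extends an equivariant map. -/
def freeLift {X : GradedSigmaModule k} {Q : GradedOperad k}
    (f : ∀ n p, X.obj n p →ₗ[k] Q.obj n p)
    (hf : ∀ (n : ℕ) (p : ℤ) (σ : Equiv.Perm (Fin n)) (x : X.obj n p),
      f n p (X.act σ x) = Q.act σ (f n p x)) : Hom (free X) Q where
  map n p :=
    { toFun := Quotient.lift (Term.eval Q f) fun _ _ h => h Q f hf
      map_add' := fun x y => by
        induction x, y using Quotient.inductionOn₂
        rfl
      map_smul' := fun c x => by
        induction x using Quotient.inductionOn
        rfl }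
  map_act σ x := by
    induction x using Quotient.inductionOn
    rfl
  map_one := rfl
  map_circ h hr i x y := by
    induction x, y using Quotient.inductionOn₂
    rfl

@[simp] theorem freeLift_gen {X : GradedSigmaModule k} {Q : GradedOperad k}
    (f : ∀ n p, X.obj n p →ₗ[k] Q.obj n p)
    (hf : ∀ (n : ℕ) (p : ℤ) (σ : Equiv.Perm (Fin n)) (x : X.obj n p),
      f n p (X.act σ x) = Q.act σ (f n p x)) {n p} (x : X.obj n p) :
    (freeLift f hf).map n p (freeGen X n p x) = f n p x := rfl

theorem free_generated {X : GradedSigmaModule k} {n p} (x : (free X).obj n p) :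
    (free X).Generated (fun n p => Set.range (freeGen X n p)) x := by
  induction x using Quotient.inductionOn with
  | _ t =>
  induction t with
  | gen x => exact .of _ ⟨x, rfl⟩
  | one => exact .one
  | zero => exact .zero
  | add x y hx hy => exact .add _ _ hx hy
  | smul c x hx => exact .smul c _ hx
  | act σ x hx => exact .act σ _ hx
  | circ h hr i x y hx hy => exact .circ h hr i _ _ hx hy

theorem free_isFreeOn (X : GradedSigmaModule k) :
    (free X).IsFreeOn (fun n p => LinearMap.range (freeGen X n p)) := by
  constructor
  · rintro n p σ _ ⟨x, rfl⟩
    exact ⟨X.act σ x, freeGen_act X σ x⟩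
  · intro Q f hf
    refine ⟨freeLift (fun n p => (f n p).comp (freeGen X n p).rangeRestrict)
      (fun n p σ x => hf n p σ _ _ (freeGen_act X σ x)), ?_, ?_⟩
    · rintro n p ⟨_, x, rfl⟩
      rfl
    · intro φ hφ
      apply Hom.ext'
      intro n p x
      refine Generated.hom_eq _ _ ?_ (free_generated x)
      rintro n p _ ⟨x, rfl⟩
      exact hφ n p ⟨_, x, rfl⟩

end GradedOperad
end OperadModels

namespace OperadModels

variable {k : Type u} [Field k]

/-! ### Inputs of partial compositions -/

theorem slot_cases {m n l : ℕ} (h : l + 1 = m + n) (i : Fin m) (s : Fin l) :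
    (∃ a ha, s = outerSlot h i a ha) ∨ ∃ j, s = innerSlot h i j := by
  obtain ⟨a | j, rfl⟩ := (slotEquiv h i).surjective s
  · exact .inl ⟨a.1, a.2, rfl⟩
  · exact .inr ⟨j, rfl⟩

theorem slotEquiv_symm_outer {m n l : ℕ} (h : l + 1 = m + n) (i a : Fin m) (ha : a ≠ i) :
    (slotEquiv h i).symm (outerSlot h i a ha) = .inl ⟨a, ha⟩ :=
  (Equiv.symm_apply_eq _).2 rfl

theorem slotEquiv_symm_inner {m n l : ℕ} (h : l + 1 = m + n) (i : Fin m) (j : Fin n) :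
    (slotEquiv h i).symm (innerSlot h i j) = .inr j :=
  (Equiv.symm_apply_eq _).2 rfl

theorem blockPerm_outer {m n l : ℕ} (h : l + 1 = m + n) (i : Fin m) (σ : Equiv.Perm (Fin m))
    (τ : Equiv.Perm (Fin n)) (a : Fin m) (ha : a ≠ i) :
    blockPerm h i σ τ (outerSlot h i a ha) = outerSlot h (σ i) (σ a) (σ.injective.ne ha) := by
  simp only [blockPerm, Equiv.trans_apply, slotEquiv_symm_outer]
  rfl

theorem blockPerm_inner {m n l : ℕ} (h : l + 1 = m + n) (i : Fin m) (σ : Equiv.Perm (Fin m))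
    (τ : Equiv.Perm (Fin n)) (j : Fin n) :
    blockPerm h i σ τ (innerSlot h i j) = innerSlot h (σ i) (τ j) := by
  simp only [blockPerm, Equiv.trans_apply, slotEquiv_symm_inner]
  rfl

theorem blockPerm_mul {m n l : ℕ} (h : l + 1 = m + n) (i : Fin m) (σ σ' : Equiv.Perm (Fin m))
    (τ τ' : Equiv.Perm (Fin n)) :
    blockPerm h i (σ * σ') (τ * τ') = blockPerm h (σ' i) σ τ * blockPerm h i σ' τ' := by
  ext1 s
  obtain ⟨a, ha, rfl⟩ | ⟨j, rfl⟩ := slot_cases h i s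
  · rw [Equiv.Perm.mul_apply, blockPerm_outer, blockPerm_outer, blockPerm_outer]
    rfl
  · rw [Equiv.Perm.mul_apply, blockPerm_inner, blockPerm_inner, blockPerm_inner]
    rfl

theorem blockPerm_one {m n l : ℕ} (h : l + 1 = m + n) (i : Fin m) :
    blockPerm h i 1 1 = 1 := by
  ext1 s
  obtain ⟨a, ha, rfl⟩ | ⟨j, rfl⟩ := slot_cases h i s
  · rw [blockPerm_outer]; rfl
  · rw [blockPerm_inner]; rfl

theorem blockPerm_unary_right {m : ℕ} (h : m + 1 = m + 1) (i : Fin m) (σ : Equiv.Perm (Fin m))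
    (τ : Equiv.Perm (Fin 1)) : blockPerm h i σ τ = σ := by
  have outer (i a : Fin m) (ha : a ≠ i) : outerSlot h i a ha = a := by
    have : (a : ℕ) ≠ i := fun e => ha (Fin.ext e)
    apply Fin.ext
    simp only [outerSlot]
    split_ifs <;> omega
  have inner (i : Fin m) (j : Fin 1) : innerSlot h i j = i := by
    apply Fin.ext
    simp only [innerSlot]
    omega
  ext1 s
  obtain ⟨a, ha, hs⟩ | ⟨j, hs⟩ := slot_cases h i s
  · rw [hs, blockPerm_outer, outer, outer]
  · rw [hs, blockPerm_inner, inner, inner]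

theorem blockPerm_unary_left {n : ℕ} (h : n + 1 = 1 + n) (i : Fin 1) (σ : Equiv.Perm (Fin 1))
    (τ : Equiv.Perm (Fin n)) : blockPerm h i σ τ = τ := by
  have inner (i : Fin 1) (j : Fin n) : innerSlot h i j = j := by
    apply Fin.ext
    simp only [innerSlot]
    omega
  ext1 s
  obtain ⟨a, ha, hs⟩ | ⟨j, hs⟩ := slot_cases h i s
  · exact absurd (Subsingleton.elim a i) ha
  · rw [hs, blockPerm_inner, inner, inner]

/-- The position of the input `i` after deletion of the input `a`. -/
abbrev delSlot {m : ℕ} (a i : Fin m) (h : i ≠ a) : Fin (m - 1) :=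
  outerSlot (show m - 1 + 1 = m + 0 by have := a.2; omega) a i h

/-- The permutation induced by `σ` after deletion of the input `a`. -/
noncomputable abbrev delPerm {m : ℕ} (σ : Equiv.Perm (Fin m)) (a : Fin m) :
    Equiv.Perm (Fin (m - 1)) :=
  blockPerm (show m - 1 + 1 = m + 0 by have := a.2; omega) a σ 1

theorem exists_delSlot {m : ℕ} (a : Fin m) (s : Fin (m - 1)) : ∃ i h, s = delSlot a i h := by
  obtain h | ⟨j, -⟩ := slot_cases (show m - 1 + 1 = m + 0 by have := a.2; omega) a s
  · exact h
  · exact j.elim0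

/-- This and the next three lemmas say where an input of a composition goes when another one is
deleted. The four cases depend on whether the tracked input (first word of the name) and the deleted
one (last word) belong to the outer or to the inner operation. -/
theorem outer_del_outer {m n l : ℕ} (h : l + 1 = m + n) (h' : l - 1 + 1 = m - 1 + n) {i a b : Fin m}
    (ha : a ≠ i) (hb : b ≠ i) (hab : b ≠ a) (h₁ h₂) :
    outerSlot h' (delSlot a i ha.symm) (delSlot a b hab) h₁ =
      delSlot (outerSlot h i a ha) (outerSlot h i b hb) h₂ := by
  have ha' : (a : ℕ) ≠ i := fun e => ha (Fin.ext e)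
  have hb' : (b : ℕ) ≠ i := fun e => hb (Fin.ext e)
  have hab' : (b : ℕ) ≠ a := fun e => hab (Fin.ext e)
  apply Fin.ext
  simp only [outerSlot, delSlot]
  split_ifs <;> omega

theorem inner_del_outer {m n l : ℕ} (h : l + 1 = m + n) (h' : l - 1 + 1 = m - 1 + n) {i a : Fin m}
    (ha : a ≠ i) (j : Fin n) (h₂) :
    innerSlot h' (delSlot a i ha.symm) j = delSlot (outerSlot h i a ha) (innerSlot h i j) h₂ := by
  have ha' : (a : ℕ) ≠ i := fun e => ha (Fin.ext e)
  apply Fin.ext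
  simp only [outerSlot, innerSlot, delSlot]
  split_ifs <;> omega

theorem outer_del_inner {m n l : ℕ} (h : l + 1 = m + n) (h' : l - 1 + 1 = m + (n - 1)) {i a : Fin m}
    (ha : a ≠ i) (j : Fin n) (h₂) :
    outerSlot h' i a ha = delSlot (innerSlot h i j) (outerSlot h i a ha) h₂ := by
  have ha' : (a : ℕ) ≠ i := fun e => ha (Fin.ext e)
  apply Fin.ext
  simp only [outerSlot, innerSlot, delSlot]
  split_ifs <;> omega

theorem inner_del_inner {m n l : ℕ} (h : l + 1 = m + n) (h' : l - 1 + 1 = m + (n - 1)) (i : Fin m)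
    {j j' : Fin n} (hj : j' ≠ j) (h₂) :
    innerSlot h' i (delSlot j j' hj) = delSlot (innerSlot h i j) (innerSlot h i j') h₂ := by
  have ha' : (j' : ℕ) ≠ j := fun e => hj (Fin.ext e)
  apply Fin.ext
  change (i : ℕ) + (if (j' : ℕ) < j then (j' : ℕ) else j' + 0 - 1) =
    if (i + j' : ℕ) < i + j then (i + j' : ℕ) else i + j' + 0 - 1
  split_ifs <;> omega

theorem innerSlot_ne_outerSlot {m n l : ℕ} (h : l + 1 = m + n) {i a : Fin m} (ha : a ≠ i)
    (j : Fin n) : innerSlot h i j ≠ outerSlot h i a ha := by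
  intro e
  have := (slotEquiv h i).injective (a₁ := .inr j) (a₂ := .inl ⟨a, ha⟩) e
  cases this

theorem outerSlot_ne_outerSlot {m n l : ℕ} (h : l + 1 = m + n) {i a b : Fin m} (ha : a ≠ i)
    (hb : b ≠ i) (hab : a ≠ b) : outerSlot h i a ha ≠ outerSlot h i b hb := by
  intro e
  have := (slotEquiv h i).injective (a₁ := .inl ⟨a, ha⟩) (a₂ := .inl ⟨b, hb⟩) e
  simp at this
  exact hab this

theorem innerSlot_ne_innerSlot {m n l : ℕ} (h : l + 1 = m + n) (i : Fin m) {j j' : Fin n}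
    (hj : j ≠ j') : innerSlot h i j ≠ innerSlot h i j' := by
  intro e
  have := (slotEquiv h i).injective (a₁ := .inr j) (a₂ := .inr j') e
  simp at this
  exact hj this

theorem outerSlot_congr {m n l : ℕ} (h : l + 1 = m + n) {i i' a a' : Fin m} (hi : i = i')
    (ha : a = a') (h₁ h₂) : outerSlot h i a h₁ = outerSlot h i' a' h₂ := by
  subst hi ha
  rfl

/-- Deletion of an input is compatible with block permutations; with its companion for inner inputs,
this is what makes the restriction of a composition equivariant. -/
theorem blockPerm_delPerm_outer {m n l : ℕ} (h : l + 1 = m + n) (h' : l - 1 + 1 = m - 1 + n)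
    (i a : Fin m) (ha : a ≠ i) (σ : Equiv.Perm (Fin m)) (τ : Equiv.Perm (Fin n)) :
    blockPerm h' (delSlot a i ha.symm) (delPerm σ a) τ =
      delPerm (blockPerm h i σ τ) (outerSlot h i a ha) := by
  ext1 s
  have hσ := σ.injective.ne ha
  have e0 : delPerm σ a (delSlot a i ha.symm) = delSlot (σ a) (σ i) hσ.symm :=
    blockPerm_outer _ _ _ _ _ _
  obtain ⟨b', hb', rfl⟩ | ⟨j, rfl⟩ := slot_cases h' (delSlot a i ha.symm) s
  · obtain ⟨b, hb, rfl⟩ := exists_delSlot a b'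
    have hbi : b ≠ i := by
      rintro rfl
      exact hb' rfl
    have hσb := σ.injective.ne hb
    have hσbi := σ.injective.ne hbi
    have e1 : delPerm σ a (delSlot a b hb) = delSlot (σ a) (σ b) hσb :=
      blockPerm_outer _ _ _ _ _ _
    have h₃ : delSlot (σ a) (σ b) hσb ≠ delSlot (σ a) (σ i) hσ.symm :=
      outerSlot_ne_outerSlot _ _ _ hσbi
    have h₄ := outerSlot_ne_outerSlot h hσbi hσ hσb
    have h₅ := outerSlot_ne_outerSlot h hbi ha hb
    rw [blockPerm_outer, outer_del_outer h h' ha hbi hb _ h₅]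
    refine (outerSlot_congr h' e0 e1 _ h₃).trans ?_
    rw [outer_del_outer h h' hσ hσbi hσb h₃ h₄]
    refine Eq.trans ?_ (blockPerm_outer _ _ _ _ _ h₅).symm
    exact outerSlot_congr _ (blockPerm_outer ..).symm (blockPerm_outer ..).symm _ _
  · have h₄ := innerSlot_ne_outerSlot h hσ (τ j)
    have h₅ := innerSlot_ne_outerSlot h ha j
    rw [blockPerm_inner, inner_del_outer h h' ha j h₅]
    refine Eq.trans ?_ (blockPerm_outer _ _ _ _ _ h₅).symm
    refine (congrArg (innerSlot h' · (τ j)) e0).trans ?_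
    rw [inner_del_outer h h' hσ _ h₄]
    exact outerSlot_congr _ (blockPerm_outer ..).symm (blockPerm_inner ..).symm _ _

theorem blockPerm_delPerm_inner {m n l : ℕ} (h : l + 1 = m + n) (h' : l - 1 + 1 = m + (n - 1))
    (i : Fin m) (j : Fin n) (σ : Equiv.Perm (Fin m)) (τ : Equiv.Perm (Fin n)) :
    blockPerm h' i σ (delPerm τ j) = delPerm (blockPerm h i σ τ) (innerSlot h i j) := by
  ext1 s
  obtain ⟨b, hb, rfl⟩ | ⟨j', rfl⟩ := slot_cases h' i s
  · rw [blockPerm_outer, outer_del_inner h h' hb j (innerSlot_ne_outerSlot h hb j).symm,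
      blockPerm_outer]
    simp only [blockPerm_outer, blockPerm_inner]
    rw [outer_del_inner h h']
  · obtain ⟨b, hb, rfl⟩ := exists_delSlot j j'
    rw [blockPerm_inner, inner_del_inner h h' i hb (innerSlot_ne_innerSlot h i hb), blockPerm_outer,
      blockPerm_outer]
    simp only [blockPerm_inner]
    rw [inner_del_inner h h' _ (τ.injective.ne hb)]

/-! ### Operads from compositions of operations of arity at least `2` -/

/-- Multiples of a given element of arity `1`. -/
inductive GradedSigmaModule.IsMultiple (X : GradedSigmaModule k) (one : X.obj 1 0) :
    ∀ {n : ℕ} {p : ℤ}, X.obj n p → Prop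
  | zero {n : ℕ} {p : ℤ} : IsMultiple X one (0 : X.obj n p)
  | smul (c : k) : IsMultiple X one (c • one)

/-- Construction of an operad from a unital composition such that there are only multiples of the
identity in arity `1` and nothing in arity `0`, so that the axioms need to be checked only for
operations of arity at least `2`. -/
def GradedOperad.ofReduced (X : GradedSigmaModule k) (one : X.obj 1 0)
    (circ : ∀ {m n l : ℕ} {p q r : ℤ}, l + 1 = m + n → p + q = r → Fin m →
      (X.obj m p →ₗ[k] X.obj n q →ₗ[k] X.obj l r))
    (one_circ : ∀ {n : ℕ} {p : ℤ} (h : n + 1 = 1 + n) (hp : 0 + p = p) (x : X.obj n p),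
      circ h hp 0 one x = x)
    (circ_one : ∀ {n : ℕ} {p : ℤ} (h : n + 1 = n + 1) (hp : p + 0 = p) (i : Fin n) (x : X.obj n p),
      circ h hp i x one = x)
    (eq_zero : ∀ {p : ℤ} (x : X.obj 0 p), x = 0)
    (isMultiple : ∀ {p : ℤ} (x : X.obj 1 p), X.IsMultiple one x)
    (circ_circ_inner : ∀ {a b c ab bc abc : ℕ} {p q s pq qs pqs : ℤ}
      (h₁ : ab + 1 = a + b) (h₂ : abc + 1 = ab + c) (h₃ : bc + 1 = b + c) (h₄ : abc + 1 = a + bc)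
      (e₁ : p + q = pq) (e₂ : pq + s = pqs) (e₃ : q + s = qs) (e₄ : p + qs = pqs)
      (i : Fin a) (j : Fin b) (x : X.obj a p) (y : X.obj b q) (z : X.obj c s), 2 ≤ a → 2 ≤ b → 2 ≤ c →
      circ h₂ e₂ (innerSlot h₁ i j) (circ h₁ e₁ i x y) z = circ h₄ e₄ i x (circ h₃ e₃ j y z))
    (circ_circ_outer : ∀ {a b c ab ac abc : ℕ} {p q s pq ps pqs : ℤ}
      (h₁ : ab + 1 = a + b) (h₂ : abc + 1 = ab + c) (h₃ : ac + 1 = a + c) (h₄ : abc + 1 = ac + b)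
      (e₁ : p + q = pq) (e₂ : pq + s = pqs) (e₃ : p + s = ps) (e₄ : ps + q = pqs)
      (i j : Fin a) (hij : i ≠ j) (x : X.obj a p) (y : X.obj b q) (z : X.obj c s),
      2 ≤ a → 2 ≤ b → 2 ≤ c →
      circ h₂ e₂ (outerSlot h₁ i j hij.symm) (circ h₁ e₁ i x y) z =
        (q * s).negOnePow • circ h₄ e₄ (outerSlot h₃ j i hij) (circ h₃ e₃ j x z) y)
    (circ_act : ∀ {m n l : ℕ} {p q r : ℤ} (h : l + 1 = m + n) (hr : p + q = r) (i : Fin m)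
      (σ : Equiv.Perm (Fin m)) (τ : Equiv.Perm (Fin n)) (x : X.obj m p) (y : X.obj n q),
      2 ≤ m → 2 ≤ n →
      circ h hr i (X.act σ x) (X.act τ y) = X.act (blockPerm h i σ τ) (circ h hr (σ i) x y)) :
    GradedOperad k where
  toGradedSigmaModule := X
  one := one
  circ := circ
  one_circ := one_circ
  circ_one := circ_one
  circ_circ_inner {a b c ab bc abc p q s pq qs pqs} h₁ h₂ h₃ h₄ e₁ e₂ e₃ e₄ i j x y z := by
    have hi := i.2
    have hj := j.2
    obtain rfl | rfl | hc : c = 0 ∨ c = 1 ∨ 2 ≤ c := by omega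
    · rw [eq_zero z, map_zero, map_zero, map_zero]
    · cases isMultiple z with
      | zero => simp
      | smul t =>
        obtain rfl : abc = ab := by omega
        obtain rfl : bc = b := by omega
        obtain rfl : pqs = pq := by omega
        obtain rfl : qs = q := by omega
        simp only [map_smul, circ_one]
    obtain rfl | hb : b = 1 ∨ 2 ≤ b := by omega
    · cases isMultiple y with
      | zero => simp
      | smul t =>
        obtain rfl : ab = a := by omega
        obtain rfl : bc = c := by omega
        obtain rfl : pq = p := by omega
        obtain rfl : qs = s := by omega
        obtain rfl : j = 0 := Subsingleton.elim _ _
        have e : innerSlot h₁ i 0 = i := Fin.ext (by simp [innerSlot])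
        simp only [map_smul, circ_one, LinearMap.smul_apply, one_circ, e]
    obtain rfl | ha : a = 1 ∨ 2 ≤ a := by omega
    · cases isMultiple x with
      | zero => simp
      | smul t =>
        obtain rfl : ab = b := by omega
        obtain rfl : bc = abc := by omega
        obtain rfl : pq = q := by omega
        obtain rfl : qs = pqs := by omega
        obtain rfl : i = 0 := Subsingleton.elim _ _
        have e : innerSlot h₁ 0 j = j := Fin.ext (by simp [innerSlot])
        simp only [map_smul, LinearMap.smul_apply, one_circ, e]
    exact circ_circ_inner h₁ h₂ h₃ h₄ e₁ e₂ e₃ e₄ i j x y z ha hb hc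
  circ_circ_outer {a b c ab ac abc p q s pq ps pqs} h₁ h₂ h₃ h₄ e₁ e₂ e₃ e₄ i j hij x y z := by
    have hi := i.2
    have hj := j.2
    have hij' : (i : ℕ) ≠ j := fun e => hij (Fin.ext e)
    obtain rfl | rfl | hc : c = 0 ∨ c = 1 ∨ 2 ≤ c := by omega
    · rw [eq_zero z]; simp
    · cases isMultiple z with
      | zero => simp
      | smul t =>
        obtain rfl : abc = ab := by omega
        obtain rfl : ac = a := by omega
        obtain rfl : pqs = pq := by omega
        obtain rfl : ps = p := by omega
        have e : outerSlot h₃ j i hij = i := Fin.ext (by simp only [outerSlot]; split_ifs <;> omega)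
        simp only [map_smul, circ_one, LinearMap.smul_apply, e, mul_zero, Int.negOnePow_zero,
          one_smul]
    obtain rfl | rfl | hb : b = 0 ∨ b = 1 ∨ 2 ≤ b := by omega
    · rw [eq_zero y]; simp
    · cases isMultiple y with
      | zero => simp
      | smul t =>
        obtain rfl : ab = a := by omega
        obtain rfl : ac = abc := by omega
        obtain rfl : pq = p := by omega
        obtain rfl : ps = pqs := by omega
        have e : outerSlot h₁ i j hij.symm = j :=
          Fin.ext (by simp only [outerSlot]; split_ifs <;> omega)
        simp only [map_smul, circ_one, LinearMap.smul_apply, e, zero_mul, Int.negOnePow_zero,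
          one_smul]
    exact circ_circ_outer h₁ h₂ h₃ h₄ e₁ e₂ e₃ e₄ i j hij x y z (by omega) hb hc
  circ_act {m n l p q r} h hr i σ τ x y := by
    have hi := i.2
    obtain rfl | rfl | hn : n = 0 ∨ n = 1 ∨ 2 ≤ n := by omega
    · rw [eq_zero y]; simp
    · cases isMultiple y with
      | zero => simp
      | smul t =>
        obtain rfl : l = m := by omega
        obtain rfl : r = p := by omega
        rw [show τ = 1 from Subsingleton.elim _ _, X.act_one]
        simp only [map_smul, circ_one, blockPerm_unary_right]
    obtain rfl | hm : m = 1 ∨ 2 ≤ m := by omega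
    · cases isMultiple x with
      | zero => simp
      | smul t =>
        obtain rfl : l = n := by omega
        obtain rfl : r = q := by omega
        obtain rfl : i = 0 := Subsingleton.elim _ _
        rw [show σ = 1 from Subsingleton.elim _ _, X.act_one]
        simp only [map_smul, LinearMap.smul_apply, one_circ, blockPerm_unary_left,
          Equiv.Perm.one_apply]
    exact circ_act h hr i σ τ x y hm hn

end OperadModels

/-! ### Jets: operations together with formal restrictions. -/

namespace OperadModels

variable {k : Type u} [Field k]

namespace GradedOperad

/-- Operations together with candidates for their restrictions. -/
noncomputable def jetModule (F : GradedOperad k) : GradedSigmaModule k where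
  obj n p := F.obj n p × (Fin n → F.obj (n - 1) p)
  act σ := ((F.act σ).comp (LinearMap.fst k _ _)).prod (LinearMap.pi fun i =>
    (F.act (delPerm σ i)).comp ((LinearMap.proj (σ i)).comp (LinearMap.snd k _ _)))
  act_one x := Prod.ext (F.act_one _) (funext fun i => by
    change F.act (delPerm 1 i) (x.2 i) = x.2 i
    rw [delPerm, blockPerm_one, F.act_one])
  act_mul σ τ x := Prod.ext (F.act_mul _ _ _) (funext fun i => by
    change F.act (delPerm (σ * τ) i) (x.2 (σ (τ i))) =
      F.act (delPerm τ i) (F.act (delPerm σ (τ i)) (x.2 (σ (τ i))))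
    rw [← F.act_mul, delPerm, delPerm, delPerm, ← blockPerm_mul, one_mul])

/-- The restriction of a composition at a given input. -/
noncomputable def jetRestrictAux (F : GradedOperad k) {m n l : ℕ} {p q r : ℤ} (h : l + 1 = m + n)
    (hr : p + q = r) (i : Fin m) (s : Fin l) :
    (F.obj m p × (Fin m → F.obj (m - 1) p)) →ₗ[k] (F.obj n q × (Fin n → F.obj (n - 1) q)) →ₗ[k]
      F.obj (l - 1) r :=
  match (slotEquiv h i).symm s with
  | .inl a => (F.circ (show l - 1 + 1 = m - 1 + n by have := i.2; have := s.2; omega) hr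
      (delSlot a.1 i a.2.symm)).compl₁₂ ((LinearMap.proj a.1).comp (LinearMap.snd k _ _))
        (LinearMap.fst k _ _)
  | .inr j =>
    -- A unary `y` is a multiple `c` of the identity when `F` is reduced, and `x ∘ᵢ (c u)` is `c`
    -- times the restriction of `x`. The formula for `n ≠ 1` would use the restriction of `y`, which
    -- lies in the trivial arity `0`, and would wrongly give zero.
    if hn : n = 1 then
      (F.circ (show l - 1 + 1 = n + (m - 1) by have := i.2; omega)
        ((add_comm q p).trans hr) j).flip.compl₁₂
          ((LinearMap.proj i).comp (LinearMap.snd k _ _)) (LinearMap.fst k _ _)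
    else
      (F.circ (show l - 1 + 1 = m + (n - 1) by have := i.2; have := j.2; omega) hr i).compl₁₂
        (LinearMap.fst k _ _) ((LinearMap.proj j).comp (LinearMap.snd k _ _))

theorem jetRestrictAux_outer (F : GradedOperad k) {m n l : ℕ} {p q r : ℤ} (h : l + 1 = m + n)
    (h' : l - 1 + 1 = m - 1 + n) (hr : p + q = r) (i a : Fin m) (ha : a ≠ i)
    (x : F.obj m p × (Fin m → F.obj (m - 1) p)) (y : F.obj n q × (Fin n → F.obj (n - 1) q)) :
    jetRestrictAux F h hr i (outerSlot h i a ha) x y =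
      F.circ h' hr (delSlot a i ha.symm) (x.2 a) y.1 := by
  rw [jetRestrictAux, slotEquiv_symm_outer]
  rfl

theorem jetRestrictAux_inner (F : GradedOperad k) {m n l : ℕ} {p q r : ℤ} (h : l + 1 = m + n)
    (h' : l - 1 + 1 = m + (n - 1)) (hr : p + q = r) (i : Fin m) (j : Fin n) (hn : n ≠ 1)
    (x : F.obj m p × (Fin m → F.obj (m - 1) p)) (y : F.obj n q × (Fin n → F.obj (n - 1) q)) :
    jetRestrictAux F h hr i (innerSlot h i j) x y = F.circ h' hr i x.1 (y.2 j) := by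
  rw [jetRestrictAux, slotEquiv_symm_inner]
  simp only [dif_neg hn]
  rfl

theorem jetRestrictAux_unary (F : GradedOperad k) {m l : ℕ} {p q r : ℤ} (h : l + 1 = m + 1)
    (h' : l - 1 + 1 = 1 + (m - 1)) (hr : p + q = r) (hr' : q + p = r) (i : Fin m) (j : Fin 1)
    (x : F.obj m p × (Fin m → F.obj (m - 1) p)) (y : F.obj 1 q × (Fin 1 → F.obj (1 - 1) q)) :
    jetRestrictAux F h hr i (innerSlot h i j) x y = F.circ h' hr' j y.1 (x.2 i) := by
  rw [jetRestrictAux, slotEquiv_symm_inner]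
  rfl

/-- The restriction of a composition at a given input. -/
noncomputable def jetRestrict (F : GradedOperad k) {m n l : ℕ} {p q r : ℤ} (h : l + 1 = m + n)
    (hr : p + q = r) (i : Fin m) (s : Fin l) :
    (jetModule F).obj m p →ₗ[k] (jetModule F).obj n q →ₗ[k] F.obj (l - 1) r :=
  jetRestrictAux F h hr i s

theorem jetRestrict_outer (F : GradedOperad k) {m n l : ℕ} {p q r : ℤ} (h : l + 1 = m + n)
    (h' : l - 1 + 1 = m - 1 + n) (hr : p + q = r) (i a : Fin m) (ha : a ≠ i)
    (x : (jetModule F).obj m p) (y : (jetModule F).obj n q) :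
    jetRestrict F h hr i (outerSlot h i a ha) x y =
      F.circ h' hr (delSlot a i ha.symm) (x.2 a) y.1 :=
  jetRestrictAux_outer F h h' hr i a ha x y

theorem jetRestrict_inner (F : GradedOperad k) {m n l : ℕ} {p q r : ℤ} (h : l + 1 = m + n)
    (h' : l - 1 + 1 = m + (n - 1)) (hr : p + q = r) (i : Fin m) (j : Fin n) (hn : n ≠ 1)
    (x : (jetModule F).obj m p) (y : (jetModule F).obj n q) :
    jetRestrict F h hr i (innerSlot h i j) x y = F.circ h' hr i x.1 (y.2 j) :=
  jetRestrictAux_inner F h h' hr i j hn x y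

theorem jetRestrict_unary (F : GradedOperad k) {m l : ℕ} {p q r : ℤ} (h : l + 1 = m + 1)
    (h' : l - 1 + 1 = 1 + (m - 1)) (hr : p + q = r) (hr' : q + p = r) (i : Fin m) (j : Fin 1)
    (x : (jetModule F).obj m p) (y : (jetModule F).obj 1 q) :
    jetRestrict F h hr i (innerSlot h i j) x y = F.circ h' hr' j y.1 (x.2 i) :=
  jetRestrictAux_unary F h h' hr hr' i j x y

noncomputable def jetCirc (F : GradedOperad k) {m n l : ℕ} {p q r : ℤ} (h : l + 1 = m + n)
    (hr : p + q = r) (i : Fin m) :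
    (jetModule F).obj m p →ₗ[k] (jetModule F).obj n q →ₗ[k] (jetModule F).obj l r :=
  LinearMap.mk₂ k (fun x y => (F.circ h hr i x.1 y.1, fun s => jetRestrict F h hr i s x y))
    (fun x x' y => Prod.ext (LinearMap.map_add₂ _ _ _ _) (funext fun s => LinearMap.map_add₂ _ _ _ _))
    (fun c x y => Prod.ext (LinearMap.map_smul₂ _ _ _ _) (funext fun s => LinearMap.map_smul₂ _ _ _ _))
    (fun x y y' => Prod.ext (map_add _ _ _) (funext fun s => map_add _ _ _))
    (fun c x y => Prod.ext (map_smul _ _ _) (funext fun s => map_smul _ _ _))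

def jetOne (F : GradedOperad k) : (jetModule F).obj 1 0 := (F.one, 0)

/-- Operations `x` together with candidates for the `x ∘ᵢ u`, where `u` would be an operation of
arity `0`. -/
noncomputable def jet (F : GradedOperad k) (hF : F.IsReduced) : GradedOperad k :=
  ofReduced (jetModule F) (jetOne F) (jetCirc F)
    (fun {n p} h hp x => by
      refine Prod.ext (F.one_circ h hp x.1) (funext fun s => ?_)
      change jetRestrict F h hp 0 s (jetOne F) x = x.2 s
      obtain ⟨a, ha, rfl⟩ | ⟨j, rfl⟩ := slot_cases h 0 s
      · exact absurd (Subsingleton.elim a 0) ha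
      have e : innerSlot h 0 j = j := Fin.ext (by simp [innerSlot])
      -- For a unary `x` both sides lie in arity `0`, where `F` vanishes.
      by_cases hn : n = 1
      · subst hn
        rw [jetRestrict_unary F h rfl hp (by omega)]
        exact (map_zero _).trans (hF.eq_zero _).symm
      · have := j.2
        rw [jetRestrict_inner F h (by omega) hp _ _ hn, e]
        exact F.one_circ _ _ _)
    (fun {n p} h hp i x => by
      refine Prod.ext (F.circ_one h hp i x.1) (funext fun s => ?_)
      change jetRestrict F h hp i s x (jetOne F) = x.2 s
      have := i.2
      obtain ⟨a, ha, rfl⟩ | ⟨j, rfl⟩ := slot_cases h i s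
      · have ha' : (a : ℕ) ≠ i := fun e => ha (Fin.ext e)
        have := a.2
        have e : outerSlot h i a ha = a := Fin.ext (by simp only [outerSlot]; split_ifs <;> omega)
        rw [jetRestrict_outer F h (by omega) hp, e]
        exact F.circ_one _ _ _ _
      · obtain rfl : j = 0 := Subsingleton.elim _ _
        have e : innerSlot h i 0 = i := Fin.ext (by simp [innerSlot])
        rw [jetRestrict_unary F h (by omega) hp (by omega), e]
        exact F.one_circ _ _ _)
    (fun x => Prod.ext (hF.eq_zero _) (funext fun s => s.elim0))
    (fun {p} x => by
      obtain ⟨x, D⟩ := x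
      obtain rfl : D = 0 := funext fun _ => hF.eq_zero _
      have hx := hF.isScalar x
      cases hx with
      | zero => exact .zero
      | smul_one c =>
        have : (c • F.one, 0) = c • jetOne F := Prod.ext rfl (smul_zero c).symm
        rw [this]
        exact .smul c)
    (fun {a b c ab bc abc p q t pq qt pqt} h₁ h₂ h₃ h₄ e₁ e₂ e₃ e₄ i j x y z ha hb hc => by
      refine Prod.ext (F.circ_circ_inner h₁ h₂ h₃ h₄ e₁ e₂ e₃ e₄ i j x.1 y.1 z.1)
        (funext fun s => ?_)
      change jetRestrict F h₂ e₂ (innerSlot h₁ i j) s (jetCirc F h₁ e₁ i x y) z =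
        jetRestrict F h₄ e₄ i s x (jetCirc F h₃ e₃ j y z)
      have := i.2
      have := j.2
      -- The restricted input belongs to `x`, to `y` or to `z`. In each case the claim is the
      -- associativity of `F` with that operation replaced by its restriction; as `b` and `c` are at
      -- least `2`, the special clause for unary operations is never met.
      obtain ⟨a', ha', rfl⟩ | ⟨s, rfl⟩ := slot_cases h₄ i s
      · have na : (a' : ℕ) ≠ i := fun e => ha' (Fin.ext e)
        have hne := innerSlot_ne_outerSlot h₁ ha' j
        have e : outerSlot h₄ i a' ha' =
            outerSlot h₂ (innerSlot h₁ i j) (outerSlot h₁ i a' ha') hne.symm := Fin.ext (by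
          simp only [outerSlot, innerSlot]; split_ifs <;> omega)
        rw [jetRestrict_outer F h₄ (by omega), e, jetRestrict_outer F h₂ (by omega)]
        change F.circ _ _ _ (jetRestrict F h₁ e₁ i _ x y) z.1 = F.circ _ _ _ _ (F.circ _ _ _ _ _)
        rw [jetRestrict_outer F h₁ (by omega), ← inner_del_outer h₁ (by omega)]
        exact F.circ_circ_inner _ _ _ _ _ _ _ _ _ _ _ _ _
      obtain ⟨b', hb', rfl⟩ | ⟨s, rfl⟩ := slot_cases h₃ j s
      · have nb : (b' : ℕ) ≠ j := fun e => hb' (Fin.ext e)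
        have hne := innerSlot_ne_innerSlot h₁ i hb'
        have e : innerSlot h₄ i (outerSlot h₃ j b' hb') =
            outerSlot h₂ (innerSlot h₁ i j) (innerSlot h₁ i b') hne := Fin.ext (by
          change (i : ℕ) + (if (b' : ℕ) < j then (b' : ℕ) else b' + c - 1) =
            if (i + b' : ℕ) < i + j then (i + b' : ℕ) else i + b' + c - 1
          split_ifs <;> omega)
        rw [jetRestrict_inner F h₄ (by omega) _ _ _ (by omega), e,
          jetRestrict_outer F h₂ (by omega)]
        change F.circ _ _ _ (jetRestrict F h₁ e₁ i _ x y) z.1 =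
          F.circ _ _ _ _ (jetRestrict F h₃ e₃ j _ y z)
        rw [jetRestrict_inner F h₁ (by omega) _ _ _ (by omega), jetRestrict_outer F h₃ (by omega),
          ← inner_del_inner h₁ (by omega)]
        exact F.circ_circ_inner _ _ _ _ _ _ _ _ _ _ _ _ _
      · have e : innerSlot h₄ i (innerSlot h₃ j s) = innerSlot h₂ (innerSlot h₁ i j) s :=
          Fin.ext (by simp only [innerSlot]; omega)
        rw [jetRestrict_inner F h₄ (by omega) _ _ _ (by omega), e,
          jetRestrict_inner F h₂ (by omega) _ _ _ (by omega)]
        change F.circ _ _ _ (F.circ _ _ _ _ _) _ = F.circ _ _ _ _ (jetRestrict F h₃ e₃ j _ y z)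
        rw [jetRestrict_inner F h₃ (by omega) _ _ _ (by omega)]
        exact F.circ_circ_inner _ _ _ _ _ _ _ _ _ _ _ _ _)
    (fun {a b c ab ac abc p q t pq pt pqt} h₁ h₂ h₃ h₄ e₁ e₂ e₃ e₄ i j hij x y z ha hb hc => by
      refine Prod.ext (F.circ_circ_outer h₁ h₂ h₃ h₄ e₁ e₂ e₃ e₄ i j hij x.1 y.1 z.1)
        (funext fun s => ?_)
      change jetRestrict F h₂ e₂ (outerSlot h₁ i j hij.symm) s (jetCirc F h₁ e₁ i x y) z =
        (q * t).negOnePow •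
          jetRestrict F h₄ e₄ (outerSlot h₃ j i hij) s (jetCirc F h₃ e₃ j x z) y
      have := i.2
      have := j.2
      have nij : (i : ℕ) ≠ j := fun e => hij (Fin.ext e)
      obtain ⟨s, hs, rfl⟩ | ⟨c', rfl⟩ := slot_cases h₂ (outerSlot h₁ i j hij.symm) s
      · obtain ⟨a', ha', rfl⟩ | ⟨b', rfl⟩ := slot_cases h₁ i s
        · have na : (a' : ℕ) ≠ i := fun e => ha' (Fin.ext e)
          have haj : a' ≠ j := by
            rintro rfl
            exact hs rfl
          have naj : (a' : ℕ) ≠ j := fun e => haj (Fin.ext e)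
          have hne := outerSlot_ne_outerSlot h₃ haj hij ha'
          have hne' : delSlot a' i ha'.symm ≠ delSlot a' j haj.symm :=
            outerSlot_ne_outerSlot _ _ _ hij
          have e : outerSlot h₂ (outerSlot h₁ i j hij.symm) (outerSlot h₁ i a' ha') hs =
              outerSlot h₄ (outerSlot h₃ j i hij) (outerSlot h₃ j a' haj) hne := Fin.ext (by
            simp only [outerSlot]; split_ifs <;> omega)
          rw [jetRestrict_outer F h₂ (by omega), e, jetRestrict_outer F h₄ (by omega)]
          change F.circ _ _ _ (jetRestrict F h₁ e₁ i _ x y) z.1 =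
            _ • F.circ _ _ _ (jetRestrict F h₃ e₃ j _ x z) y.1
          rw [jetRestrict_outer F h₁ (by omega), jetRestrict_outer F h₃ (by omega),
            ← outer_del_outer h₁ (by omega) ha' hij.symm haj.symm hne'.symm,
            ← outer_del_outer h₃ (by omega) haj hij ha'.symm hne']
          exact F.circ_circ_outer _ _ _ _ _ _ _ _ _ _ hne' _ _ _
        · have hne := innerSlot_ne_outerSlot h₁ hij.symm b'
          have e : outerSlot h₂ (outerSlot h₁ i j hij.symm) (innerSlot h₁ i b') hs =
              innerSlot h₄ (outerSlot h₃ j i hij) b' := Fin.ext (by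
            simp only [outerSlot, innerSlot]; split_ifs <;> omega)
          rw [jetRestrict_outer F h₂ (by omega), e, jetRestrict_inner F h₄ (by omega) _ _ _ (by omega)]
          change F.circ _ _ _ (jetRestrict F h₁ e₁ i _ x y) z.1 = _ • F.circ _ _ _ (F.circ _ _ _ _ _) _
          rw [jetRestrict_inner F h₁ (by omega) _ _ _ (by omega),
            ← outer_del_inner h₁ (by omega) hij.symm]
          exact F.circ_circ_outer _ _ _ _ _ _ _ _ _ _ hij _ _ _
      · have hne := innerSlot_ne_outerSlot h₃ hij c'
        have e : innerSlot h₂ (outerSlot h₁ i j hij.symm) c' =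
            outerSlot h₄ (outerSlot h₃ j i hij) (innerSlot h₃ j c') hne := Fin.ext (by
          simp only [outerSlot, innerSlot]; split_ifs <;> omega)
        rw [jetRestrict_inner F h₂ (by omega) _ _ _ (by omega), e, jetRestrict_outer F h₄ (by omega)]
        change F.circ _ _ _ (F.circ _ _ _ _ _) _ = _ • F.circ _ _ _ (jetRestrict F h₃ e₃ j _ x z) y.1
        rw [jetRestrict_inner F h₃ (by omega) _ _ _ (by omega),
            ← outer_del_inner h₃ (by omega) hij]
        exact F.circ_circ_outer _ _ _ _ _ _ _ _ _ _ hij _ _ _)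
    (fun {m n l p q r} h hr i σ τ x y hm hn => by
      refine Prod.ext (F.circ_act h hr i σ τ x.1 y.1) (funext fun s => ?_)
      change jetRestrict F h hr i s ((jetModule F).act σ x) ((jetModule F).act τ y) =
        F.act (delPerm (blockPerm h i σ τ) s) (jetRestrict F h hr (σ i) (blockPerm h i σ τ s) x y)
      have := i.2
      obtain ⟨a, ha, rfl⟩ | ⟨j, rfl⟩ := slot_cases h i s
      · rw [jetRestrict_outer F h (by omega), ← blockPerm_delPerm_outer h (by omega), blockPerm_outer,
          jetRestrict_outer F h (by omega)]
        refine (F.circ_act _ _ _ _ _ _ _).trans ?_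
        rw [blockPerm_outer]
        rfl
      · rw [jetRestrict_inner F h (by omega) _ _ _ (by omega),
          ← blockPerm_delPerm_inner h (by omega), blockPerm_inner,
          jetRestrict_inner F h (by omega) _ _ _ (by omega)]
        exact F.circ_act _ _ _ _ _ _ _)

end GradedOperad
end OperadModels

namespace OperadModels

variable {k : Type u} [Field k]

namespace GradedOperad

/-- The projection of `Q ⊕ η Q` to `Q`. -/
def oddExtensionFst (Q : GradedOperad k) (s : ℤ) (hs : Odd s) : Hom (Q.oddExtension s hs) Q where
  map n p := LinearMap.fst k _ _
  map_act _ _ := rfl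
  map_one := rfl
  map_circ _ _ _ _ _ := rfl

/-- The projection of the jets to `F`. -/
noncomputable def jetFst (F : GradedOperad k) (hF : F.IsReduced) : Hom (jet F hF) F where
  map n p := LinearMap.fst k _ _
  map_act _ _ := rfl
  map_one := rfl
  map_circ _ _ _ _ _ := rfl

theorem free_isReduced {X : GradedSigmaModule k} (h0 : ∀ p (x : X.obj 0 p), x = 0)
    (h1 : ∀ p (x : X.obj 1 p), x = 0) : (free X).IsReduced := by
  refine (free_isFreeOn X).isReduced (fun p => ?_) (fun p => ?_)
  · rw [LinearMap.range_eq_bot]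
    ext x
    rw [h0 p x, map_zero, map_zero]
  · rw [LinearMap.range_eq_bot]
    ext x
    rw [h1 p x, map_zero, map_zero]

theorem free_hom_eq {X : GradedSigmaModule k} {Q : GradedOperad k} (φ ψ : Hom (free X) Q)
    (h : ∀ n p x, φ.map n p (freeGen X n p x) = ψ.map n p (freeGen X n p x)) {n p}
    (x : (free X).obj n p) : φ.map n p x = ψ.map n p x := by
  refine Generated.hom_eq φ ψ ?_ (free_generated x)
  rintro n p _ ⟨x, rfl⟩
  exact h n p x

/-! ### Derivations of free operads -/

section Derivation

variable {X : GradedSigmaModule k} (D : ∀ n p, X.obj n p →ₗ[k] (free X).obj n (p + 1))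

/-- Equivariance of the values of a derivation on generators. -/
def IsEquivariantDerivation : Prop :=
  ∀ (n : ℕ) (p : ℤ) (σ : Equiv.Perm (Fin n)) (x : X.obj n p),
    D n p (X.act σ x) = (free X).act σ (D n p x)

variable {D} (hD : IsEquivariantDerivation D)

/-- The morphism `x ↦ x + η D x`: its multiplicativity is exactly the signed Leibniz rule, so
freeness extends derivations from generators. -/
def derivationHom : Hom (free X) ((free X).oddExtension 1 odd_one) :=
  freeLift (fun n p => (freeGen X n p).prod (D n p))
    (fun n p σ x => Prod.ext (freeGen_act X σ x) (hD n p σ x))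

theorem derivationHom_fst {n p} (x : (free X).obj n p) :
    ((derivationHom hD).map n p x).1 = x :=
  free_hom_eq ((oddExtensionFst _ 1 odd_one).comp (derivationHom hD)) (Hom.id _)
    (fun _ _ _ => rfl) x

/-- The derivation of the free operad with given values on generators. -/
def derivation {n : ℕ} {p q : ℤ} (h : p + 1 = q) : (free X).obj n p →ₗ[k] (free X).obj n q :=
  ((free X).castDeg h).comp ((LinearMap.snd k _ _).comp ((derivationHom hD).map n p))

theorem derivation_gen {n : ℕ} {p : ℤ} (h : p + 1 = p + 1) (x : X.obj n p) :
    derivation hD h (freeGen X n p x) = D n p x := rfl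

theorem derivation_act {n : ℕ} {p q : ℤ} (h : p + 1 = q) (σ : Equiv.Perm (Fin n))
    (x : (free X).obj n p) :
    derivation hD h ((free X).act σ x) = (free X).act σ (derivation hD h x) := by
  subst h
  exact congrArg Prod.snd ((derivationHom hD).map_act σ x)

theorem derivation_one {q : ℤ} (h : 0 + 1 = q) : derivation hD h (free X).one = 0 := by
  subst h
  exact congrArg Prod.snd (derivationHom hD).map_one

theorem derivation_circ {m n l : ℕ} {p q r p' q' r' : ℤ} (h : l + 1 = m + n) (hr : p + q = r)
    (hp' : p + 1 = p') (hq' : q + 1 = q') (hr' : r + 1 = r')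
    (e₁ : p' + q = r') (e₂ : p + q' = r') (i : Fin m) (x : (free X).obj m p)
    (y : (free X).obj n q) :
    derivation hD hr' ((free X).circ h hr i x y) =
      (free X).circ h e₁ i (derivation hD hp' x) y +
        p.negOnePow • (free X).circ h e₂ i x (derivation hD hq' y) := by
  subst hp' hq' hr'
  have := congrArg Prod.snd ((derivationHom hD).map_circ h hr i x y)
  rw [oddExtension_circ] at this
  dsimp only at this
  rw [derivationHom_fst, derivationHom_fst] at this
  exact this

/-- The square of an odd derivation is an honest derivation, the two mixed terms having opposite
signs; it vanishes as soon as it vanishes on generators. -/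
theorem derivation_derivation (hX : (free X).IsReduced)
    (hDD : ∀ n p x, derivation hD rfl (D n p x) = 0) {n : ℕ} {p q r : ℤ} (h : p + 1 = q)
    (h' : q + 1 = r) (x : (free X).obj n p) : derivation hD h' (derivation hD h x) = 0 := by
  refine hX.induction (fun n p x => ∀ {q r : ℤ} (h : p + 1 = q) (h' : q + 1 = r),
    derivation hD h' (derivation hD h x) = 0) ?_ ?_ ?_ ?_ ?_ ?_ ?_ (free_generated x) h h'
  · rintro n p _ ⟨x, rfl⟩ q r rfl rfl
    exact hDD n p x
  · intro q r h h'
    rw [derivation_one, map_zero]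
  · intro n p q r h h'
    rw [map_zero, map_zero]
  · intro n p x y hx hy q r h h'
    rw [map_add, map_add, hx, hy, add_zero]
  · intro n p c x hx q r h h'
    rw [map_smul, map_smul, hx, smul_zero]
  · intro n p σ x hx q r h h'
    rw [derivation_act, derivation_act, hx, map_zero]
  · intro m n l p q r h hr i x y _ _ hx hy r' r'' h1 h2
    subst hr h1 h2
    rw [derivation_circ hD h rfl rfl rfl rfl (by omega) (by omega), map_add,
      derivation_circ hD h _ rfl rfl rfl (by omega) (by omega), hx]
    have := derivation_circ hD h (by omega : p + (q + 1) = p + q + 1) rfl rfl rfl (by omega)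
      (by omega) i x (derivation hD rfl y)
    rw [hy, map_zero, smul_zero, add_zero] at this
    rw [map_zero, LinearMap.zero_apply, zero_add, Int.negOnePow_succ, Units.neg_smul]
    rcases Int.units_eq_one_or p.negOnePow with hp | hp <;> rw [hp] <;> simp [this]

end Derivation

/-! ### Restrictions on free operads -/

section Restriction

variable {X : GradedSigmaModule k} (R : ∀ n p, Fin n → X.obj n p →ₗ[k] (free X).obj (n - 1) p)

/-- Equivariance of the values of restrictions on generators. -/
def IsEquivariantRestriction : Prop :=
  ∀ (n : ℕ) (p : ℤ) (σ : Equiv.Perm (Fin n)) (i : Fin n) (x : X.obj n p),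
    R n p i (X.act σ x) = (free X).act (delPerm σ i) (R n p (σ i) x)

variable {R} (hX : (free X).IsReduced) (hR : IsEquivariantRestriction R)

/-- The composition of jets was defined by the rule for restricting a composition, so the universal
property extends restrictions from generators to all operations. -/
noncomputable def restrictionHom : Hom (free X) (jet (free X) hX) :=
  freeLift (fun n p => (freeGen X n p).prod (LinearMap.pi (R n p)))
    (fun n p σ x => Prod.ext (freeGen_act X σ x) (funext fun i => hR n p σ i x))

theorem restrictionHom_fst {n p} (x : (free X).obj n p) :
    ((restrictionHom hX hR).map n p x).1 = x :=
  free_hom_eq ((jetFst _ hX).comp (restrictionHom hX hR)) (Hom.id _) (fun _ _ _ => rfl) x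

/-- The restrictions on the free operad with given values on generators. -/
noncomputable def restriction {m l : ℕ} {p : ℤ} (h : l + 1 = m + 0) (i : Fin m) :
    (free X).obj m p →ₗ[k] (free X).obj l p :=
  (show m - 1 = l by omega) ▸
    (LinearMap.proj i).comp ((LinearMap.snd k _ _).comp ((restrictionHom hX hR).map m p))

theorem restriction_gen {m : ℕ} {p : ℤ} (h : m - 1 + 1 = m + 0) (i : Fin m) (x : X.obj m p) :
    restriction hX hR h i (freeGen X m p x) = R m p i x := rfl

theorem restriction_act {m l : ℕ} {p : ℤ} (h : l + 1 = m + 0) (i : Fin m) (σ : Equiv.Perm (Fin m))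
    (x : (free X).obj m p) : restriction hX hR h i ((free X).act σ x) =
      (free X).act (blockPerm h i σ 1) (restriction hX hR h (σ i) x) := by
  obtain rfl : l = m - 1 := by omega
  exact congrFun (congrArg Prod.snd ((restrictionHom hX hR).map_act σ x)) i

theorem restriction_outer {m n l m' l' : ℕ} {p q r : ℤ} (h : l + 1 = m + n) (hm : m' + 1 = m + 0)
    (hl : l' + 1 = l + 0) (h' : l' + 1 = m' + n) (hr : p + q = r) (i a : Fin m) (ha : a ≠ i)
    (x : (free X).obj m p) (y : (free X).obj n q) :
    restriction hX hR hl (outerSlot h i a ha) ((free X).circ h hr i x y) =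
      (free X).circ h' hr (outerSlot hm a i ha.symm) (restriction hX hR hm a x) y := by
  obtain rfl : m' = m - 1 := by omega
  obtain rfl : l' = l - 1 := by omega
  have h1 : ((restrictionHom hX hR).map l r ((free X).circ h hr i x y)).2 (outerSlot h i a ha) =
      jetRestrict (free X) h hr i (outerSlot h i a ha) ((restrictionHom hX hR).map m p x)
        ((restrictionHom hX hR).map n q y) :=
    congrFun (congrArg Prod.snd ((restrictionHom hX hR).map_circ h hr i x y)) (outerSlot h i a ha)
  refine h1.trans ((jetRestrict_outer _ _ h' _ _ _ _ _ _).trans ?_)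
  rw [restrictionHom_fst]
  rfl

theorem restriction_inner {m n l n' l' : ℕ} {p q r : ℤ} (h : l + 1 = m + n) (hn : n' + 1 = n + 0)
    (hl : l' + 1 = l + 0) (h' : l' + 1 = m + n') (hr : p + q = r) (i : Fin m) (j : Fin n)
    (hn1 : n ≠ 1) (x : (free X).obj m p) (y : (free X).obj n q) :
    restriction hX hR hl (innerSlot h i j) ((free X).circ h hr i x y) =
      (free X).circ h' hr i x (restriction hX hR hn j y) := by
  obtain rfl : n' = n - 1 := by omega
  obtain rfl : l' = l - 1 := by omega
  have h1 : ((restrictionHom hX hR).map l r ((free X).circ h hr i x y)).2 (innerSlot h i j) =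
      jetRestrict (free X) h hr i (innerSlot h i j) ((restrictionHom hX hR).map m p x)
        ((restrictionHom hX hR).map n q y) :=
    congrFun (congrArg Prod.snd ((restrictionHom hX hR).map_circ h hr i x y)) (innerSlot h i j)
  refine h1.trans ((jetRestrict_inner _ _ h' _ _ _ hn1 _ _).trans ?_)
  rw [restrictionHom_fst]
  rfl

/-- A composition of operations of arity at least `2` has arity at least `3`, so in arity `2` only
generators, their permutations and linear combinations occur. -/
theorem restriction_two
    (h2 : ∀ {p : ℤ} (x : X.obj 2 p) (i j : Fin 2), R 2 p i x = R 2 p j x)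
    {p : ℤ} (x : (free X).obj 2 p) (h : 1 + 1 = 2 + 0) (i j : Fin 2) :
    restriction hX hR h i x = restriction hX hR h j x := by
  refine hX.induction (fun m p x => ∀ {l : ℕ} (hm : m = 2) (h : l + 1 = m + 0) (i j : Fin m),
    restriction hX hR h i x = restriction hX hR h j x) ?_ ?_ ?_ ?_ ?_ ?_ ?_ (free_generated x)
    rfl h i j
  · rintro m p _ ⟨x, rfl⟩ l rfl h i j
    obtain rfl : l = 1 := by omega
    exact h2 x i j
  · intro l h
    omega
  · intros
    simp only [map_zero]
  · intro m p x y hx hy l hm h i j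
    rw [map_add, map_add, hx hm h i j, hy hm h i j]
  · intro m p c x hx l hm h i j
    rw [map_smul, map_smul, hx hm h i j]
  · intro m p σ x hx l hm h i j
    obtain rfl : l = 1 := by omega
    rw [restriction_act, restriction_act, hx hm h (σ i) (σ j)]
    exact congrArg (fun τ => (free X).act τ _) (Subsingleton.elim _ _)
  · intro m n l p q r h hr i x y hm hn hx hy l hl
    omega

/-- For a composition one distinguishes whether each of the two deleted inputs belongs to the outer
or to the inner operation. In the mixed case the two restrictions act on different factors;
otherwise the claim reduces to a single factor. -/
theorem restriction_restriction
    (h2 : ∀ {p : ℤ} (x : (free X).obj 2 p) (h : 1 + 1 = 2 + 0) (i j : Fin 2),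
      restriction hX hR h i x = restriction hX hR h j x)
    (hRR : ∀ {m m' m'' : ℕ} {p : ℤ} (hm : m' + 1 = m + 0) (hm' : m'' + 1 = m' + 0) (i j : Fin m)
      (hij : i ≠ j) (x : X.obj m p),
      restriction hX hR hm' (outerSlot hm i j hij.symm)
          (restriction hX hR hm i (freeGen X m p x)) =
        restriction hX hR hm' (outerSlot hm j i hij)
          (restriction hX hR hm j (freeGen X m p x)))
    {m m' m'' : ℕ} {p : ℤ} (hm : m' + 1 = m + 0) (hm' : m'' + 1 = m' + 0) (i j : Fin m)
      (hij : i ≠ j) (x : (free X).obj m p) :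
    restriction hX hR hm' (outerSlot hm i j hij.symm) (restriction hX hR hm i x) =
      restriction hX hR hm' (outerSlot hm j i hij) (restriction hX hR hm j x) := by
  refine hX.induction (fun m p x => ∀ {m' m'' : ℕ} (hm : m' + 1 = m + 0) (hm' : m'' + 1 = m' + 0)
    (i j : Fin m) (hij : i ≠ j), restriction hX hR hm' (outerSlot hm i j hij.symm)
      (restriction hX hR hm i x) = restriction hX hR hm' (outerSlot hm j i hij)
        (restriction hX hR hm j x)) ?_ ?_ ?_ ?_ ?_ ?_ ?_ (free_generated x) hm hm' i j hij
  · rintro m p _ ⟨x, rfl⟩ m' m'' hm hm' i j hij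
    exact hRR hm hm' i j hij x
  · intro m' m'' hm hm' i j hij
    exact absurd (Subsingleton.elim i j) hij
  · intros
    simp only [map_zero]
  · intro m p x y hx hy m' m'' hm hm' i j hij
    simp only [map_add, hx hm hm' i j hij, hy hm hm' i j hij]
  · intro m p c x hx m' m'' hm hm' i j hij
    simp only [map_smul, hx hm hm' i j hij]
  · intro m p σ x hx m' m'' hm hm' i j hij
    obtain rfl : m' = m - 1 := by omega
    obtain rfl : m'' = m - 1 - 1 := by omega
    have hσ := σ.injective.ne hij
    simp only [restriction_act]
    have e (i j : Fin m) (hij : i ≠ j) : blockPerm hm i σ 1 (outerSlot hm i j hij.symm) =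
      outerSlot hm (σ i) (σ j) (σ.injective.ne hij.symm) := blockPerm_outer _ _ _ _ _ _
    rw [e i j hij, e j i hij.symm, hx hm hm' _ _ hσ]
    have e1 := blockPerm_delPerm_outer (n := 0) (l := m - 1) hm hm' j i hij σ 1
    exact congrArg (fun τ => (free X).act τ _) e1
  · intro m n l p q r h hr a x y hm2 hn2 hx hy l' l'' hl hl' s t hst
    have ha2 := a.2
    obtain rfl : l' = l - 1 := by omega
    obtain rfl : l'' = l - 1 - 1 := by omega
    have hm1 : m - 1 + 1 = m + 0 := by omega
    have hn1 : n - 1 + 1 = n + 0 := by omega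
    have hml : l - 1 + 1 = m - 1 + n := by omega
    have hnl : l - 1 + 1 = m + (n - 1) := by omega
    have outer_inner (i : Fin m) (ha : i ≠ a) (j : Fin n) (h1 h2) :
        restriction hX hR hl' (outerSlot hl (outerSlot h a i ha) (innerSlot h a j) h1)
            (restriction hX hR hl (outerSlot h a i ha) ((free X).circ h hr a x y)) =
          restriction hX hR hl' (outerSlot hl (innerSlot h a j) (outerSlot h a i ha) h2)
            (restriction hX hR hl (innerSlot h a j) ((free X).circ h hr a x y)) := by
      rw [restriction_outer hX hR h hm1 hl hml, restriction_inner hX hR h hn1 hl hnl _ _ _ (by omega)]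
      have e1 := inner_del_outer h hml ha j h1
      have e2 := outer_del_inner h hnl ha j h2
      dsimp only [delSlot] at e1 e2
      rw [← e1, ← e2, restriction_inner hX hR hml hn1 hl' (by omega) _ _ _ (by omega),
        restriction_outer hX hR hnl hm1 hl' (by omega)]
    obtain ⟨i, hi, rfl⟩ | ⟨i, rfl⟩ := slot_cases h a s <;>
    obtain ⟨j, hj, rfl⟩ | ⟨j, rfl⟩ := slot_cases h a t
    · have hij : i ≠ j := by
        rintro rfl
        exact hst rfl
      have hm3 : m - 1 - 1 + 1 = m - 1 + 0 := by
        have := i.2; have := j.2; have : (i : ℕ) ≠ j := fun e => hij (Fin.ext e)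
        have : (i : ℕ) ≠ a := fun e => hi (Fin.ext e)
        have : (j : ℕ) ≠ a := fun e => hj (Fin.ext e)
        omega
      rw [restriction_outer hX hR h hm1 hl hml, restriction_outer hX hR h hm1 hl hml]
      have n1 : outerSlot hm1 i j hij.symm ≠ outerSlot hm1 i a hi.symm :=
        outerSlot_ne_outerSlot _ _ _ hj
      have n2 : outerSlot hm1 j i hij ≠ outerSlot hm1 j a hj.symm :=
        outerSlot_ne_outerSlot _ _ _ hi
      have e1 := outer_del_outer h hml hi hj hij.symm n1 hst.symm
      have e2 := outer_del_outer h hml hj hi hij n2 hst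
      dsimp only [delSlot] at e1 e2
      rw [← e1, ← e2, restriction_outer hX hR hml hm3 hl' (by omega),
        restriction_outer hX hR hml hm3 hl' (by omega), hx hm1 hm3 i j hij]
      refine congrArg (fun s => (free X).circ _ hr s _ y) (Fin.ext ?_)
      have := i.2; have := j.2; have : (i : ℕ) ≠ j := fun e => hij (Fin.ext e)
      have : (i : ℕ) ≠ a := fun e => hi (Fin.ext e)
      have : (j : ℕ) ≠ a := fun e => hj (Fin.ext e)
      simp only [outerSlot]
      split_ifs <;> omega
    · exact outer_inner i hi j _ _
    · exact (outer_inner j hj i _ _).symm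
    · have hij : i ≠ j := by
        rintro rfl
        exact hst rfl
      rw [restriction_inner hX hR h hn1 hl hnl _ _ _ (by omega),
        restriction_inner hX hR h hn1 hl hnl _ _ _ (by omega)]
      have e1 := inner_del_inner h hnl a hij.symm hst.symm
      have e2 := inner_del_inner h hnl a hij hst
      dsimp only [delSlot] at e1 e2
      rw [← e1, ← e2]
      -- If both inputs exhaust a binary `y`, the first restriction makes `y` unary and the rule for
      -- inner inputs no longer applies. Then the two restrictions of `y` have to agree already,
      -- which is `h2`.
      obtain rfl | hn3 : n = 2 ∨ 3 ≤ n := by omega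
      · rw [h2 _ hn1 i j]
        congr 3
        exact Subsingleton.elim (α := Fin 1) _ _
      · rw [restriction_inner hX hR hnl (show n - 1 - 1 + 1 = n - 1 + 0 by omega) hl' (by omega) _ _ _
          (by omega), restriction_inner hX hR hnl (show n - 1 - 1 + 1 = n - 1 + 0 by omega) hl'
          (by omega) _ _ _ (by omega), hy hn1 (by omega) i j hij]

/-- A restriction acts on only one factor of a composition and has degree `0`, so it commutes with
both terms of the Leibniz rule if it commutes with the derivation on the factors. -/
theorem derivation_restriction {D : ∀ n p, X.obj n p →ₗ[k] (free X).obj n (p + 1)}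
    (hD : IsEquivariantDerivation D)
    (hDR : ∀ n p i x, derivation hD rfl (R n p i x) =
      restriction hX hR (by have := i.2; omega) i (D n p x))
    {m m' : ℕ} {p q : ℤ} (hm : m' + 1 = m + 0) (hq : p + 1 = q) (i : Fin m)
    (x : (free X).obj m p) :
    derivation hD hq (restriction hX hR hm i x) = restriction hX hR hm i (derivation hD hq x) := by
  refine hX.induction (fun m p x => ∀ {m' : ℕ} {q : ℤ} (hm : m' + 1 = m + 0) (hq : p + 1 = q)
    (i : Fin m), derivation hD hq (restriction hX hR hm i x) =
      restriction hX hR hm i (derivation hD hq x)) ?_ ?_ ?_ ?_ ?_ ?_ ?_ (free_generated x) hm hq i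
  · rintro m p _ ⟨x, rfl⟩ m' q hm rfl i
    obtain rfl : m' = m - 1 := by omega
    exact hDR m p i x
  · intro m' q hm hq i
    obtain rfl : m' = 0 := by omega
    rw [hX.eq_zero (restriction hX hR hm i (derivation hD hq _)), hX.eq_zero (derivation hD hq _)]
  · intros
    simp only [map_zero]
  · intro m p x y hx hy m' q hm hq i
    simp only [map_add, hx hm hq i, hy hm hq i]
  · intro m p c x hx m' q hm hq i
    simp only [map_smul, hx hm hq i]
  · intro m p σ x hx m' q hm hq i
    rw [restriction_act, derivation_act, derivation_act, restriction_act, hx]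
  · intro m n l p q r h hr a x y hm2 hn2 hx hy l' r' hl hr' s
    have ha2 := a.2
    subst hr hr'
    have hm1 : m - 1 + 1 = m + 0 := by omega
    have hn1 : n - 1 + 1 = n + 0 := by omega
    have hml : l' + 1 = m - 1 + n := by omega
    have hnl : l' + 1 = m + (n - 1) := by omega
    rw [derivation_circ hD h rfl rfl rfl rfl (by omega) (by omega), map_add, Units.smul_def,
      map_zsmul, ← Units.smul_def]
    obtain ⟨i, hi, rfl⟩ | ⟨j, rfl⟩ := slot_cases h a s
    · rw [restriction_outer hX hR h hm1 hl hml, restriction_outer hX hR h hm1 hl hml,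
        restriction_outer hX hR h hm1 hl hml,
        derivation_circ hD _ rfl rfl rfl rfl (by omega) (by omega), hx]
    · rw [restriction_inner hX hR h hn1 hl hnl _ _ _ (by omega),
        restriction_inner hX hR h hn1 hl hnl _ _ _ (by omega),
        restriction_inner hX hR h hn1 hl hnl _ _ _ (by omega),
        derivation_circ hD _ rfl rfl rfl rfl (by omega) (by omega), hy]

end Restriction

end GradedOperad
end OperadModels

/-! ### Operads with restrictions and their unitary extensions. -/

namespace OperadModels

variable {k : Type u} [Field k]

/-- Dg operads that are trivial in arities `0` and `1`, with operations that behave like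
compositions with an operation of arity `0`. -/
structure RestrictedOperad (k : Type u) [Field k] extends DGOperad k where
  isReduced : toGradedOperad.IsReduced
  one_ne_zero : one ≠ 0
  res : ∀ {m l : ℕ} {p : ℤ}, l + 1 = m + 0 → Fin m → (obj m p →ₗ[k] obj l p)
  res_act : ∀ {m l : ℕ} {p : ℤ} (h : l + 1 = m + 0) (i : Fin m) (σ : Equiv.Perm (Fin m))
    (x : obj m p), res h i (act σ x) = act (blockPerm h i σ 1) (res h (σ i) x)
  res_outer : ∀ {m n l m' l' : ℕ} {p q r : ℤ} (h : l + 1 = m + n) (hm : m' + 1 = m + 0)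
    (hl : l' + 1 = l + 0) (h' : l' + 1 = m' + n) (hr : p + q = r) (i a : Fin m) (ha : a ≠ i)
    (x : obj m p) (y : obj n q),
    res hl (outerSlot h i a ha) (circ h hr i x y) =
      circ h' hr (outerSlot hm a i ha.symm) (res hm a x) y
  res_inner : ∀ {m n l n' l' : ℕ} {p q r : ℤ} (h : l + 1 = m + n) (hn : n' + 1 = n + 0)
    (hl : l' + 1 = l + 0) (h' : l' + 1 = m + n') (hr : p + q = r) (i : Fin m) (j : Fin n)
    (_ : n ≠ 1) (x : obj m p) (y : obj n q),
    res hl (innerSlot h i j) (circ h hr i x y) = circ h' hr i x (res hn j y)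
  res_res : ∀ {m m' m'' : ℕ} {p : ℤ} (hm : m' + 1 = m + 0) (hm' : m'' + 1 = m' + 0) (i j : Fin m)
    (hij : i ≠ j) (x : obj m p), res hm' (outerSlot hm i j hij.symm) (res hm i x) =
      res hm' (outerSlot hm j i hij) (res hm j x)
  -- Composing a binary operation with the unit at both inputs lands in arity `0`, which is
  -- invisible in the reduced operad; this axiom replaces `res_res` there.
  res_two : ∀ {p : ℤ} (x : obj 2 p) (h : 1 + 1 = 2 + 0) (i j : Fin 2), res h i x = res h j x
  d_res : ∀ {m m' : ℕ} {p q : ℤ} (hm : m' + 1 = m + 0) (hq : p + 1 = q) (i : Fin m) (x : obj m p),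
    d hq (res hm i x) = res hm i (d hq x)

namespace RestrictedOperad

variable (F : RestrictedOperad k)

/-- The identity is nonzero, so some linear functional takes the value `1` on it. As arity `1`
contains only multiples of the identity, this functional reads off their coefficients. -/
theorem exists_counit : ∃ ε : ∀ m p, F.obj m p →ₗ[k] k, ε 1 0 F.one = 1 ∧
    ∀ m p, ¬ (m = 1 ∧ p = 0) → ε m p = 0 := by
  classical
  obtain ⟨f, hf⟩ := Module.Projective.exists_dual_eq_one k F.one_ne_zero
  let ε (m : ℕ) (p : ℤ) : F.obj m p →ₗ[k] k :=
    if h : m = 1 ∧ p = 0 then by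
      obtain ⟨rfl, rfl⟩ := h
      exact f
    else 0
  exact ⟨ε, hf, fun m p h => dif_neg h⟩

/-- The coefficient of the identity. -/
noncomputable def counit (m : ℕ) (p : ℤ) : F.obj m p →ₗ[k] k := F.exists_counit.choose m p

@[simp] theorem counit_one : F.counit 1 0 F.one = 1 := F.exists_counit.choose_spec.1

theorem counit_eq_zero {m : ℕ} {p : ℤ} (h : ¬ (m = 1 ∧ p = 0)) (x : F.obj m p) :
    F.counit m p x = 0 := by
  rw [counit, F.exists_counit.choose_spec.2 m p h, LinearMap.zero_apply]

/-- Operations of the unitary extension. -/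
def unitaryModule : GradedSigmaModule k where
  obj n p := F.obj n p × supportedOn k k (n = 0 ∧ p = 0)
  act σ := (F.act σ).prodMap LinearMap.id
  act_one x := Prod.ext (F.act_one _) rfl
  act_mul σ τ x := Prod.ext (F.act_mul _ _ _) rfl

/-- Operations of `F`, in the unitary extension. -/
def incl (n : ℕ) (p : ℤ) : F.obj n p →ₗ[k] F.unitaryModule.obj n p := LinearMap.inl k _ _

/-- The part in `F` of an operation of the unitary extension. -/
def proj (n : ℕ) (p : ℤ) : F.unitaryModule.obj n p →ₗ[k] F.obj n p := LinearMap.fst k _ _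

/-- The coefficient of the operation of arity `0`. -/
def coeff (n : ℕ) (p : ℤ) : F.unitaryModule.obj n p →ₗ[k] k :=
  (supportedOn k k (n = 0 ∧ p = 0)).subtype.comp (LinearMap.snd k (F.obj n p) _)

/-- The operation of arity `0` of the unitary extension. -/
def unit : F.unitaryModule.obj 0 0 := (0, ⟨1, fun h => absurd ⟨rfl, rfl⟩ h⟩)

/-- Compositions with the operation of arity `0`. -/
noncomputable def restrict {m l : ℕ} {p : ℤ} (h : l + 1 = m + 0) (i : Fin m) :
    F.obj m p →ₗ[k] F.unitaryModule.obj l p :=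
  -- The second component accounts for unary operations: `(c • 1) ∘ u = c • u`, while `F.res`
  -- vanishes there.
  (F.res h i).prod ((F.counit m p).codRestrict _ fun x hc =>
    F.counit_eq_zero (fun hc' => hc ⟨by omega, hc'.2⟩) x)

theorem restrict_of_ne {m l : ℕ} {p : ℤ} (h : l + 1 = m + 0) (i : Fin m) (hm : m ≠ 1)
    (x : F.obj m p) : F.restrict h i x = F.incl l p (F.res h i x) :=
  Prod.ext rfl (Subtype.ext (F.counit_eq_zero (fun hc => hm hc.1) x))

theorem restrict_one (h : 0 + 1 = 1 + 0) (i : Fin 1) : F.restrict h i F.one = F.unit :=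
  Prod.ext (F.isReduced.eq_zero _) (Subtype.ext F.counit_one)

/-- Induction on the operations of the unitary extension. -/
theorem unitary_induction (C : ∀ n p, F.unitaryModule.obj n p → Prop)
    (incl : ∀ n p x, C n p (F.incl n p x)) (unit : ∀ c : k, C 0 0 (c • F.unit)) {n p}
    (x : F.unitaryModule.obj n p) : C n p x := by
  by_cases h : n = 0 ∧ p = 0
  · obtain ⟨rfl, rfl⟩ := h
    have : x = x.2.1 • F.unit :=
      Prod.ext ((F.isReduced.eq_zero _).trans (F.isReduced.eq_zero _).symm)
        (Subtype.ext (mul_one _).symm)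
    rw [this]
    exact unit _
  · have : x = F.incl n p x.1 := Prod.ext rfl (DGOperad.supportedOn_eq_zero h _)
    rw [this]
    exact incl _ _ _

theorem eq_incl {n p} (i : Fin n) (x : F.unitaryModule.obj n p) :
    x = F.incl n p (F.proj n p x) :=
  Prod.ext rfl (DGOperad.supportedOn_eq_zero (fun h => by have := i.2; omega) _)

open Classical in
/-- The composition of the unitary extension. -/
noncomputable def unitaryCirc {m n l : ℕ} {p q r : ℤ} (h : l + 1 = m + n) (hr : p + q = r)
    (i : Fin m) :
    F.unitaryModule.obj m p →ₗ[k] F.unitaryModule.obj n q →ₗ[k] F.unitaryModule.obj l r :=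
  LinearMap.mk₂ k
    -- The left factor has an input, hence comes from `F`; only `y` can involve the unit, and its
    -- coefficient then multiplies a restriction of `x`.
    (fun x y => F.incl l r (F.circ h hr i (F.proj m p x) (F.proj n q y)) +
      if H : n = 0 ∧ q = 0 then F.coeff n q y • F.unitaryModule.castDeg (show p = r by omega)
        (F.restrict (show l + 1 = m + 0 by omega) i (F.proj m p x)) else 0)
    (fun x x' y => by
      split_ifs <;> simp only [map_add, LinearMap.add_apply, smul_add] <;> abel)
    (fun c x y => by
      split_ifs <;> simp only [map_smul, LinearMap.smul_apply, smul_add, smul_zero]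
      rw [smul_comm])
    (fun x y y' => by
      split_ifs <;> simp only [map_add, add_smul] <;> abel)
    (fun c x y => by
      split_ifs <;> simp only [map_smul, smul_add, smul_zero, smul_assoc])

theorem unitaryCirc_incl {m n l : ℕ} {p q r : ℤ} (h : l + 1 = m + n) (hr : p + q = r)
    (i : Fin m) (x : F.obj m p) (y : F.obj n q) :
    F.unitaryCirc h hr i (F.incl m p x) (F.incl n q y) = F.incl l r (F.circ h hr i x y) := by
  have : F.unitaryCirc h hr i (F.incl m p x) (F.incl n q y) = F.incl l r (F.circ h hr i x y) +
      if H : n = 0 ∧ q = 0 then (0 : k) • F.unitaryModule.castDeg (show p = r by omega)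
        (F.restrict (show l + 1 = m + 0 by omega) i x) else 0 := rfl
  rw [this]
  simp

theorem unitaryCirc_unit {m l : ℕ} {p : ℤ} (h : l + 1 = m + 0) (hr : p + 0 = p)
    (i : Fin m) (x : F.obj m p) :
    F.unitaryCirc h hr i (F.incl m p x) F.unit = F.restrict h i x := by
  have : F.unitaryCirc h hr i (F.incl m p x) F.unit = F.incl l p (F.circ h hr i x 0) +
      if H : 0 = 0 ∧ (0 : ℤ) = 0 then (1 : k) • F.unitaryModule.castDeg (show p = p by omega)
        (F.restrict (show l + 1 = m + 0 by omega) i x) else 0 := rfl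
  rw [this]
  simp [GradedSigmaModule.castDeg_rfl]

theorem restrict_outer {m n l m' l' : ℕ} {p q r : ℤ} (h : l + 1 = m + n) (hm : m' + 1 = m + 0)
    (hl : l' + 1 = l + 0) (h' : l' + 1 = m' + n) (hr : p + q = r) (i a : Fin m) (ha : a ≠ i)
    (x : F.obj m p) (y : F.obj n q) :
    F.restrict hl (outerSlot h i a ha) (F.circ h hr i x y) =
      F.unitaryCirc h' hr (outerSlot hm a i ha.symm) (F.restrict hm a x) (F.incl n q y) := by
  have ha' : (a : ℕ) ≠ i := fun e => ha (Fin.ext e)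
  have := a.2
  have := i.2
  rw [F.restrict_of_ne hm _ (by omega), unitaryCirc_incl]
  obtain rfl | hn : n = 0 ∨ 1 ≤ n := by omega
  · rw [F.isReduced.eq_zero y]
    simp only [map_zero]
  rw [F.restrict_of_ne hl _ (by omega), F.res_outer h hm hl h']

/-- The exception `n ≠ 1` of `res_inner` disappears in the unitary extension: for `y = c • 1` the
restriction of `y` is `c • u`, and composing `x` with it is `c` times the restriction of `x`. -/
theorem restrict_inner {m n l n' l' : ℕ} {p q r : ℤ} (h : l + 1 = m + n) (hn : n' + 1 = n + 0)
    (hl : l' + 1 = l + 0) (h' : l' + 1 = m + n') (hr : p + q = r) (i : Fin m) (j : Fin n)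
    (x : F.obj m p) (y : F.obj n q) :
    F.restrict hl (innerSlot h i j) (F.circ h hr i x y) =
      F.unitaryCirc h' hr i (F.incl m p x) (F.restrict hn j y) := by
  by_cases hn1 : n = 1
  · subst hn1
    obtain rfl : n' = 0 := by omega
    obtain rfl : l = m := by omega
    have hy := F.isReduced.isScalar y
    cases hy with
    | zero => simp only [map_zero]
    | smul_one c =>
      obtain rfl : r = p := by omega
      obtain rfl : j = 0 := Subsingleton.elim _ _
      have e : innerSlot h i 0 = i := Fin.ext (by simp [innerSlot])
      simp only [map_smul, F.circ_one, F.restrict_one, unitaryCirc_unit, e]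
  · have := i.2
    have := j.2
    rw [F.restrict_of_ne hn _ hn1, unitaryCirc_incl, F.restrict_of_ne hl _ (by omega),
      F.res_inner h hn hl h' _ _ _ hn1]

/-- For `m = 2` the result has arity `0` and depends on the coefficients of the unary operations
`res x`; their equality is `res_two`. -/
theorem restrict_restrict {m m' m'' : ℕ} {p : ℤ} (hm : m' + 1 = m + 0) (hm' : m'' + 1 = m' + 0)
    (i j : Fin m) (hij : i ≠ j) (x : F.obj m p) :
    F.restrict hm' (outerSlot hm i j hij.symm) (F.res hm i x) =
      F.restrict hm' (outerSlot hm j i hij) (F.res hm j x) := by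
  by_cases h : m' = 1
  · subst h
    obtain rfl : m = 2 := by omega
    rw [F.res_two x hm i j]
    exact congrArg (fun s => F.restrict hm' s _) (Subsingleton.elim (α := Fin 1) _ _)
  · rw [F.restrict_of_ne hm' _ h, F.restrict_of_ne hm' _ h, F.res_res]

theorem restrict_act {m l : ℕ} {p : ℤ} (h : l + 1 = m + 0) (i : Fin m) (σ : Equiv.Perm (Fin m))
    (x : F.obj m p) : F.restrict h i (F.act σ x) =
      F.unitaryModule.act (blockPerm h i σ 1) (F.restrict h (σ i) x) := by
  by_cases hm : m = 1
  · subst hm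
    obtain rfl : l = 0 := by omega
    rw [Subsingleton.elim σ 1, F.act_one, blockPerm_one, F.unitaryModule.act_one]
    rfl
  · rw [F.restrict_of_ne h _ hm, F.restrict_of_ne h _ hm, F.res_act]
    rfl

theorem d_eq_zero_of_unary {p q : ℤ} (h : p + 1 = q) (x : F.obj 1 p) : F.d h x = 0 := by
  have hx := F.isReduced.isScalar x
  cases hx with
  | zero => rw [map_zero]
  | smul_one c => rw [map_smul, F.d_one, smul_zero]

/-- The differential of the unitary extension. -/
def unitaryD {n : ℕ} {p q : ℤ} (h : p + 1 = q) :
    F.unitaryModule.obj n p →ₗ[k] F.unitaryModule.obj n q :=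
  (F.incl n q).comp ((F.d h).comp (LinearMap.fst k _ _))

theorem unitaryD_incl {n : ℕ} {p q : ℤ} (h : p + 1 = q) (x : F.obj n p) :
    F.unitaryD h (F.incl n p x) = F.incl n q (F.d h x) := rfl

theorem unitaryD_unit {q : ℤ} (h : 0 + 1 = q) : F.unitaryD h F.unit = 0 :=
  Prod.ext (map_zero (F.d h)) rfl

theorem unitaryD_restrict {m l : ℕ} {p q : ℤ} (h : l + 1 = m + 0) (hq : p + 1 = q) (i : Fin m)
    (x : F.obj m p) : F.unitaryD hq (F.restrict h i x) = F.restrict h i (F.d hq x) := by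
  by_cases hm : m = 1
  · subst hm
    obtain rfl : l = 0 := by omega
    rw [F.d_eq_zero_of_unary, map_zero]
    exact Prod.ext (F.isReduced.eq_zero _) rfl
  · rw [F.restrict_of_ne h _ hm, F.restrict_of_ne h _ hm, unitaryD_incl, F.d_res]

/-- The unitary extension: `F` together with an operation of arity `0`. -/
noncomputable def unitary : DGOperad k where
  toGradedSigmaModule := F.unitaryModule
  one := F.incl 1 0 F.one
  circ := F.unitaryCirc
  one_circ {n p} h hp x := by
    refine F.unitary_induction (fun n p x => ∀ (h : n + 1 = 1 + n) (hp : 0 + p = p),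
      F.unitaryCirc h hp 0 (F.incl 1 0 F.one) x = x) ?_ ?_ x h hp
    · intro n p x h hp
      rw [unitaryCirc_incl, F.one_circ]
    · intro c h hp
      rw [map_smul, unitaryCirc_unit, restrict_one]
  circ_one {n p} h hp i x := by
    rw [F.eq_incl i x, unitaryCirc_incl, F.circ_one]
  circ_circ_inner {a b c ab bc abc p q s pq qs pqs} h₁ h₂ h₃ h₄ e₁ e₂ e₃ e₄ i j x y z := by
    -- Both `x` and `y` have an input and so come from `F`; only `z` may involve the unit, and then
    -- sequential associativity becomes `restrict_inner`.
    rw [F.eq_incl i x, F.eq_incl j y]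
    generalize F.proj _ _ x = x
    generalize F.proj _ _ y = y
    refine F.unitary_induction (fun c s z => ∀ {bc abc qs pqs} (h₂ : abc + 1 = ab + c)
      (h₃ : bc + 1 = b + c) (h₄ : abc + 1 = a + bc) (e₂ : pq + s = pqs) (e₃ : q + s = qs)
      (e₄ : p + qs = pqs), F.unitaryCirc h₂ e₂ (innerSlot h₁ i j)
        (F.unitaryCirc h₁ e₁ i (F.incl _ _ x) (F.incl _ _ y)) z =
          F.unitaryCirc h₄ e₄ i (F.incl _ _ x) (F.unitaryCirc h₃ e₃ j (F.incl _ _ y) z))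
      ?_ ?_ z h₂ h₃ h₄ e₂ e₃ e₄
    · intro c s z bc abc qs pqs h₂ h₃ h₄ e₂ e₃ e₄
      simp only [unitaryCirc_incl, F.circ_circ_inner h₁ h₂ h₃ h₄ e₁ e₂ e₃ e₄]
    · intro c bc abc qs pqs h₂ h₃ h₄ e₂ e₃ e₄
      obtain rfl : pqs = pq := by omega
      obtain rfl : qs = q := by omega
      simp only [unitaryCirc_incl, map_smul, unitaryCirc_unit, F.restrict_inner h₁ h₃ h₂ h₄]
  circ_circ_outer {a b c ab ac abc p q s pq ps pqs} h₁ h₂ h₃ h₄ e₁ e₂ e₃ e₄ i j hij x y z := by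
    have := i.2
    have := j.2
    have hij' : (i : ℕ) ≠ j := fun e => hij (Fin.ext e)
    rw [F.eq_incl i x]
    generalize F.proj _ _ x = x
    refine F.unitary_induction (fun b q y => ∀ {ab abc pq pqs}
      (h₁ : ab + 1 = a + b) (h₂ : abc + 1 = ab + c) (h₄ : abc + 1 = ac + b)
      (e₁ : p + q = pq) (e₂ : pq + s = pqs) (e₄ : ps + q = pqs),
        F.unitaryCirc h₂ e₂ (outerSlot h₁ i j hij.symm) (F.unitaryCirc h₁ e₁ i (F.incl _ _ x) y) z =
      (q * s).negOnePow • F.unitaryCirc h₄ e₄ (outerSlot h₃ j i hij)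
        (F.unitaryCirc h₃ e₃ j (F.incl _ _ x) z) y) ?_ ?_ y h₁ h₂ h₄ e₁ e₂ e₄
    · intro b q y ab abc pq pqs h₁ h₂ h₄ e₁ e₂ e₄
      refine F.unitary_induction (fun c s z => ∀ {ac abc ps pqs}
        (h₂ : abc + 1 = ab + c) (h₃ : ac + 1 = a + c) (h₄ : abc + 1 = ac + b)
        (e₂ : pq + s = pqs) (e₃ : p + s = ps) (e₄ : ps + q = pqs),
          F.unitaryCirc h₂ e₂ (outerSlot h₁ i j hij.symm) (F.unitaryCirc h₁ e₁ i (F.incl _ _ x)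
            (F.incl _ _ y)) z =
        (q * s).negOnePow • F.unitaryCirc h₄ e₄ (outerSlot h₃ j i hij)
          (F.unitaryCirc h₃ e₃ j (F.incl _ _ x) z) (F.incl _ _ y)) ?_ ?_ z h₂ h₃ h₄ e₂ e₃ e₄
      · intro c s z ac abc ps pqs h₂ h₃ h₄ e₂ e₃ e₄
        simp only [unitaryCirc_incl, F.circ_circ_outer h₁ h₂ h₃ h₄ e₁ e₂ e₃ e₄ i j hij]
        rw [Units.smul_def, map_zsmul, ← Units.smul_def]
      · intro c ac abc ps pqs h₂ h₃ h₄ e₂ e₃ e₄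
        obtain rfl : pqs = pq := by omega
        obtain rfl : ps = p := by omega
        simp only [unitaryCirc_incl, map_smul, LinearMap.smul_apply, unitaryCirc_unit,
          F.restrict_outer h₁ h₃ h₂ h₄, mul_zero, Int.negOnePow_zero, one_smul]
    · intro t ab abc pq pqs h₁ h₂ h₄ e₁ e₂ e₄
      refine F.unitary_induction (fun c s z => ∀ {ac abc ps pqs}
        (h₂ : abc + 1 = ab + c) (h₃ : ac + 1 = a + c) (h₄ : abc + 1 = ac + 0)
        (e₂ : pq + s = pqs) (e₃ : p + s = ps) (e₄ : ps + 0 = pqs),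
          F.unitaryCirc h₂ e₂ (outerSlot h₁ i j hij.symm) (F.unitaryCirc h₁ e₁ i (F.incl _ _ x)
            (t • F.unit)) z =
        (0 * s).negOnePow • F.unitaryCirc h₄ e₄ (outerSlot h₃ j i hij)
          (F.unitaryCirc h₃ e₃ j (F.incl _ _ x) z) (t • F.unit)) ?_ ?_ z h₂ h₃ h₄ e₂ e₃ e₄
      · intro c s z ac abc ps pqs h₂ h₃ h₄ e₂ e₃ e₄
        obtain rfl : pq = p := by omega
        obtain rfl : pqs = ps := by omega
        simp only [unitaryCirc_incl, map_smul, LinearMap.smul_apply, unitaryCirc_unit,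
          F.restrict_outer h₃ h₁ h₄ h₂ _ _ _ hij, zero_mul, Int.negOnePow_zero, one_smul]
      · intro c ac abc ps pqs h₂ h₃ h₄ e₂ e₃ e₄
        obtain rfl : pq = p := by omega
        obtain rfl : ps = pq := by omega
        obtain rfl : pqs = ps := by omega
        simp only [map_smul, LinearMap.smul_apply, unitaryCirc_unit, zero_mul, Int.negOnePow_zero,
          one_smul]
        rw [F.restrict_of_ne h₁ _ (by omega), F.restrict_of_ne h₃ _ (by omega), unitaryCirc_unit,
          unitaryCirc_unit, smul_comm]
        obtain rfl : ab = ac := by omega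
        rw [F.restrict_restrict h₁ h₂ i j hij]
  circ_act {m n l p q r} h hr i σ τ x y := by
    rw [F.eq_incl i x]
    generalize F.proj _ _ x = x
    refine F.unitary_induction (fun n q y => ∀ {l r} (h : l + 1 = m + n) (hr : p + q = r)
      (τ : Equiv.Perm (Fin n)), F.unitaryCirc h hr i (F.unitaryModule.act σ (F.incl _ _ x))
        (F.unitaryModule.act τ y) =
      F.unitaryModule.act (blockPerm h i σ τ) (F.unitaryCirc h hr (σ i) (F.incl _ _ x) y)) ?_ ?_
      y h hr τ
    · intro n q y l r h hr τ
      have e (n p σ) (x : F.obj n p) : F.unitaryModule.act σ (F.incl _ _ x) =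
        F.incl _ _ (F.act σ x) := rfl
      simp only [e, unitaryCirc_incl, F.circ_act]
    · intro c l r h hr τ
      obtain rfl : r = p := by omega
      have e (n p σ) (x : F.obj n p) : F.unitaryModule.act σ (F.incl _ _ x) =
        F.incl _ _ (F.act σ x) := rfl
      rw [Subsingleton.elim τ 1, F.unitaryModule.act_one]
      simp only [e, map_smul, unitaryCirc_unit, restrict_act]
  d := F.unitaryD
  d_d h h' x := Prod.ext (F.d_d h h' x.1) rfl
  d_act h σ x := Prod.ext (F.d_act h σ x.1) rfl
  d_circ {m n l p q r p' q' r'} h hr hp' hq' hr' e₁ e₂ i x y := by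
    rw [F.eq_incl i x]
    generalize F.proj _ _ x = x
    refine F.unitary_induction (fun n q y => ∀ {l r q' r'} (h : l + 1 = m + n) (hr : p + q = r)
      (hq' : q + 1 = q') (hr' : r + 1 = r') (e₁ : p' + q = r') (e₂ : p + q' = r'),
      F.unitaryD hr' (F.unitaryCirc h hr i (F.incl _ _ x) y) =
        F.unitaryCirc h e₁ i (F.unitaryD hp' (F.incl _ _ x)) y +
          p.negOnePow • F.unitaryCirc h e₂ i (F.incl _ _ x) (F.unitaryD hq' y)) ?_ ?_
      y h hr hq' hr' e₁ e₂
    · intro n q y l r q' r' h hr hq' hr' e₁ e₂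
      simp only [unitaryD_incl, unitaryCirc_incl, F.d_circ h hr hp' hq' hr' e₁ e₂]
      rw [map_add, Units.smul_def, Units.smul_def, map_zsmul]
    · intro c l r q' r' h hr hq' hr' e₁ e₂
      obtain rfl : r = p := by omega
      obtain rfl : r' = p' := by omega
      simp only [unitaryD_incl, map_smul, unitaryD_unit, unitaryCirc_unit, map_zero, smul_zero,
        add_zero, unitaryD_restrict]

end RestrictedOperad
end OperadModels

/-! ### Minimality of unitary extensions, and morphisms out of them. -/

namespace OperadModels

variable {k : Type u} [Field k]

namespace DGSigmaModule

/-- The cohomology in degree `0` is a line and `u` represents a nonzero class, so every other class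
is a multiple of it. -/
theorem exists_smul_eq_add {X : DGSigmaModule k} {n : ℕ} (hX : IsGroundField k (X.cohomology n))
    {u b : X.obj n 0} (hu : X.d (zero_add 1) u = 0) {t : ℤ} (ht : t + 1 = 0)
    (hu' : ∀ w : X.obj n t, X.d ht w ≠ u) (hb : X.d (zero_add 1) b = 0) :
    ∃ (c : k) (w : X.obj n t), c • u = b + X.d ht w := by
  obtain ⟨⟨e⟩, -⟩ := hX
  let ub : X.cocycles n 0 := ⟨u, hu⟩
  let bb : X.cocycles n 0 := ⟨b, hb⟩
  have hne : e (Submodule.Quotient.mk ub) ≠ 0 := by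
    rw [Ne, LinearEquiv.map_eq_zero_iff, cohomology_mk_eq_zero ht]
    rintro ⟨w, hw⟩
    exact hu' w hw
  let c := e (Submodule.Quotient.mk bb) / e (Submodule.Quotient.mk ub)
  have h0 : (Submodule.Quotient.mk (c • ub - bb) : X.cohomology n 0) = 0 := by
    apply e.injective
    rw [Submodule.Quotient.mk_sub, Submodule.Quotient.mk_smul, map_sub, map_smul, map_zero,
      smul_eq_mul, div_mul_cancel₀ _ hne, sub_self]
  rw [cohomology_mk_eq_zero ht] at h0
  obtain ⟨w, hw⟩ := h0
  refine ⟨c, w, ?_⟩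
  rw [hw]
  exact (add_sub_cancel b (c • u)).symm

theorem exists_d_eq {X : DGSigmaModule k} {n : ℕ} (hX : IsGroundField k (X.cohomology n))
    {p q t : ℤ} (hp : p ≠ 0) (h : p + 1 = q) (ht : t + 1 = p) {b : X.obj n p} (hb : X.d h b = 0) :
    ∃ w : X.obj n t, X.d ht w = b := by
  have := hX.2 p hp
  exact (cohomology_mk_eq_zero ht (⟨b, (mem_cocycles h).2 hb⟩ : X.cocycles n p)).1
    (Subsingleton.elim _ _)

end DGSigmaModule

namespace RestrictedOperad

variable (F : RestrictedOperad k)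

/-- The identification of `F` with the truncation of its unitary extension. -/
noncomputable def toTruncation : F.toDGOperad.Hom F.unitary.truncation where
  map n p := (F.incl n p).codRestrict (supportedOn k (F.unitary.obj n p) (n ≠ 0)) fun x hn => by
    obtain rfl : n = 0 := not_not.1 hn
    rw [F.isReduced.eq_zero x]
    exact map_zero (F.incl 0 p)
  map_act _ _ := rfl
  map_one := rfl
  map_circ h hr i x y := Subtype.ext (F.unitaryCirc_incl h hr i x y).symm
  map_d _ _ := rfl

theorem toTruncation_val {n p} (x : F.obj n p) : (F.toTruncation.map n p x).1 = F.incl n p x := rfl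

theorem toTruncation_isIso : F.toTruncation.IsIso := by
  intro n p
  constructor
  · intro x y h
    exact congrArg Prod.fst (congrArg Subtype.val h)
  · intro x
    by_cases hn : n = 0
    · subst hn
      exact ⟨0, (DGOperad.truncation_eq_zero _ _).trans (DGOperad.truncation_eq_zero _ _).symm⟩
    · exact ⟨F.proj n p x.1, Subtype.ext
        (Prod.ext rfl (DGOperad.supportedOn_eq_zero (fun h => hn h.1) _).symm)⟩

theorem unitary_isUnitary : F.unitary.IsUnitary := by
  refine ⟨⟨LinearEquiv.ofBijective (F.coeff 0 0) ⟨?_, ?_⟩⟩, fun p hp => ⟨fun x y => ?_⟩⟩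
  · intro x y h
    exact Prod.ext ((F.isReduced.eq_zero _).trans (F.isReduced.eq_zero _).symm) (Subtype.ext h)
  · intro c
    exact ⟨(c • F.unit : F.unitaryModule.obj 0 0), mul_one c⟩
  · exact Prod.ext ((F.isReduced.eq_zero _).trans (F.isReduced.eq_zero _).symm)
      ((DGOperad.supportedOn_eq_zero (fun h => hp h.2) _).trans
        (DGOperad.supportedOn_eq_zero (fun h => hp h.2) _).symm)

/-- The presentation is transported along `toTruncation`. An element of arity `0` is a multiple of
the unit, so composing a generator with it gives a multiple of a restriction, to which `hres`
applies. -/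
theorem unitary_isUnitarySullivanMinimal {E : ∀ n p, Submodule k (F.obj n p)}
    (hE : F.toDGOperad.IsMinimalPresentation E)
    (hres : ∀ {n l : ℕ} {p : ℤ} (h : l + 1 = n + 0) (i : Fin n) (e : F.obj n p), e ∈ E n p →
      F.toDGOperad.StageBelow E n (F.res h i e)) : F.unitary.IsUnitarySullivanMinimal := by
  have hbelow {n l : ℕ} {p : ℤ} {x : F.obj l p} (hx : F.toDGOperad.StageBelow E n x) :
      F.unitary.truncation.StageBelow (fun n p => (E n p).map (F.toTruncation.map n p)) n
        (F.toTruncation.map l p x) :=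
    GradedOperad.Generated.map F.toTruncation.toHom (fun m q y hy =>
      .of _ (show m < n ∧ F.toTruncation.map m q y ∈ (E m q).map (F.toTruncation.map m q) from
        ⟨hy.1, Submodule.mem_map_of_mem hy.2⟩)) hx
  refine ⟨F.unitary_isUnitary, fun n p => (E n p).map (F.toTruncation.map n p),
    ⟨fun p => ?_, fun p => ?_, ?_, ?_⟩, ?_⟩
  · rw [hE.arity_zero, Submodule.map_bot]
  · rw [hE.arity_one, Submodule.map_bot]
  · exact hE.free.transport F.toTruncation.toHom F.toTruncation_isIso
  · rintro n p q h _ ⟨e, he, rfl⟩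
    rw [← F.toTruncation.map_d]
    exact hbelow (hE.d_mem h e he)
  · rintro n l p h hp i _ w ⟨e, he, rfl⟩
    have hw : w = F.coeff 0 0 w • F.unit :=
      Prod.ext ((F.isReduced.eq_zero _).trans (F.isReduced.eq_zero _).symm)
        (Subtype.ext (mul_one _).symm)
    have hcirc : F.unitary.circ h hp i (F.toTruncation.map n p e).1 w =
        F.coeff 0 0 w • F.restrict h i e := by
      rw [toTruncation_val]
      have : F.unitaryCirc h hp i (F.incl n p e) (F.coeff 0 0 w • F.unit) =
          F.coeff 0 0 w • F.restrict h i e := by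
        rw [map_smul, unitaryCirc_unit]
      rw [← this, ← hw]
      rfl
    rw [hcirc]
    by_cases hn : n = 1
    · subst hn
      rw [hE.arity_one] at he
      obtain rfl : e = 0 := he
      refine ⟨0, .zero, ?_⟩
      rw [map_zero, smul_zero]
      rfl
    · refine ⟨F.coeff 0 0 w • F.toTruncation.map l p (F.res h i e),
        .smul _ _ (hbelow (hres h i e he)), ?_⟩
      rw [F.restrict_of_ne h i hn]
      rfl

section Hom

variable {F} {P : DGOperad k} (ρ : F.toDGOperad.Hom P) (u : P.obj 0 0)

open Classical in
/-- The map on the unitary extension. -/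
noncomputable def unitaryMap (n : ℕ) (p : ℤ) : F.unitaryModule.obj n p →ₗ[k] P.obj n p :=
  (ρ.map n p).comp (F.proj n p) +
    (F.coeff n p).smulRight (if H : n = 0 ∧ p = 0 then by
      obtain ⟨rfl, rfl⟩ := H
      exact u else 0)

theorem unitaryMap_incl {n p} (x : F.obj n p) :
    unitaryMap ρ u n p (F.incl n p x) = ρ.map n p x := by
  have : F.coeff n p (F.incl n p x) = 0 := rfl
  simp only [unitaryMap, LinearMap.add_apply, LinearMap.smulRight_apply, this, zero_smul, add_zero]
  rfl

theorem unitaryMap_unit : unitaryMap ρ u 0 0 F.unit = u := by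
  have h1 : F.coeff 0 0 F.unit = 1 := rfl
  have h2 : F.proj 0 0 F.unit = 0 := rfl
  rw [unitaryMap, LinearMap.add_apply, LinearMap.smulRight_apply, h1, one_smul,
    LinearMap.comp_apply, h2, map_zero, zero_add, dif_pos ⟨rfl, rfl⟩]

/-- The morphism from the unitary extension that takes the operation of arity `0` to `u`. -/
noncomputable def unitaryHom (hu : P.d (zero_add 1) u = 0)
    (hρ : ∀ {m l : ℕ} {p : ℤ} (h : l + 1 = m + 0) (i : Fin m) (x : F.obj m p), l ≠ 0 →
      ρ.map l p (F.res h i x) = P.circ h (add_zero p) i (ρ.map m p x) u) : F.unitary.Hom P where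
  map := unitaryMap ρ u
  map_act {n p} σ x := by
    refine F.unitary_induction (fun n p x => ∀ σ, unitaryMap ρ u n p (F.unitaryModule.act σ x) =
      P.act σ (unitaryMap ρ u n p x)) ?_ ?_ x σ
    · intro n p x σ
      have : F.unitaryModule.act σ (F.incl n p x) = F.incl n p (F.act σ x) := rfl
      rw [this, unitaryMap_incl, unitaryMap_incl, ρ.map_act]
    · intro c σ
      rw [Subsingleton.elim σ 1, P.act_one, F.unitaryModule.act_one]
  map_one := (unitaryMap_incl ρ u F.one).trans ρ.map_one
  map_circ {m n l p q r} h hr i x y := by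
    change unitaryMap ρ u l r (F.unitaryCirc h hr i x y) =
      P.circ h hr i (unitaryMap ρ u m p x) (unitaryMap ρ u n q y)
    rw [F.eq_incl i x]
    generalize F.proj _ _ x = x
    refine F.unitary_induction (fun n q y => ∀ {l r} (h : l + 1 = m + n) (hr : p + q = r),
      unitaryMap ρ u l r (F.unitaryCirc h hr i (F.incl m p x) y) =
        P.circ h hr i (unitaryMap ρ u m p (F.incl m p x)) (unitaryMap ρ u n q y)) ?_ ?_ y h hr
    · intro n q y l r h hr
      rw [F.unitaryCirc_incl, unitaryMap_incl, unitaryMap_incl, unitaryMap_incl, ρ.map_circ]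
    · intro c l r h hr
      obtain rfl : r = p := by omega
      simp only [map_smul, F.unitaryCirc_unit, unitaryMap_unit, unitaryMap_incl]
      congr 1
      by_cases hm : m = 1
      · subst hm
        obtain rfl : l = 0 := by omega
        have hx := F.isReduced.isScalar x
        cases hx with
        | zero => simp only [map_zero, LinearMap.zero_apply]
        | smul_one c =>
          obtain rfl : i = 0 := Subsingleton.elim _ _
          have := ρ.map_one
          simp only [map_smul, F.restrict_one, unitaryMap_unit, LinearMap.smul_apply]
          rw [this, P.one_circ]
      · rw [F.restrict_of_ne h i hm, unitaryMap_incl, hρ h i x (by omega)]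
  map_d {n p q} h x := by
    refine F.unitary_induction (fun n p x => ∀ {q} (h : p + 1 = q),
      unitaryMap ρ u n q (F.unitaryD h x) = P.d h (unitaryMap ρ u n p x)) ?_ ?_ x h
    · intro n p x q h
      rw [unitaryD_incl, unitaryMap_incl, unitaryMap_incl, ρ.map_d]
    · intro c q h
      subst h
      have hu'' : P.d rfl u = 0 := hu
      rw [map_smul, unitaryD_unit, map_smul, map_smul, unitaryMap_unit, map_smul, hu'', smul_zero,
        map_zero, smul_zero]

theorem unitaryHom_relLifts (hu : P.d (zero_add 1) u = 0)
    (hρ : ∀ {m l : ℕ} {p : ℤ} (h : l + 1 = m + 0) (i : Fin m) (x : F.obj m p), l ≠ 0 →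
      ρ.map l p (F.res h i x) = P.circ h (add_zero p) i (ρ.map m p x) u) {n : ℕ} (hn : n ≠ 0)
    (hlift : ρ.RelLifts n) : (unitaryHom ρ u hu hρ).RelLifts n := by
  intro p q t h ht a b ha hb
  have hincl {p} (x : F.unitary.obj n p) : x = F.incl n p (F.proj n p x) :=
    Prod.ext rfl (DGOperad.supportedOn_eq_zero (fun h => hn h.1) _)
  have hmap {p} (x : F.obj n p) : (unitaryHom ρ u hu hρ).map n p (F.incl n p x) = ρ.map n p x :=
    unitaryMap_incl ρ u x
  rw [hincl a, hmap] at hb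
  obtain ⟨a', b', h1, h2⟩ := hlift h ht (F.proj n q a) b (congrArg Prod.fst ha) hb
  refine ⟨F.incl n p a', b', ?_, (hmap a').trans h2⟩
  rw [hincl a, ← h1]
  rfl

/-- Positive arities are unaffected by the unit. In arity `0` the source is the line of the unit
with zero differential, and its image `u` is a nonzero class in the line `HP(0)`. -/
theorem unitaryHom_isQuasiIso (hP : P.IsCohomologicallyUnitary) (hu : P.d (zero_add 1) u = 0)
    (hu' : ∀ {t : ℤ} (ht : t + 1 = 0) (w : P.obj 0 t), P.d ht w ≠ u)
    (hρ : ∀ {m l : ℕ} {p : ℤ} (h : l + 1 = m + 0) (i : Fin m) (x : F.obj m p), l ≠ 0 →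
      ρ.map l p (F.res h i x) = P.circ h (add_zero p) i (ρ.map m p x) u)
    (hlift : ∀ n, n ≠ 0 → ρ.RelLifts n) : (unitaryHom ρ u hu hρ).IsQuasiIso := by
  rw [DGOperad.Hom.isQuasiIso_iff]
  intro n
  by_cases hn : n = 0
  · subst hn
    have dzero {p q : ℤ} (h : p + 1 = q) (x : F.unitary.obj 0 p) : F.unitary.d h x = 0 :=
      Prod.ext (F.isReduced.eq_zero _) rfl
    have hcoeff (x : F.unitary.obj 0 0) : x = (F.coeff 0 0 x • F.unit : F.unitaryModule.obj 0 0) :=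
      Prod.ext ((F.isReduced.eq_zero _).trans (F.isReduced.eq_zero _).symm)
        (Subtype.ext (mul_one _).symm)
    have hmap (c : k) : (unitaryHom ρ u hu hρ).map 0 0 (c • F.unit : F.unitaryModule.obj 0 0) =
        c • u := by
      change unitaryMap ρ u 0 0 _ = _
      rw [map_smul, unitaryMap_unit]
    intro p q t h ht a b ha hb
    have ha0 : a = 0 := by
      by_cases hq : q = 0
      · subst hq
        rw [hcoeff a, hmap] at hb
        rw [hcoeff a]
        by_cases hc : F.coeff 0 0 a = 0
        · rw [hc]
          exact zero_smul k (F.unit : F.unitaryModule.obj 0 0)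
        · refine absurd ?_ (hu' h ((F.coeff 0 0 a)⁻¹ • b))
          rw [map_smul, hb, smul_smul, inv_mul_cancel₀ hc, one_smul]
      · exact (F.unitary_isUnitary.2 q hq).elim _ _
    subst ha0
    rw [map_zero] at hb
    by_cases hp : p = 0
    · subst hp
      obtain rfl : q = 1 := by omega
      obtain ⟨c, w, hw⟩ := DGSigmaModule.exists_smul_eq_add hP hu ht (hu' ht) hb
      exact ⟨(c • F.unit : F.unitaryModule.obj 0 0), w, dzero _ _, (hmap c).trans hw⟩
    · obtain ⟨w, hw⟩ := DGSigmaModule.exists_d_eq hP hp h ht hb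
      refine ⟨0, -w, dzero _ _, ?_⟩
      have hw' : P.d ht w = b := hw
      rw [map_zero, map_neg, hw', add_neg_cancel]
  · exact unitaryHom_relLifts ρ u hu hρ hn (hlift n hn)

end Hom

end RestrictedOperad
end OperadModels

/-! ### Operads with restrictions from generators; partial models of `P`. -/

namespace OperadModels

variable {k : Type u} [Field k]

theorem del_arity {m : ℕ} (i : Fin m) : m - 1 + 1 = m + 0 := by have := i.2; omega

namespace RestrictedOperad

open GradedOperad

section OfGenerators

variable {X : GradedSigmaModule k} {D : ∀ n p, X.obj n p →ₗ[k] (free X).obj n (p + 1)}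
  {R : ∀ n p, Fin n → X.obj n p →ₗ[k] (free X).obj (n - 1) p}

/-- The free operad with restrictions, whose differential and restrictions have given values on the
generators. -/
noncomputable def ofGenerators (hX : (free X).IsReduced) (hD : IsEquivariantDerivation D)
    (hR : IsEquivariantRestriction R) (hone : (free X).one ≠ 0)
    (hDD : ∀ n p x, derivation hD rfl (D n p x) = 0)
    (hDR : ∀ n p i x, derivation hD rfl (R n p i x) = restriction hX hR (del_arity i) i (D n p x))
    (hRR : ∀ {m m' m'' : ℕ} {p : ℤ} (hm : m' + 1 = m + 0) (hm' : m'' + 1 = m' + 0) (i j : Fin m)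
      (hij : i ≠ j) (x : X.obj m p),
      restriction hX hR hm' (outerSlot hm i j hij.symm)
          (restriction hX hR hm i (freeGen X m p x)) =
        restriction hX hR hm' (outerSlot hm j i hij)
          (restriction hX hR hm j (freeGen X m p x)))
    (h2 : ∀ {p : ℤ} (x : X.obj 2 p) (i j : Fin 2), R 2 p i x = R 2 p j x) :
    RestrictedOperad k where
  toGradedOperad := free X
  d := derivation hD
  d_d := derivation_derivation hD hX hDD
  d_act := derivation_act hD
  d_circ := derivation_circ hD
  isReduced := hX
  one_ne_zero := hone
  res := restriction hX hR
  res_act := restriction_act hX hR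
  res_outer := restriction_outer hX hR
  res_inner := restriction_inner hX hR
  res_res := restriction_restriction hX hR (restriction_two hX hR h2) hRR
  res_two := restriction_two hX hR h2
  d_res := derivation_restriction hX hR hD hDR

end OfGenerators

theorem hom_res_of_generated (F : RestrictedOperad k) {Y : GradedSigmaModule k}
    {R : ∀ n p, Fin n → Y.obj n p →ₗ[k] (free Y).obj (n - 1) p}
    (hY : (free Y).IsReduced) (hR : IsEquivariantRestriction R)
    (j : GradedOperad.Hom F.toGradedOperad (free Y)) {G : ∀ n p, Set (F.obj n p)}
    (hG : ∀ {n l p} (h : l + 1 = n + 0) (i : Fin n) (x : F.obj n p), x ∈ G n p →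
      j.map l p (F.res h i x) = restriction hY hR h i (j.map n p x))
    {n l p} (h : l + 1 = n + 0) (i : Fin n) {x : F.obj n p} (hx : F.Generated G x) :
    j.map l p (F.res h i x) = restriction hY hR h i (j.map n p x) := by
  refine F.isReduced.induction (fun n p x => ∀ {l} (h : l + 1 = n + 0) (i : Fin n),
    j.map l p (F.res h i x) = restriction hY hR h i (j.map n p x)) ?_ ?_ ?_ ?_ ?_ ?_ ?_ hx h i
  · exact fun n p x hx l h i => hG h i x hx
  · intro l h i
    obtain rfl : l = 0 := by omega
    exact (hY.eq_zero _).trans (hY.eq_zero _).symm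
  · intros
    simp only [map_zero]
  · intro n p x y hx hy l h i
    simp only [map_add, hx h i, hy h i]
  · intro n p c x hx l h i
    simp only [map_smul, hx h i]
  · intro n p σ x hx l h i
    rw [F.res_act, j.map_act, hx, j.map_act, restriction_act]
  · intro m n l p q r h hr a x y hm2 hn2 hx hy l' hl s
    have ha2 := a.2
    have hm1 : m - 1 + 1 = m + 0 := by omega
    have hn1 : n - 1 + 1 = n + 0 := by omega
    rw [j.map_circ]
    obtain ⟨i, hi, rfl⟩ | ⟨b, rfl⟩ := slot_cases h a s
    · rw [F.res_outer h hm1 hl (by omega), restriction_outer hY hR h hm1 hl (by omega), j.map_circ,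
        hx]
    · rw [F.res_inner h hn1 hl (by omega) _ _ _ (by omega),
        restriction_inner hY hR h hn1 hl (by omega) _ _ _ (by omega), j.map_circ, hy]

/-- Compatibility of a morphism with restrictions may be checked on generators. -/
theorem hom_circ_unit_of_generated (F : RestrictedOperad k) {P : DGOperad k} (u : P.obj 0 0)
    (ρ : GradedOperad.Hom F.toGradedOperad P.toGradedOperad) {G : ∀ n p, Set (F.obj n p)}
    (hG : ∀ {n l p} (h : l + 1 = n + 0) (i : Fin n) (x : F.obj n p), l ≠ 0 → x ∈ G n p →
      ρ.map l p (F.res h i x) = P.circ h (add_zero p) i (ρ.map n p x) u)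
    {n l p} (h : l + 1 = n + 0) (i : Fin n) {x : F.obj n p} (hl : l ≠ 0) (hx : F.Generated G x) :
    ρ.map l p (F.res h i x) = P.circ h (add_zero p) i (ρ.map n p x) u := by
  refine F.isReduced.induction (fun n p x => ∀ {l} (h : l + 1 = n + 0) (i : Fin n), l ≠ 0 →
    ρ.map l p (F.res h i x) = P.circ h (add_zero p) i (ρ.map n p x) u) ?_ ?_ ?_ ?_ ?_ ?_ ?_ hx h i hl
  · exact fun n p x hx l h i hl => hG h i x hl hx
  · intro l h i
    omega
  · intros
    simp only [map_zero, LinearMap.zero_apply]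
  · intro n p x y hx hy l h i hl
    simp only [map_add, LinearMap.add_apply, hx h i hl, hy h i hl]
  · intro n p c x hx l h i hl
    simp only [map_smul, LinearMap.smul_apply, hx h i hl]
  · intro n p σ x hx l h i hl
    rw [F.res_act, ρ.map_act, hx h _ hl, ρ.map_act]
    have := P.circ_act h (add_zero p) i σ 1 (ρ.map n p x) u
    rw [P.act_one] at this
    exact this.symm
  · intro m n l p q r h hr a x y hm2 hn2 hx hy l' hl s hl'
    have ha2 := a.2
    have hm1 : m - 1 + 1 = m + 0 := by omega
    have hn1 : n - 1 + 1 = n + 0 := by omega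
    rw [ρ.map_circ]
    obtain ⟨i, hi, rfl⟩ | ⟨b, rfl⟩ := slot_cases h a s
    · rw [F.res_outer h hm1 hl (by omega), ρ.map_circ, hx hm1 i (by omega)]
      have := P.circ_circ_outer h hl hm1 (by omega : l' + 1 = m - 1 + n) hr (add_zero r)
        (add_zero p) hr a i hi.symm (ρ.map m p x) (ρ.map n q y) u
      rw [mul_zero, Int.negOnePow_zero, one_smul] at this
      exact this.symm
    · rw [F.res_inner h hn1 hl (by omega) _ _ _ (by omega), ρ.map_circ, hy hn1 b (by omega)]
      exact (P.circ_circ_inner h hl hn1 (by omega) hr (add_zero r) (add_zero q) hr a b _ _ u).symm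

end RestrictedOperad

/-- Operads with restrictions that are free on generators, with the properties required in a
unitary Sullivan minimal operad, together with a morphism to `P` that takes restrictions to
compositions with `u`. -/
structure PartialModel (P : DGOperad k) (u : P.obj 0 0) extends RestrictedOperad k where
  E : ∀ n p, Submodule k (obj n p)
  isMinimalPresentation : toDGOperad.IsMinimalPresentation E
  res_mem : ∀ {n l : ℕ} {p : ℤ} (h : l + 1 = n + 0) (i : Fin n) (e : obj n p), e ∈ E n p →
    toDGOperad.StageBelow E n (res h i e)
  ρ : toDGOperad.Hom P
  -- For `l = 0` the restriction is zero although `1 ∘ u = u`; that case is the business of the unit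
  -- of the unitary extension.
  ρ_res : ∀ {m l : ℕ} {p : ℤ} (h : l + 1 = m + 0) (i : Fin m) (x : obj m p), l ≠ 0 →
    ρ.map l p (res h i x) = P.circ h (add_zero p) i (ρ.map m p x) u

theorem PartialModel.exists_isUnitaryMinimalModel {P : DGOperad k} {u : P.obj 0 0}
    (M : PartialModel P u) (hP : P.IsCohomologicallyUnitary) (hu : P.d (zero_add 1) u = 0)
    (hu' : ∀ {t : ℤ} (ht : t + 1 = 0) (w : P.obj 0 t), P.d ht w ≠ u)
    (hlift : ∀ n, n ≠ 0 → M.ρ.RelLifts n) :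
    ∃ (S : DGOperad k) (ρS : S.Hom P), ρS.IsUnitaryMinimalModel :=
  ⟨M.unitary, M.unitaryHom M.ρ u hu M.ρ_res,
    M.unitary_isUnitarySullivanMinimal M.isMinimalPresentation M.res_mem,
    M.unitaryHom_isQuasiIso M.ρ u hP hu hu' M.ρ_res hlift⟩

end OperadModels

/-! ### Adding generators of one arity to a partial model. -/

namespace OperadModels

variable {k : Type u} [Field k]

open GradedOperad

/-- New generators of arity `n` for a partial model, all of whose restrictions vanish. -/
structure ExtensionData {P : DGOperad k} {u : P.obj 0 0} (M : PartialModel P u) (n : ℕ) where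
  X : GradedSigmaModule k
  eq_zero : ∀ {m : ℕ} {p : ℤ}, m ≠ n → ∀ x : X.obj m p, x = 0
  dX : ∀ m p, X.obj m p →ₗ[k] M.obj m (p + 1)
  dX_act : ∀ (m : ℕ) (p : ℤ) (σ : Equiv.Perm (Fin m)) (x : X.obj m p),
    dX m p (X.act σ x) = M.act σ (dX m p x)
  d_dX : ∀ (m : ℕ) (p : ℤ) (x : X.obj m p), M.d rfl (dX m p x) = 0
  dX_below : ∀ (m : ℕ) (p : ℤ) (x : X.obj m p), M.toDGOperad.StageBelow M.E m (dX m p x)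
  res_dX : ∀ {m l : ℕ} {p : ℤ} (h : l + 1 = m + 0) (i : Fin m) (x : X.obj m p),
    M.res h i (dX m p x) = 0
  ρX : ∀ m p, X.obj m p →ₗ[k] P.obj m p
  ρX_act : ∀ (m : ℕ) (p : ℤ) (σ : Equiv.Perm (Fin m)) (x : X.obj m p),
    ρX m p (X.act σ x) = P.act σ (ρX m p x)
  d_ρX : ∀ (m : ℕ) (p : ℤ) (x : X.obj m p), P.d rfl (ρX m p x) = M.ρ.map m (p + 1) (dX m p x)
  circ_ρX : ∀ {m l : ℕ} {p : ℤ} (h : l + 1 = m + 0) (i : Fin m) (x : X.obj m p),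
    P.circ h (add_zero p) i (ρX m p x) u = 0

namespace ExtensionData

variable {P : DGOperad k} {u : P.obj 0 0} {M : PartialModel P u} {n : ℕ} (V : ExtensionData M n)

/-- The old and the new generators. -/
def generators : GradedSigmaModule k where
  obj m p := M.E m p × V.X.obj m p
  act σ := ((M.act σ).restrict (M.isMinimalPresentation.free.1 _ _ σ)).prodMap (V.X.act σ)
  act_one x := Prod.ext (Subtype.ext (M.act_one _)) (V.X.act_one _)
  act_mul σ τ x := Prod.ext (Subtype.ext (M.act_mul _ _ _)) (V.X.act_mul _ _ _)

/-- The old generators. -/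
def oldPart (m : ℕ) (p : ℤ) : V.generators.obj m p →ₗ[k] M.obj m p :=
  (M.E m p).subtype.comp (LinearMap.fst k _ (V.X.obj m p))

/-- The new generators. -/
def newPart (m : ℕ) (p : ℤ) : V.generators.obj m p →ₗ[k] V.X.obj m p := LinearMap.snd k _ _

def inlGen (m : ℕ) (p : ℤ) : M.E m p →ₗ[k] V.generators.obj m p := LinearMap.inl k _ _

def inrGen (m : ℕ) (p : ℤ) : V.X.obj m p →ₗ[k] V.generators.obj m p := LinearMap.inr k _ _

theorem exists_inclusion : ∃ j : GradedOperad.Hom M.toGradedOperad (free V.generators),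
    ∀ m p (e : M.E m p), j.map m p e = freeGen V.generators m p (V.inlGen m p e) := by
  obtain ⟨j, hj, -⟩ := M.isMinimalPresentation.free.2 (free V.generators)
    (fun m p => (freeGen V.generators m p).comp (V.inlGen m p)) (by
      intro m p σ e e' he
      have : V.inlGen m p e' = V.generators.act σ (V.inlGen m p e) :=
        Prod.ext (Subtype.ext he) (map_zero (V.X.act σ)).symm
      rw [LinearMap.comp_apply, this, freeGen_act]
      rfl)
  exact ⟨j, hj⟩

noncomputable def inclusion : GradedOperad.Hom M.toGradedOperad (free V.generators) :=
  V.exists_inclusion.choose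

theorem inclusion_gen (m : ℕ) (p : ℤ) (e : M.obj m p) (he : e ∈ M.E m p) :
    V.inclusion.map m p e = freeGen V.generators m p (V.inlGen m p ⟨e, he⟩) :=
  V.exists_inclusion.choose_spec m p ⟨e, he⟩

noncomputable def diffGen (m : ℕ) (p : ℤ) :
    V.generators.obj m p →ₗ[k] (free V.generators).obj m (p + 1) :=
  (V.inclusion.map m (p + 1)).comp ((M.d rfl).comp (V.oldPart m p) + (V.dX m p).comp (V.newPart m p))

theorem diffGen_apply (m : ℕ) (p : ℤ) (x : V.generators.obj m p) : V.diffGen m p x =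
    V.inclusion.map m (p + 1) (M.d rfl (V.oldPart m p x) + V.dX m p (V.newPart m p x)) := rfl

noncomputable def resGen (m : ℕ) (p : ℤ) (i : Fin m) :
    V.generators.obj m p →ₗ[k] (free V.generators).obj (m - 1) p :=
  (V.inclusion.map (m - 1) p).comp ((M.res (del_arity i) i).comp (V.oldPart m p))

theorem resGen_apply (m : ℕ) (p : ℤ) (i : Fin m) (x : V.generators.obj m p) : V.resGen m p i x =
    V.inclusion.map (m - 1) p (M.res (del_arity i) i (V.oldPart m p x)) := rfl

theorem oldPart_act {m p} (σ : Equiv.Perm (Fin m)) (x : V.generators.obj m p) :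
    V.oldPart m p (V.generators.act σ x) = M.act σ (V.oldPart m p x) := rfl

theorem newPart_act {m p} (σ : Equiv.Perm (Fin m)) (x : V.generators.obj m p) :
    V.newPart m p (V.generators.act σ x) = V.X.act σ (V.newPart m p x) := rfl

theorem diffGen_equivariant : IsEquivariantDerivation V.diffGen := by
  intro m p σ x
  rw [diffGen_apply, diffGen_apply, oldPart_act, newPart_act, M.d_act, V.dX_act, ← map_add,
    V.inclusion.map_act]

theorem resGen_equivariant : IsEquivariantRestriction V.resGen := by
  intro m p σ i x
  rw [resGen_apply, resGen_apply, oldPart_act, M.res_act, V.inclusion.map_act]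

theorem generators_eq_zero {m : ℕ} (hm : m ≠ n) (hE : ∀ p, M.E m p = ⊥) {p : ℤ}
    (x : V.generators.obj m p) : x = 0 := by
  refine Prod.ext (Subtype.ext ?_) (V.eq_zero hm _)
  have : V.oldPart m p x ∈ M.E m p := x.1.2
  rw [hE] at this
  exact this

theorem range_freeGen_eq_bot {m : ℕ} (hm : m ≠ n) (hE : ∀ p, M.E m p = ⊥) (p : ℤ) :
    LinearMap.range (freeGen V.generators m p) = ⊥ := by
  rw [LinearMap.range_eq_bot]
  ext x
  rw [V.generators_eq_zero hm hE x, map_zero, map_zero]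

theorem isReduced (hn : 2 ≤ n) : (free V.generators).IsReduced :=
  free_isReduced (fun _ => V.generators_eq_zero (by omega) M.isMinimalPresentation.arity_zero)
    (fun _ => V.generators_eq_zero (by omega) M.isMinimalPresentation.arity_one)

theorem generated (m : ℕ) (p : ℤ) (x : M.obj m p) :
    M.Generated (fun m p => (M.E m p : Set (M.obj m p))) x :=
  M.isMinimalPresentation.free.generated x

theorem inclusion_d {m : ℕ} {p q : ℤ} (h : p + 1 = q) (x : M.obj m p) :
    V.inclusion.map m q (M.d h x) = derivation V.diffGen_equivariant h (V.inclusion.map m p x) := by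
  have hx := generated m p x
  induction hx generalizing q with
  | of x hx =>
    subst h
    rw [V.inclusion_gen _ _ x hx, derivation_gen, diffGen_apply]
    have h1 : V.newPart _ _ (V.inlGen _ _ ⟨x, hx⟩) = 0 := rfl
    have h2 : V.oldPart _ _ (V.inlGen _ _ ⟨x, hx⟩) = x := rfl
    rw [h1, h2, map_zero, add_zero]
  | one => rw [M.d_one, V.inclusion.map_one, derivation_one, map_zero]
  | zero => simp only [map_zero]
  | add x y _ _ hx hy => simp only [map_add, hx, hy]
  | smul c x _ hx => simp only [map_smul, hx]
  | act σ x _ hx => rw [M.d_act, V.inclusion.map_act, hx, V.inclusion.map_act, derivation_act]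
  | circ hc hr i x y _ _ hx hy =>
    subst hr h
    rw [M.d_circ hc rfl rfl rfl rfl (by omega) (by omega), V.inclusion.map_circ,
      derivation_circ _ hc rfl rfl rfl rfl (by omega) (by omega), map_add, V.inclusion.map_circ,
      Units.smul_def, map_zsmul, V.inclusion.map_circ, hx, hy, Units.smul_def]

variable (hn : 2 ≤ n)

theorem inclusion_res {m l : ℕ} {p : ℤ} (h : l + 1 = m + 0) (i : Fin m) (x : M.obj m p) :
    V.inclusion.map l p (M.res h i x) =
      restriction (V.isReduced hn) V.resGen_equivariant h i (V.inclusion.map m p x) := by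
  refine M.hom_res_of_generated _ _ V.inclusion ?_ h i (generated m p x)
  intro m l p h i x hx
  obtain rfl : l = m - 1 := by omega
  rw [V.inclusion_gen _ _ x hx, restriction_gen, resGen_apply]
  rfl

theorem restriction_generator {m l : ℕ} {p : ℤ} (h : l + 1 = m + 0) (i : Fin m)
    (x : V.generators.obj m p) : restriction (V.isReduced hn) V.resGen_equivariant h i
      (freeGen V.generators m p x) = V.inclusion.map l p (M.res h i (V.oldPart m p x)) := by
  obtain rfl : l = m - 1 := by omega
  rw [restriction_gen, resGen_apply]

/-- Sending the new generators to zero is a graded retraction. It yields the injectivity of the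
inclusion and the nontriviality of the identity. -/
theorem exists_retraction : ∃ r : GradedOperad.Hom (free V.generators) M.toGradedOperad,
    ∀ m p x, r.map m p (V.inclusion.map m p x) = x := by
  have hr : ∀ (m : ℕ) (p : ℤ) (σ : Equiv.Perm (Fin m)) (x : V.generators.obj m p),
    V.oldPart m p (V.generators.act σ x) = M.act σ (V.oldPart m p x) := fun m p σ x => rfl
  refine ⟨freeLift V.oldPart hr, fun m p x => ?_⟩
  refine Generated.hom_eq ((freeLift V.oldPart hr).comp V.inclusion) (Hom.id _) ?_ (generated m p x)
  intro m p x hx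
  rw [Hom.comp_map, V.inclusion_gen _ _ x hx, freeLift_gen]
  rfl

theorem inclusion_injective (m : ℕ) (p : ℤ) : Function.Injective (V.inclusion.map m p) := by
  obtain ⟨r, hr⟩ := V.exists_retraction
  exact Function.LeftInverse.injective (hr m p)

theorem one_ne_zero' : (free V.generators).one ≠ 0 := by
  intro h
  obtain ⟨r, hr⟩ := V.exists_retraction
  apply M.one_ne_zero
  rw [← r.map_one, h, map_zero]

/-- The operad with the new generators. -/
noncomputable def operad : RestrictedOperad k :=
  RestrictedOperad.ofGenerators (V.isReduced hn) V.diffGen_equivariant V.resGen_equivariant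
    V.one_ne_zero'
    (fun m p x => by
      rw [diffGen_apply, ← V.inclusion_d, map_add, M.d_d, V.d_dX, add_zero, map_zero])
    -- On a new generator both composites vanish: its restrictions are zero, and so are those of its
    -- differential, by `res_dX`.
    (fun m p i x => by
      rw [diffGen_apply, resGen_apply, ← V.inclusion_d, ← V.inclusion_res hn, map_add, V.res_dX,
        add_zero, M.d_res])
    (fun {m m' m'' p} hm hm' i j hij x => by
      rw [V.restriction_generator hn, V.restriction_generator hn, ← V.inclusion_res hn,
        ← V.inclusion_res hn, M.res_res])
    (fun {p} x i j => by
      rw [resGen_apply, resGen_apply]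
      exact congrArg _ (M.res_two _ _ i j))

/-- The morphism to the operad with the new generators. -/
noncomputable def inclusionHom : M.toDGOperad.Hom (V.operad hn).toDGOperad where
  toHom := V.inclusion
  map_d := V.inclusion_d

theorem operad_generated {m p} (x : (V.operad hn).obj m p) :
    (V.operad hn).Generated (fun m p => Set.range (freeGen V.generators m p)) x :=
  free_generated x

theorem operad_d_gen {m p} (x : V.generators.obj m p) :
    (V.operad hn).d rfl (freeGen V.generators m p x) =
      V.inclusion.map m (p + 1) (M.d rfl (V.oldPart m p x) + V.dX m p (V.newPart m p x)) := rfl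

theorem operad_res_gen {m l : ℕ} {p : ℤ} (h : l + 1 = m + 0) (i : Fin m)
    (x : V.generators.obj m p) : (V.operad hn).res h i (freeGen V.generators m p x) =
      V.inclusion.map l p (M.res h i (V.oldPart m p x)) :=
  V.restriction_generator hn h i x

def ρGen (m : ℕ) (p : ℤ) : V.generators.obj m p →ₗ[k] P.obj m p :=
  (M.ρ.map m p).comp (V.oldPart m p) + (V.ρX m p).comp (V.newPart m p)

theorem ρGen_apply {m p} (x : V.generators.obj m p) :
    V.ρGen m p x = M.ρ.map m p (V.oldPart m p x) + V.ρX m p (V.newPart m p x) := rfl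

theorem ρGen_act (m : ℕ) (p : ℤ) (σ : Equiv.Perm (Fin m)) (x : V.generators.obj m p) :
    V.ρGen m p (V.generators.act σ x) = P.act σ (V.ρGen m p x) := by
  rw [ρGen_apply, ρGen_apply, oldPart_act, newPart_act, M.ρ.map_act, V.ρX_act, map_add]

def ρGraded : GradedOperad.Hom (free V.generators) P.toGradedOperad :=
  freeLift V.ρGen V.ρGen_act

theorem ρGraded_inclusion {m p} (x : M.obj m p) :
    V.ρGraded.map m p (V.inclusion.map m p x) = M.ρ.map m p x := by
  refine Generated.hom_eq (V.ρGraded.comp V.inclusion) M.ρ.toHom ?_ (generated m p x)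
  intro m p x hx
  rw [Hom.comp_map, V.inclusion_gen _ _ x hx, ρGraded, freeLift_gen, ρGen_apply]
  exact (congrArg _ (map_zero _)).trans (add_zero _)

/-- The extended morphism to `P`. -/
noncomputable def ρHom : (V.operad hn).toDGOperad.Hom P where
  toHom := V.ρGraded
  map_d h x := by
    refine DGOperad.map_d_of_generated (P := (V.operad hn).toDGOperad) V.ρGraded ?_ h
      (V.operad_generated hn x)
    rintro m p _ rfl _ ⟨x, rfl⟩
    have h1 := congrArg (V.ρGraded.map m (p + 1)) (V.operad_d_gen hn x)
    refine h1.trans ?_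
    rw [ρGraded_inclusion, map_add, M.ρ.map_d]
    refine Eq.trans ?_ (congrArg (P.d rfl) (freeLift_gen _ _ x).symm)
    rw [ρGen_apply, map_add, V.d_ρX]

theorem below_map {m l : ℕ} {p : ℤ} {x : M.obj l p} (hx : M.toDGOperad.StageBelow M.E m x) :
    (V.operad hn).toDGOperad.StageBelow
      (fun m p => LinearMap.range (freeGen V.generators m p)) m (V.inclusion.map l p x) :=
  Generated.map V.inclusion (fun l q y hy => by
    refine .of _ (show l < m ∧ V.inclusion.map l q y ∈ LinearMap.range (freeGen V.generators l q)
      from ⟨hy.1, ?_⟩)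
    rw [V.inclusion_gen _ _ y hy.2]
    exact ⟨_, rfl⟩) hx

/-- The partial model with the new generators. -/
noncomputable def model : PartialModel P u where
  toRestrictedOperad := V.operad hn
  E m p := LinearMap.range (freeGen V.generators m p)
  isMinimalPresentation :=
    { arity_zero := V.range_freeGen_eq_bot (by omega) M.isMinimalPresentation.arity_zero
      arity_one := V.range_freeGen_eq_bot (by omega) M.isMinimalPresentation.arity_one
      free := free_isFreeOn V.generators
      d_mem := by
        rintro m p _ rfl _ ⟨x, rfl⟩
        refine V.below_map hn (x := M.d rfl (V.oldPart m p x) + V.dX m p (V.newPart m p x))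
          (.add _ _ (M.isMinimalPresentation.d_mem rfl _ x.1.2) (V.dX_below _ _ _)) }
  res_mem := by
    rintro m l p h i _ ⟨x, rfl⟩
    exact (congrArg ((V.operad hn).toDGOperad.StageBelow _ m) (V.operad_res_gen hn h i x)).mpr
      (V.below_map hn (M.res_mem h i _ x.1.2))
  ρ := V.ρHom hn
  ρ_res {m l p} h i x hl := by
    refine (V.operad hn).hom_circ_unit_of_generated u V.ρGraded ?_ h i hl (V.operad_generated hn x)
    rintro m l p h i _ hl ⟨x, rfl⟩
    rw [V.operad_res_gen hn]
    refine (V.ρGraded_inclusion _).trans ?_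
    refine Eq.trans ?_ (congrArg (fun y => P.circ h (add_zero p) i y u) (freeLift_gen _ _ x).symm)
    rw [M.ρ_res h i _ hl, ρGen_apply, map_add, LinearMap.add_apply, V.circ_ρX, add_zero]

/-- In arity at most `n` a new generator can only occur linearly: a composition of operations of
arity at least `2` has factors of arity less than `n`, which involve no new generator. -/
theorem exists_eq_add {m : ℕ} (hm : m ≤ n) {p : ℤ} (x : (V.operad hn).obj m p) :
    ∃ (y : M.obj m p) (v : V.X.obj m p),
      x = V.inclusion.map m p y + freeGen V.generators m p (V.inrGen m p v) := by
  refine (V.isReduced hn).induction (fun m p x => m ≤ n → ∃ (y : M.obj m p) (v : V.X.obj m p),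
    x = V.inclusion.map m p y + freeGen V.generators m p (V.inrGen m p v)) ?_ ?_ ?_ ?_ ?_ ?_ ?_
    (free_generated x) hm
  · rintro m p _ ⟨⟨e, v⟩, rfl⟩ -
    refine ⟨e, v, ?_⟩
    rw [V.inclusion_gen m p e e.2, ← map_add]
    exact congrArg _ (Prod.ext (add_zero e).symm (zero_add v).symm)
  · intro _
    exact ⟨M.one, 0, by rw [V.inclusion.map_one, map_zero, map_zero, add_zero]⟩
  · intro m p _
    exact ⟨0, 0, by simp only [map_zero, add_zero]⟩
  · intro m p x y hx hy hm
    obtain ⟨a, v, rfl⟩ := hx hm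
    obtain ⟨b, w, rfl⟩ := hy hm
    refine ⟨a + b, v + w, ?_⟩
    simp only [map_add]
    abel
  · intro m p c x hx hm
    obtain ⟨a, v, rfl⟩ := hx hm
    exact ⟨c • a, c • v, by simp only [map_smul, smul_add]⟩
  · intro m p σ x hx hm
    obtain ⟨a, v, rfl⟩ := hx hm
    refine ⟨M.act σ a, V.X.act σ v, ?_⟩
    rw [map_add, V.inclusion.map_act, ← freeGen_act]
    exact congrArg (fun g => _ + freeGen V.generators m p g)
      (Prod.ext (map_zero ((M.act σ).restrict (M.isMinimalPresentation.free.1 _ _ σ))) rfl)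
  · intro m n' l p q r h hr i x y hm2 hn2 hx hy hl
    obtain ⟨a, v, rfl⟩ := hx (by omega)
    obtain ⟨b, w, rfl⟩ := hy (by omega)
    rw [V.eq_zero (by omega) v, V.eq_zero (by omega) w]
    refine ⟨M.circ h hr i a b, 0, ?_⟩
    simp only [map_zero, add_zero, V.inclusion.map_circ]

theorem inclusion_bijective (hn : 2 ≤ n) {m : ℕ} (hm : m < n) (p : ℤ) :
    Function.Bijective (V.inclusion.map m p) := by
  refine ⟨V.inclusion_injective m p, fun x => ?_⟩
  obtain ⟨y, v, hx⟩ := V.exists_eq_add hn hm.le x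
  refine ⟨y, ?_⟩
  rw [V.eq_zero hm.ne v, map_zero, map_zero, add_zero] at hx
  exact hx.symm

/-- The inclusion of the new generators. -/
noncomputable def newGen (p : ℤ) : V.X.obj n p →ₗ[k] (V.operad hn).obj n p :=
  (freeGen V.generators n p).comp (V.inrGen n p)

theorem d_newGen (p : ℤ) (v : V.X.obj n p) :
    (V.operad hn).d rfl (V.newGen hn p v) = V.inclusion.map n (p + 1) (V.dX n p v) := by
  refine (V.operad_d_gen hn (V.inrGen n p v)).trans (congrArg _ ?_)
  exact (congrArg (· + V.dX n p v) (map_zero _)).trans (zero_add _)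

theorem res_newGen {l : ℕ} (h : l + 1 = n + 0) (i : Fin n) (p : ℤ) (v : V.X.obj n p) :
    (V.operad hn).res h i (V.newGen hn p v) = 0 := by
  refine (V.operad_res_gen hn h i (V.inrGen n p v)).trans ?_
  have : V.oldPart n p (V.inrGen n p v) = 0 := rfl
  rw [this, map_zero, map_zero]
  rfl

theorem ρ_newGen (p : ℤ) (v : V.X.obj n p) :
    (V.ρHom hn).map n p (V.newGen hn p v) = V.ρX n p v := by
  refine (freeLift_gen V.ρGen V.ρGen_act (V.inrGen n p v)).trans ?_
  rw [ρGen_apply]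
  exact (congrArg (· + V.ρX n p v) (map_zero _)).trans (zero_add _)

end ExtensionData
end OperadModels

/-! ### The initial partial model, with one symmetric binary generator. -/

namespace OperadModels

variable {k : Type u} [Field k]

open GradedOperad

/-- If `1 = d w`, then every cocycle `x` in arity `1` and degree `0` equals `d (w ∘ x)`, contrary to
`HP(1) = k`. -/
theorem DGOperad.IsCohomologicallyConnected.d_ne_one {P : DGOperad k}
    (hP : P.IsCohomologicallyConnected) {t : ℤ} (ht : t + 1 = 0) (w : P.obj 1 t) :
    P.d ht w ≠ P.one := by
  intro hw
  obtain ⟨⟨e⟩, -⟩ := hP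
  obtain ⟨x, hx⟩ := Submodule.Quotient.mk_surjective _ (e.symm 1)
  have hd : P.d (rfl : (0 : ℤ) + 1 = 0 + 1) x.1 = 0 := x.2
  have : (Submodule.Quotient.mk x : P.toDGSigmaModule.cohomology 1 0) = 0 := by
    rw [DGSigmaModule.cohomology_mk_eq_zero ht]
    refine ⟨P.circ rfl (by omega) 0 w x.1, ?_⟩
    change P.d ht _ = x.1
    have := P.d_circ (rfl : 1 + 1 = 1 + 1) (by omega : t + 0 = t) ht rfl ht (by omega) (by omega) 0
      w x.1
    rw [this, hd, map_zero, smul_zero, add_zero, hw, P.one_circ]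
  rw [hx, e.symm.map_eq_zero_iff] at this
  exact one_ne_zero this

theorem DGOperad.IsCohomologicallyConnected.one_ne_zero {P : DGOperad k}
    (hP : P.IsCohomologicallyConnected) : P.one ≠ 0 := by
  intro h
  apply hP.d_ne_one (neg_add_cancel 1) 0
  rw [map_zero, h]

/-- In arity `1` the model is the line of the identity with zero differential, and the identity of
`P` spans `HP(1)`. -/
theorem PartialModel.relLifts_one {P : DGOperad k} {u : P.obj 0 0} (M : PartialModel P u)
    (hP : P.IsCohomologicallyConnected) : M.ρ.RelLifts 1 := by
  intro p q t h ht a b ha hb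
  have hone : M.ρ.map 1 0 M.one = P.one := M.ρ.map_one
  have ha0 : a = 0 := by
    have hsc := M.isReduced.isScalar a
    cases hsc with
    | zero => rfl
    | smul_one c =>
      rw [map_smul, hone] at hb
      by_cases hc : c = 0
      · rw [hc, zero_smul]
      · refine absurd ?_ (hP.d_ne_one h (c⁻¹ • b))
        rw [map_smul, hb, smul_smul, inv_mul_cancel₀ hc, one_smul]
  subst ha0
  rw [map_zero] at hb
  by_cases hp : p = 0
  · subst hp
    obtain rfl : q = 1 := by omega
    obtain ⟨c, w, hw⟩ := DGSigmaModule.exists_smul_eq_add hP (P.d_one (zero_add 1)) ht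
      (hP.d_ne_one ht) hb
    refine ⟨c • M.one, w, M.d_eq_zero_of_unary _ _, ?_⟩
    rw [map_smul, hone]
    exact hw
  · obtain ⟨w, hw⟩ := DGSigmaModule.exists_d_eq hP hp h ht hb
    refine ⟨0, -w, map_zero _, ?_⟩
    have hw' : P.d ht w = b := hw
    rw [map_zero, map_neg, hw', add_neg_cancel]

/-! ### The free operad on a unital symmetric binary operation -/

namespace BinaryGenerator

open Classical in
/-- A symmetric binary generator. -/
def binary (k : Type u) [Field k] : GradedSigmaModule k where
  obj n p := supportedOn k k (n = 2 ∧ p = 0)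
  act _ := LinearMap.id
  act_one _ := rfl
  act_mul _ _ _ := rfl

theorem binary_induction (C : ∀ n p, (binary k).obj n p → Prop) (zero : ∀ n p, C n p 0)
    (gen : ∀ x, C 2 0 x) {n p} (x : (binary k).obj n p) : C n p x := by
  by_cases h : n = 2 ∧ p = 0
  · obtain ⟨rfl, rfl⟩ := h
    exact gen x
  · rw [DGOperad.supportedOn_eq_zero h x]
    exact zero n p

theorem binary_eq_zero {n p} (h : ¬ (n = 2 ∧ p = 0)) (x : (binary k).obj n p) : x = 0 :=
  DGOperad.supportedOn_eq_zero h x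

def coeff (n : ℕ) (p : ℤ) : (binary k).obj n p →ₗ[k] k := (supportedOn k k (n = 2 ∧ p = 0)).subtype

def gen (k : Type u) [Field k] : (binary k).obj 2 0 := ⟨1, fun h => absurd ⟨rfl, rfl⟩ h⟩

open Classical in
/-- An element of the given arity and degree, equal to `y` in arity `2` and degree `0`. -/
noncomputable def extend {Y : ℕ → ℤ → Type u} [∀ n p, AddCommGroup (Y n p)] (y : Y 2 0) (n : ℕ)
    (p : ℤ) : Y n p :=
  if H : n = 2 ∧ p = 0 then by
    obtain ⟨rfl, rfl⟩ := H
    exact y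
  else 0

theorem extend_self {Y : ℕ → ℤ → Type u} [∀ n p, AddCommGroup (Y n p)] (y : Y 2 0) :
    extend y 2 0 = y := by
  rw [extend, dif_pos ⟨rfl, rfl⟩]

theorem binary_isReduced : (free (binary k)).IsReduced :=
  free_isReduced (fun _ x => binary_eq_zero (by omega) x)
    (fun _ x => binary_eq_zero (by omega) x)

noncomputable def res (n : ℕ) (p : ℤ) (_ : Fin n) :
    (binary k).obj n p →ₗ[k] (free (binary k)).obj (n - 1) p :=
  (coeff n p).smulRight (extend (Y := fun n p => (free (binary k)).obj (n - 1) p)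
    (free (binary k)).one n p)

theorem res_two (i : Fin 2) (x : (binary k).obj 2 0) :
    res 2 0 i x = coeff 2 0 x • (free (binary k)).one := by
  rw [res, LinearMap.smulRight_apply, extend_self]

theorem res_equivariant : IsEquivariantRestriction (res (k := k)) := by
  intro n p σ i x
  refine binary_induction (fun n p x => ∀ (σ : Equiv.Perm (Fin n)) (i : Fin n),
    res n p i ((binary k).act σ x) = (free (binary k)).act (delPerm σ i) (res n p (σ i) x)) ?_ ?_
    x σ i
  · intro n p σ i
    simp only [map_zero]
  · intro x σ i
    have : delPerm σ i = 1 := Subsingleton.elim (α := Equiv.Perm (Fin 1)) _ _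
    rw [this, (free (binary k)).act_one]
    rfl

theorem zero_equivariant : IsEquivariantDerivation (X := binary k) (fun _ _ => 0) :=
  fun _ _ _ _ => (map_zero _).symm

variable {P : DGOperad k} (m : P.obj 2 0)

noncomputable def toGraded (hm : ∀ σ, P.act σ m = m) :
    GradedOperad.Hom (free (binary k)) P.toGradedOperad :=
  freeLift (fun n p => (coeff n p).smulRight (extend (Y := P.obj) m n p)) (fun n p σ x => by
    refine binary_induction (fun n p x => ∀ (σ : Equiv.Perm (Fin n)),
      (coeff n p).smulRight (extend (Y := P.obj) m n p) ((binary k).act σ x) =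
        P.act σ ((coeff n p).smulRight (extend (Y := P.obj) m n p) x)) ?_ ?_ x σ
    · intro n p σ
      simp only [map_zero]
    · intro x σ
      rw [LinearMap.smulRight_apply, LinearMap.smulRight_apply, extend_self, map_smul, hm]
      rfl)

theorem toGraded_gen (hm : ∀ σ, P.act σ m = m) (x : (binary k).obj 2 0) :
    (toGraded m hm).map 2 0 (freeGen (binary k) 2 0 x) = coeff 2 0 x • m := by
  rw [toGraded, freeLift_gen, LinearMap.smulRight_apply, extend_self]

theorem one_ne_zero (hP : P.one ≠ 0) (hm : ∀ σ, P.act σ m = m) : (free (binary k)).one ≠ 0 := by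
  intro h
  apply hP
  rw [← (toGraded m hm).map_one, h, map_zero]

noncomputable def operad (h1 : (free (binary k)).one ≠ 0) : RestrictedOperad k :=
  RestrictedOperad.ofGenerators binary_isReduced zero_equivariant res_equivariant h1
    (fun n p x => by rw [LinearMap.zero_apply, map_zero])
    (fun n p i x => by
      rw [LinearMap.zero_apply, map_zero]
      refine binary_induction (fun n p x => ∀ i, derivation zero_equivariant rfl (res n p i x) = 0)
        ?_ ?_ x i
      · intro n p i
        rw [map_zero, map_zero]
      · intro x i
        rw [res_two, map_smul]
        exact (congrArg _ (derivation_one zero_equivariant rfl)).trans (smul_zero _))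
    (fun {n n' n'' p} hn hn' i j hij x => by
      by_cases h : n = 2 ∧ p = 0
      · obtain ⟨rfl, rfl⟩ := h
        obtain rfl : n'' = 0 := by omega
        exact (binary_isReduced.eq_zero _).trans (binary_isReduced.eq_zero _).symm
      · rw [binary_eq_zero h x]
        exact (congrArg _ ((congrArg _ (map_zero _)).trans (map_zero _))).trans ((map_zero _).trans
          ((congrArg _ ((congrArg _ (map_zero _)).trans (map_zero _))).trans (map_zero _)).symm))
    (fun x i j => rfl)

theorem operad_d_gen (h1 : (free (binary k)).one ≠ 0) {n p q} (h : p + 1 = q)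
    (x : (binary k).obj n p) : (operad h1).d h (freeGen (binary k) n p x) = 0 := by
  subst h
  rfl

theorem operad_res_gen (h1 : (free (binary k)).one ≠ 0) (h : 1 + 1 = 2 + 0) (i : Fin 2)
    (x : (binary k).obj 2 0) :
    (operad h1).res h i (freeGen (binary k) 2 0 x) = coeff 2 0 x • (operad h1).one :=
  res_two i x

theorem operad_generated (h1 : (free (binary k)).one ≠ 0) {n p} (x : (operad h1).obj n p) :
    (operad h1).Generated (fun n p => Set.range (freeGen (binary k) n p)) x :=
  free_generated x

/-- The morphism to `P` that takes the generator to `m`. -/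
noncomputable def toHom (h1 : (free (binary k)).one ≠ 0) (hm : ∀ σ, P.act σ m = m)
    (hd : P.d (zero_add 1) m = 0) : (operad h1).toDGOperad.Hom P where
  toHom := toGraded m hm
  map_d {n p q} h x := by
    refine DGOperad.map_d_of_generated (P := (operad h1).toDGOperad) (toGraded m hm) ?_ h
      (operad_generated h1 x)
    rintro n p q h _ ⟨x, rfl⟩
    have e1 := congrArg ((toGraded m hm).map n q) (operad_d_gen h1 h x)
    refine (e1.trans (map_zero ((toGraded m hm).map n q))).trans ?_
    refine binary_induction (fun n p x => ∀ {q} (h : p + 1 = q), 0 =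
      P.d h ((toGraded m hm).map n p (freeGen (binary k) n p x))) ?_ ?_ x h
    · intro n p q h
      simp only [map_zero]
    · intro x q h
      subst h
      rw [toGraded_gen, map_smul]
      exact ((congrArg _ hd).trans (smul_zero _)).symm

theorem range_freeGen_eq_bot {n : ℕ} (hn : n ≠ 2) (p : ℤ) :
    LinearMap.range (freeGen (binary k) n p) = ⊥ := by
  rw [LinearMap.range_eq_bot]
  ext x
  rw [binary_eq_zero (fun h => hn h.1) x, map_zero, map_zero]

/-- The partial model whose only generator is `m`. -/
noncomputable def model (hP : P.one ≠ 0) (u : P.obj 0 0) (hm : ∀ σ, P.act σ m = m)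
    (hd : P.d (zero_add 1) m = 0)
    (hmu : ∀ (h : 1 + 1 = 2 + 0) (i : Fin 2), P.circ h (add_zero 0) i m u = P.one) :
    PartialModel P u where
  toRestrictedOperad := operad (one_ne_zero m hP hm)
  E n p := LinearMap.range (freeGen (binary k) n p)
  isMinimalPresentation :=
    { arity_zero := range_freeGen_eq_bot (by omega)
      arity_one := range_freeGen_eq_bot (by omega)
      free := free_isFreeOn _
      d_mem := by
        rintro n p q h _ ⟨x, rfl⟩
        exact (congrArg (DGOperad.StageBelow _ _ n) (operad_d_gen _ h x)).mpr .zero }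
  res_mem := by
    rintro n l p h i _ ⟨x, rfl⟩
    by_cases hn : n = 2 ∧ p = 0
    · obtain ⟨rfl, rfl⟩ := hn
      obtain rfl : l = 1 := by omega
      exact (congrArg (DGOperad.StageBelow _ _ 2) (operad_res_gen _ h i x)).mpr (.smul _ _ .one)
    · have : (operad (one_ne_zero m hP hm)).res h i (freeGen (binary k) n p x) = 0 := by
        rw [binary_eq_zero hn x]
        exact (congrArg _ (map_zero (freeGen (binary k) n p))).trans (map_zero _)
      exact (congrArg (DGOperad.StageBelow _ _ n) this).mpr .zero
  ρ := toHom m _ hm hd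
  ρ_res {n l p} h i x hl := by
    refine (operad (one_ne_zero m hP hm)).hom_circ_unit_of_generated u (toGraded m hm) ?_ h i hl
      (operad_generated _ x)
    rintro n l p h i _ hl ⟨x, rfl⟩
    by_cases hn : n = 2 ∧ p = 0
    · obtain ⟨rfl, rfl⟩ := hn
      obtain rfl : l = 1 := by omega
      refine (congrArg ((toGraded m hm).map 1 0) (operad_res_gen _ h i x)).trans ?_
      refine (map_smul ((toGraded m hm).map 1 0) (coeff 2 0 x) (free (binary k)).one).trans ?_
      rw [(toGraded m hm).map_one]
      refine Eq.trans ?_ (congrArg (fun y => P.circ h (add_zero 0) i y u)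
        (toGraded_gen m hm x)).symm
      rw [map_smul, LinearMap.smul_apply, hmu]
    · rw [binary_eq_zero hn x]
      have : (operad (one_ne_zero m hP hm)).res h i (freeGen (binary k) n p 0) = 0 :=
        (congrArg _ (map_zero (freeGen (binary k) n p))).trans (map_zero _)
      refine (congrArg ((toGraded m hm).map l p) this).trans
        ((map_zero ((toGraded m hm).map l p)).trans ?_)
      have h0 : (toGraded m hm).map n p (freeGen (binary k) n p 0) = 0 := by
        rw [map_zero, map_zero]
      refine Eq.trans ?_ (congrArg (fun y => P.circ h (add_zero p) i y u) h0).symm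
      rw [map_zero, LinearMap.zero_apply]

end BinaryGenerator

/-- Symmetrization of a unital binary operation. -/
theorem DGOperad.HasUnitaryMultiplication.exists_symmetric [CharZero k] {P : DGOperad k}
    (hP : P.HasUnitaryMultiplication) : ∃ (m : P.obj 2 0) (u : P.obj 0 0),
      (∀ σ, P.act σ m = m) ∧ P.d (zero_add 1) m = 0 ∧ P.d (zero_add 1) u = 0 ∧
      ∀ (h : 1 + 1 = 2 + 0) (i : Fin 2), P.circ h (add_zero 0) i m u = P.one := by
  obtain ⟨μ, u, -, h0, h1, hμ, hu⟩ := hP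
  have hμu (h : 1 + 1 = 2 + 0) (i : Fin 2) : P.circ h (add_zero 0) i μ u = P.one := by
    fin_cases i
    · exact h0
    · exact h1
  -- The mean of `μ` and its transpose. The unit laws survive: `u` is a unit on both sides, so
  -- inserting it at either input of a permuted `μ` gives the identity.
  refine ⟨(2 : k)⁻¹ • ∑ σ, P.act σ μ, u, fun τ => ?_, ?_, hu, fun h i => ?_⟩
  · rw [map_smul, map_sum]
    congr 1
    simp only [← P.act_mul]
    exact Fintype.sum_equiv (Equiv.mulRight τ) _ _ fun _ => rfl
  · rw [map_smul, map_sum]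
    simp only [P.d_act, hμ, map_zero, Finset.sum_const_zero, smul_zero]
  · have (σ : Equiv.Perm (Fin 2)) : P.circ h (add_zero 0) i (P.act σ μ) u = P.one := by
      have := P.circ_act h (add_zero 0) i σ 1 μ u
      rw [P.act_one, hμu, Subsingleton.elim (blockPerm h i σ 1) 1, P.act_one] at this
      exact this
    rw [map_smul, map_sum, LinearMap.smul_apply, LinearMap.sum_apply]
    simp only [this, Finset.sum_const, Finset.card_univ, Fintype.card_perm, Fintype.card_fin]
    rw [← Nat.cast_smul_eq_nsmul k, smul_smul]
    simp

/-- From `u = d w` would follow `1 = m ∘ u = d (m ∘ w)`. -/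
theorem DGOperad.d_ne_unit {P : DGOperad k} (hP : P.IsCohomologicallyConnected) {m : P.obj 2 0}
    {u : P.obj 0 0} (hm : P.d (zero_add 1) m = 0)
    (hmu : ∀ (h : 1 + 1 = 2 + 0) (i : Fin 2), P.circ h (add_zero 0) i m u = P.one) {t : ℤ}
    (ht : t + 1 = 0) (w : P.obj 0 t) : P.d ht w ≠ u := by
  intro hw
  apply hP.d_ne_one ht (P.circ (by omega : 1 + 1 = 2 + 0) (zero_add t) 0 m w)
  rw [P.d_circ _ _ (zero_add 1) ht ht (by omega) (by omega), hm, hw, hmu]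
  simp

end OperadModels

/-! ### Degeneracies from a unital binary operation; normalization of relative cocycles. -/

namespace OperadModels

variable {k : Type u} [Field k]

namespace DGOperad

/-- Insertion of an input next to the input `r`, by means of a binary operation `m`. -/
def degeneracy (Q : DGOperad k) (m : Q.obj 2 0) {l n : ℕ} {p : ℤ} (h : l + 1 = n + 0) (r : Fin n) :
    Q.obj l p →ₗ[k] Q.obj n p :=
  -- For `r < l` the input `r` of `y` is doubled by inserting `m`. For `r = l` there is no such
  -- input, and `y` is inserted into the first input of `m`, so that the new input comes last.
  if hr : (r : ℕ) < l then (Q.circ (by omega : n + 1 = l + 2) (add_zero p) ⟨r, hr⟩).flip m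
  else Q.circ (by omega : n + 1 = 2 + l) (zero_add p) 0 m

section

variable (Q : DGOperad k) (m : Q.obj 2 0) {l n : ℕ} {p : ℤ} (h : l + 1 = n + 0) (r : Fin n)

theorem degeneracy_of_lt (h' : n + 1 = l + 2) (hr : (r : ℕ) < l) (y : Q.obj l p) :
    Q.degeneracy m h r y = Q.circ h' (add_zero p) ⟨r, hr⟩ y m := by
  rw [degeneracy, dif_pos hr]
  rfl

theorem degeneracy_of_not_lt (h' : n + 1 = 2 + l) (hr : ¬ (r : ℕ) < l) (y : Q.obj l p) :
    Q.degeneracy m h r y = Q.circ h' (zero_add p) 0 m y := by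
  rw [degeneracy, dif_neg hr]

theorem d_degeneracy (hm : Q.d (zero_add 1) m = 0) {q : ℤ} (hq : p + 1 = q) (y : Q.obj l p) :
    Q.d hq (Q.degeneracy m h r y) = Q.degeneracy m h r (Q.d hq y) := by
  by_cases hr : (r : ℕ) < l
  · rw [Q.degeneracy_of_lt m h r (by omega) hr, Q.degeneracy_of_lt m h r (by omega) hr,
      Q.d_circ _ _ hq (zero_add 1) hq (by omega) (by omega), hm, map_zero, smul_zero, add_zero]
  · rw [Q.degeneracy_of_not_lt m h r (by omega) hr, Q.degeneracy_of_not_lt m h r (by omega) hr,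
      Q.d_circ _ _ (zero_add 1) hq hq (by omega) (by omega), hm, map_zero, LinearMap.zero_apply,
      zero_add, Int.negOnePow_zero, one_smul]

theorem map_degeneracy {P : DGOperad k} (f : Hom Q P) (y : Q.obj l p) :
    f.map n p (Q.degeneracy m h r y) = P.degeneracy (f.map 2 0 m) h r (f.map l p y) := by
  by_cases hr : (r : ℕ) < l
  · rw [Q.degeneracy_of_lt m h r (by omega) hr, P.degeneracy_of_lt _ h r (by omega) hr, f.map_circ]
  · rw [Q.degeneracy_of_not_lt m h r (by omega) hr, P.degeneracy_of_not_lt _ h r (by omega) hr,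
      f.map_circ]

variable (u : Q.obj 0 0)

/-- The analogue of the simplicial identity `dᵣ sᵣ = id`, from the unit law of `m`. -/
theorem degeneracy_circ_unit
    (hmu : ∀ (h : 1 + 1 = 2 + 0) (i : Fin 2), Q.circ h (add_zero 0) i m u = Q.one)
    (y : Q.obj l p) : Q.circ h (add_zero p) r (Q.degeneracy m h r y) u = y := by
  have hr2 := r.2
  by_cases hr : (r : ℕ) < l
  · rw [Q.degeneracy_of_lt m h r (by omega) hr]
    have e : r = innerSlot (by omega : n + 1 = l + 2) ⟨r, hr⟩ 0 := Fin.ext (by simp [innerSlot])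
    have := Q.circ_circ_inner (by omega : n + 1 = l + 2) h rfl rfl (add_zero p) (add_zero p)
      (add_zero 0) (add_zero p) ⟨r, hr⟩ 0 y m u
    rw [← e, hmu, Q.circ_one] at this
    exact this
  · rw [Q.degeneracy_of_not_lt m h r (by omega) hr]
    have e : r = outerSlot (by omega : n + 1 = 2 + l) 0 1 (by decide) :=
      Fin.ext (by simp [outerSlot]; omega)
    have := Q.circ_circ_outer (by omega : n + 1 = 2 + l) h rfl (by omega : l + 1 = 1 + l)
      (zero_add p) (add_zero p) (add_zero 0) (zero_add p) 0 1 (by decide) m y u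
    rw [← e, hmu, mul_zero, Int.negOnePow_zero, one_smul] at this
    rw [Subsingleton.elim (outerSlot _ _ _ _ : Fin 1) 0, Q.one_circ] at this
    exact this

/-- For `j < r` the face `j` passes through the degeneracy `r` and then through the face `r`, as in
the simplicial identities, so it acts on `x` first and gives zero. -/
theorem degeneracy_circ_unit_of_lt (x : Q.obj n p) (j : Fin n) (hj : (j : ℕ) < r)
    (hx : Q.circ h (add_zero p) j x u = 0) :
    Q.circ h (add_zero p) j (Q.degeneracy m h r (Q.circ h (add_zero p) r x u)) u = 0 := by
  have hr2 := r.2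
  have hjl : (j : ℕ) < l := by omega
  have hrj : r ≠ j := fun e => by rw [e] at hj; omega
  have h1 : Q.circ (by omega : l - 1 + 1 = l + 0) (add_zero p) ⟨j, hjl⟩
      (Q.circ h (add_zero p) r x u) u = 0 := by
    have e : (⟨j, hjl⟩ : Fin l) = outerSlot h r j hrj.symm :=
      Fin.ext (by simp only [outerSlot]; rw [if_pos hj])
    rw [e, Q.circ_circ_outer h (by omega : l - 1 + 1 = l + 0) h (by omega) (add_zero p) (add_zero p)
      (add_zero p) (add_zero p) r j hrj x u u, hx, map_zero, LinearMap.zero_apply, smul_zero]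
  generalize Q.circ h (add_zero p) r x u = y at h1 ⊢
  by_cases hr : (r : ℕ) < l
  · rw [Q.degeneracy_of_lt m h r (by omega) hr]
    have hne : (⟨r, hr⟩ : Fin l) ≠ ⟨j, hjl⟩ := fun e => by
      have := congrArg Fin.val e
      simp only at this
      omega
    have e : j = outerSlot (by omega : n + 1 = l + 2) ⟨r, hr⟩ ⟨j, hjl⟩ hne.symm :=
      Fin.ext (by simp only [outerSlot]; rw [if_pos hj])
    have := Q.circ_circ_outer (by omega : n + 1 = l + 2) h (by omega : l - 1 + 1 = l + 0) (by omega)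
      (add_zero p) (add_zero p) (add_zero p) (add_zero p) ⟨r, hr⟩ ⟨j, hjl⟩ hne y m u
    rw [← e, h1, map_zero, LinearMap.zero_apply, smul_zero] at this
    exact this
  · rw [Q.degeneracy_of_not_lt m h r (by omega) hr]
    have e : j = innerSlot (by omega : n + 1 = 2 + l) 0 ⟨j, hjl⟩ := Fin.ext (by simp [innerSlot])
    have := Q.circ_circ_inner (by omega : n + 1 = 2 + l) h (by omega : l - 1 + 1 = l + 0) (by omega)
      (zero_add p) (add_zero p) (add_zero p) (zero_add p) 0 ⟨j, hjl⟩ m y u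
    rw [← e, h1, map_zero] at this
    exact this

end

/-- Relative cocycles are cohomologous to normalized ones. -/
theorem Hom.exists_normalized {Q P : DGOperad k} (f : Hom Q P) {m : Q.obj 2 0} {u : Q.obj 0 0}
    (hm : Q.d (zero_add 1) m = 0) (hu : Q.d (zero_add 1) u = 0)
    (hmu : ∀ (h : 1 + 1 = 2 + 0) (i : Fin 2), Q.circ h (add_zero 0) i m u = Q.one)
    {l n : ℕ} (h : l + 1 = n + 0) (hf : f.RelLifts l) {p q t : ℤ} (hp : p + 1 = q) (ht : t + 1 = p)
    (a : Q.obj n q) (b : P.obj n p) (ha : Q.d (rfl : q + 1 = q + 1) a = 0)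
    (hb : P.d hp b = f.map n q a) :
    ∃ (w : Q.obj n p) (v : P.obj n t), ∀ j : Fin n,
      Q.circ h (add_zero q) j (a - Q.d hp w) u = 0 ∧
      P.circ h (add_zero p) j (b - f.map n p w - P.d ht v) (f.map 0 0 u) = 0 := by
  have hm' : P.d (zero_add 1) (f.map 2 0 m) = 0 := by rw [← f.map_d, hm, map_zero]
  have hu' : P.d (zero_add 1) (f.map 0 0 u) = 0 := by rw [← f.map_d, hu, map_zero]
  have hmu' (h : 1 + 1 = 2 + 0) (i : Fin 2) :
      P.circ h (add_zero 0) i (f.map 2 0 m) (f.map 0 0 u) = P.one := by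
    rw [← f.map_circ, hmu]
    exact f.map_one
  have face_d {R : DGOperad k} {u : R.obj 0 0} (hu : R.d (zero_add 1) u = 0) {p q : ℤ}
      (hp : p + 1 = q) (j : Fin n) (x : R.obj n p) :
      R.d hp (R.circ h (add_zero p) j x u) = R.circ h (add_zero q) j (R.d hp x) u := by
    rw [R.d_circ _ _ hp (zero_add 1) hp (by omega) (by omega), hu, map_zero, smul_zero, add_zero]
  -- The faces are killed one after the other. Subtracting the degeneracy `r` of the face `r` kills
  -- that face and preserves the vanishing of the earlier ones. What is subtracted is a relative
  -- coboundary, because the face `r` is a relative cocycle of arity `l`, where `f` is acyclic by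
  -- `hf`.
  have key (s : ℕ) (hs : s ≤ n) : ∃ (w : Q.obj n p) (v : P.obj n t), ∀ j : Fin n, (j : ℕ) < s →
      Q.circ h (add_zero q) j (a - Q.d hp w) u = 0 ∧
      P.circ h (add_zero p) j (b - f.map n p w - P.d ht v) (f.map 0 0 u) = 0 := by
    induction s with
    | zero => exact ⟨0, 0, fun j hj => absurd hj (Nat.not_lt_zero _)⟩
    | succ s ih =>
      obtain ⟨w, v, hwv⟩ := ih (by omega)
      let r : Fin n := ⟨s, hs⟩
      set a' := a - Q.d hp w with ha'
      set b' := b - f.map n p w - P.d ht v with hb'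
      have hda : Q.d (rfl : q + 1 = q + 1) a' = 0 := by
        rw [ha', map_sub, ha, Q.d_d, sub_zero]
      have hdb : P.d hp b' = f.map n q a' := by
        rw [hb', ha', map_sub, map_sub, hb, P.d_d, sub_zero, map_sub, f.map_d]
      obtain ⟨w', v', h1, h2⟩ := hf hp ht (Q.circ h (add_zero q) r a' u)
        (P.circ h (add_zero p) r b' (f.map 0 0 u)) (by
          rw [face_d hu, hda, map_zero, LinearMap.zero_apply])
        (by rw [face_d hu', hdb, f.map_circ])
      have e1 : a - Q.d hp (w + Q.degeneracy m h r w') =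
          a' - Q.degeneracy m h r (Q.circ h (add_zero q) r a' u) := by
        rw [map_add, Q.d_degeneracy m h r hm, h1, ha', sub_add_eq_sub_sub]
      have e2 : b - f.map n p (w + Q.degeneracy m h r w') -
            P.d ht (v - P.degeneracy (f.map 2 0 m) h r v') =
          b' - P.degeneracy (f.map 2 0 m) h r (P.circ h (add_zero p) r b' (f.map 0 0 u)) := by
        rw [map_add, map_sub, P.d_degeneracy _ h r hm', Q.map_degeneracy, h2, hb', map_add]
        abel
      refine ⟨w + Q.degeneracy m h r w', v - P.degeneracy (f.map 2 0 m) h r v', fun j hj => ?_⟩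
      rw [e1, e2]
      by_cases hjs : (j : ℕ) < s
      · obtain ⟨hj1, hj2⟩ := hwv j hjs
        constructor
        · rw [map_sub, LinearMap.sub_apply, hj1,
            Q.degeneracy_circ_unit_of_lt m h r u a' j hjs hj1, sub_zero]
        · rw [map_sub, LinearMap.sub_apply, hj2,
            P.degeneracy_circ_unit_of_lt _ h r _ b' j hjs hj2, sub_zero]
      · obtain rfl : j = r := Fin.ext (by change (j : ℕ) = s; omega)
        constructor
        · rw [map_sub, LinearMap.sub_apply, Q.degeneracy_circ_unit m h r u hmu, sub_self]
        · rw [map_sub, LinearMap.sub_apply, P.degeneracy_circ_unit _ h r _ hmu', sub_self]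
  obtain ⟨w, v, hwv⟩ := key n le_rfl
  exact ⟨w, v, fun j => hwv j j.2⟩

end DGOperad
end OperadModels

/-! ### Normalized relative cohomology and the choice of new generators. -/

namespace OperadModels

variable {k : Type u} [Field k]

/-- The operations whose compositions with `u` vanish. -/
def DGOperad.normalized (P : DGOperad k) (u : P.obj 0 0) (n : ℕ) (p : ℤ) :
    Submodule k (P.obj n p) where
  carrier := {x | ∀ (l : ℕ) (h : l + 1 = n + 0) (i : Fin n), P.circ h (add_zero p) i x u = 0}
  zero_mem' l h i := by rw [map_zero, LinearMap.zero_apply]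
  add_mem' hx hy l h i := by rw [map_add, LinearMap.add_apply, hx, hy, add_zero]
  smul_mem' c x hx l h i := by rw [map_smul, LinearMap.smul_apply, hx, smul_zero]

theorem DGOperad.act_mem_normalized (P : DGOperad k) {u : P.obj 0 0} {n : ℕ} {p : ℤ}
    (σ : Equiv.Perm (Fin n)) {x : P.obj n p} (hx : x ∈ P.normalized u n p) :
    P.act σ x ∈ P.normalized u n p := by
  intro l h i
  have := P.circ_act h (add_zero p) i σ 1 x u
  rw [P.act_one, hx, map_zero] at this
  exact this

/-- The operations whose restrictions vanish. -/
def RestrictedOperad.normalized (F : RestrictedOperad k) (n : ℕ) (p : ℤ) :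
    Submodule k (F.obj n p) where
  carrier := {x | ∀ (l : ℕ) (h : l + 1 = n + 0) (i : Fin n), F.res h i x = 0}
  zero_mem' l h i := map_zero _
  add_mem' hx hy l h i := by rw [map_add, hx, hy, add_zero]
  smul_mem' c x hx l h i := by rw [map_smul, hx, smul_zero]

theorem RestrictedOperad.act_mem_normalized (F : RestrictedOperad k) {n : ℕ} {p : ℤ}
    (σ : Equiv.Perm (Fin n)) {x : F.obj n p} (hx : x ∈ F.normalized n p) :
    F.act σ x ∈ F.normalized n p := by
  intro l h i
  rw [F.res_act, hx, map_zero]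

namespace PartialModel

variable {P : DGOperad k} {u : P.obj 0 0} (M : PartialModel P u)

/-- Existence of a binary cocycle all of whose restrictions are the identity. -/
def HasUnitalCocycle : Prop :=
  ∃ m : M.obj 2 0, M.d (zero_add 1) m = 0 ∧ ∀ (h : 1 + 1 = 2 + 0) (i : Fin 2), M.res h i m = M.one

variable {M}

/-- The degeneracy argument needs an operation of arity `0` in the source, so it is applied to the
unitary extension of `M`, where restrictions are compositions with the unit. -/
theorem exists_normalized (hM : M.HasUnitalCocycle) (hu : P.d (zero_add 1) u = 0) {n : ℕ}
    (hn : 2 ≤ n) (hf : M.ρ.RelLifts (n - 1)) {p q t : ℤ} (hp : p + 1 = q) (ht : t + 1 = p)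
    {a : M.obj n q} {b : P.obj n p} (ha : M.d (rfl : q + 1 = q + 1) a = 0)
    (hb : P.d hp b = M.ρ.map n q a) : ∃ (w : M.obj n p) (v : P.obj n t),
      a - M.d hp w ∈ M.normalized n q ∧ b - M.ρ.map n p w - P.d ht v ∈ P.normalized u n p := by
  obtain ⟨m, hm, hmu⟩ := hM
  let f := RestrictedOperad.unitaryHom M.ρ u hu M.ρ_res
  have hfm {n p} (x : M.obj n p) : f.map n p (M.incl n p x) = M.ρ.map n p x :=
    RestrictedOperad.unitaryMap_incl M.ρ u x
  have hfu : f.map 0 0 M.unit = u := RestrictedOperad.unitaryMap_unit M.ρ u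
  have hcu {n l : ℕ} {p : ℤ} (h : l + 1 = n + 0) (hn : n ≠ 1) (i : Fin n) (x : M.obj n p) :
      M.unitary.circ h (add_zero p) i (M.incl n p x) M.unit = M.incl l p (M.res h i x) :=
    (M.unitaryCirc_unit h (add_zero p) i _).trans (M.restrict_of_ne h i hn _)
  have hdi {n : ℕ} {p q : ℤ} (h : p + 1 = q) (x : M.obj n p) :
      M.unitary.d h (M.incl n p x) = M.incl n q (M.d h x) := M.unitaryD_incl h x
  obtain ⟨w, v, hwv⟩ := f.exists_normalized (m := M.incl 2 0 m) (u := M.unit)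
    ((hdi _ _).trans ((congrArg _ hm).trans (map_zero _))) (M.unitaryD_unit _)
    (fun h i => (hcu h (by omega) i m).trans (congrArg _ (hmu h i)))
    (by omega : n - 1 + 1 = n + 0)
    (RestrictedOperad.unitaryHom_relLifts M.ρ u hu M.ρ_res (by omega) hf) hp ht (M.incl n q a) b
    ((hdi _ _).trans ((congrArg _ ha).trans (map_zero _))) (hb.trans (hfm a).symm)
  obtain ⟨w, rfl⟩ : ∃ w', w = M.incl n p w' := ⟨_, M.eq_incl ⟨0, by omega⟩ w⟩
  refine ⟨w, v, fun l h i => ?_, fun l h i => ?_⟩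
  · obtain rfl : l = n - 1 := by omega
    have h1 := (hwv i).1
    have h2 : (show M.unitary.obj n q from M.incl n q a) - M.unitary.d hp (M.incl n p w) =
        M.incl n q (a - M.d hp w) :=
      (congrArg ((show M.unitary.obj n q from M.incl n q a) - ·) (hdi hp w)).trans (map_sub (M.incl n q) _ _).symm
    have h3 := (congrArg (fun x => M.unitary.circ h (add_zero q) i x M.unit) h2).symm.trans h1
    exact congrArg Prod.fst ((hcu h (by omega) i _).symm.trans h3)
  · obtain rfl : l = n - 1 := by omega
    have h1 := (hwv i).2
    rw [hfu, hfm] at h1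
    exact h1

end PartialModel

namespace ExtensionData

variable {P : DGOperad k} {u : P.obj 0 0} {M : PartialModel P u} {n : ℕ} (V : ExtensionData M n)

/-- The new generators kill the normalized relative cohomology of `M` in arity `n`. -/
structure IsComplete : Prop where
  eq_zero : ∀ {p : ℤ} (x : V.X.obj n (p + 1)) (w : M.obj n (p + 1)) (v : P.obj n p),
    w ∈ M.normalized n (p + 1) → v ∈ P.normalized u n p →
    V.dX n (p + 1) x = M.d rfl w → V.ρX n (p + 1) x = M.ρ.map n (p + 1) w + P.d rfl v → x = 0
  exists_eq : ∀ {p t : ℤ} (ht : t + 1 = p) (a : M.obj n (p + 1)) (b : P.obj n p),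
    a ∈ M.normalized n (p + 1) → b ∈ P.normalized u n p → M.d rfl a = 0 →
    P.d rfl b = M.ρ.map n (p + 1) a → ∃ (x : V.X.obj n p) (w : M.obj n p) (v : P.obj n t),
      V.dX n p x = a + M.d rfl w ∧ V.ρX n p x = b + M.ρ.map n p w + P.d ht v

variable {V}

theorem hasUnitalCocycle (hn : 2 ≤ n) (hM : M.HasUnitalCocycle) :
    (V.model hn).HasUnitalCocycle := by
  obtain ⟨m, hm, hmu⟩ := hM
  refine ⟨V.inclusion.map 2 0 m, ?_, fun h i => ?_⟩
  · exact (V.inclusion_d _ m).symm.trans ((congrArg _ hm).trans (map_zero _))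
  · exact (V.inclusion_res hn h i m).symm.trans ((congrArg _ (hmu h i)).trans V.inclusion.map_one)

/-- A relative cocycle of `T` may be normalized; its first entry is then `J y + g x` with `y`
normalized. First the new part `x` is shown to vanish, and then the remaining relative cocycle `(y,
b')` of `M` is killed by the generator that represents its class. The enlarged model `T` enters only
through the formal properties of `J` and `g`. -/
theorem IsComplete.relLifts_of_hom (hV : V.IsComplete) (hn : 2 ≤ n) {T : PartialModel P u}
    (J : M.toDGOperad.Hom T.toDGOperad) (hJ : ∀ p, Function.Injective (J.map n p))
    (hJres : ∀ {l p} (h : l + 1 = n + 0) (i : Fin n) (x : M.obj n p),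
      T.res h i (J.map n p x) = J.map l p (M.res h i x))
    (hJinj : ∀ p, Function.Injective (J.map (n - 1) p))
    (hJρ : ∀ {p} (x : M.obj n p), T.ρ.map n p (J.map n p x) = M.ρ.map n p x)
    (g : ∀ p, V.X.obj n p →ₗ[k] T.obj n p)
    (hg : ∀ {p} (x : T.obj n p), ∃ y v, x = J.map n p y + g p v)
    (hgd : ∀ {p} (v : V.X.obj n p), T.d rfl (g p v) = J.map n (p + 1) (V.dX n p v))
    (hgres : ∀ {l p} (h : l + 1 = n + 0) (i : Fin n) (v : V.X.obj n p), T.res h i (g p v) = 0)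
    (hgρ : ∀ {p} (v : V.X.obj n p), T.ρ.map n p (g p v) = V.ρX n p v)
    (hT : T.HasUnitalCocycle) (hu : P.d (zero_add 1) u = 0) (hf : T.ρ.RelLifts (n - 1)) :
    T.ρ.RelLifts n := by
  rintro p _ t rfl ht a b ha hb
  obtain ⟨w, v, h1, h2⟩ := T.exists_normalized hT hu hn hf rfl ht ha hb
  have hda : T.d (rfl : p + 1 + 1 = p + 1 + 1) (a - T.d rfl w) = 0 := by
    rw [map_sub, ha, T.d_d, sub_zero]
  have hdb : P.d rfl (b - T.ρ.map n p w - P.d ht v) = T.ρ.map n (p + 1) (a - T.d rfl w) := by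
    rw [map_sub, map_sub, map_sub, P.d_d, hb, T.ρ.map_d, sub_zero]
  obtain ⟨y, x, hx⟩ := hg (a - T.d rfl w)
  set b' := b - T.ρ.map n p w - P.d ht v with hb'
  have hy : y ∈ M.normalized n (p + 1) := by
    intro l h i
    obtain rfl : l = n - 1 := by omega
    have := h1 (n - 1) h i
    rw [hx, map_add, hgres, add_zero, hJres] at this
    exact hJinj _ (this.trans (map_zero _).symm)
  -- The two cocycle conditions say that the differential and the image in `P` of `x` form the
  -- relative coboundary of `(-y, b')`. New generators inject into normalized relative cohomology,
  -- hence `x = 0`.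
  have hx0 : x = 0 := by
    refine hV.eq_zero x (-y) b' (neg_mem hy) h2 ?_ ?_
    · rw [hx, map_add, hgd, ← J.map_d, ← map_add] at hda
      rw [map_neg]
      exact eq_neg_of_add_eq_zero_right (hJ _ (hda.trans (map_zero _).symm))
    · rw [hdb, hx, map_add, hgρ, hJρ, map_neg]
      abel
  subst hx0
  rw [map_zero, add_zero] at hx
  rw [hx] at hda hdb
  rw [← J.map_d] at hda
  rw [hJρ] at hdb
  obtain ⟨x, w', v', hx1, hx2⟩ := hV.exists_eq ht y b' hy h2
    (hJ _ (hda.trans (map_zero _).symm)) hdb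
  refine ⟨g p x - J.map n p w' + w, v' - v, ?_, ?_⟩
  · rw [map_add, map_sub, hgd, hx1, map_add, J.map_d, add_sub_cancel_right, ← hx, sub_add_cancel]
  · rw [map_add, map_sub, hgρ, hx2, hJρ, hb', map_sub]
    abel

theorem IsComplete.relLifts (hV : V.IsComplete) (hn : 2 ≤ n) (hM : M.HasUnitalCocycle)
    (hu : P.d (zero_add 1) u = 0) (hf : (V.model hn).ρ.RelLifts (n - 1)) :
    (V.model hn).ρ.RelLifts n :=
  hV.relLifts_of_hom hn (T := V.model hn) (V.inclusionHom hn) (V.inclusion_injective n)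
    (fun h i x => (V.inclusion_res hn h i x).symm) (V.inclusion_injective (n - 1))
    V.ρGraded_inclusion (V.newGen hn) (fun x => V.exists_eq_add hn le_rfl x)
    (V.d_newGen hn _) (fun h i => V.res_newGen hn h i _) (V.ρ_newGen hn _)
    (hasUnitalCocycle hn hM) hu hf

theorem relLifts_of_lt (hn : 2 ≤ n) {m : ℕ} (hm : m < n) (hf : M.ρ.RelLifts m) :
    (V.model hn).ρ.RelLifts m := by
  intro p q t h ht a b ha hb
  obtain ⟨a, rfl⟩ := (V.inclusion_bijective hn hm q).2 a
  obtain ⟨a', b', h1, h2⟩ := hf h ht a b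
    ((V.inclusion_injective m _) ((V.inclusion_d _ a).trans (ha.trans (map_zero _).symm)))
    (hb.trans (V.ρGraded_inclusion a))
  exact ⟨V.inclusion.map m p a', b', (V.inclusion_d h a').symm.trans (congrArg _ h1),
    (V.ρGraded_inclusion a').trans h2⟩

end ExtensionData

namespace PartialModel

variable {P : DGOperad k} {u : P.obj 0 0} (M : PartialModel P u)

/-- Normalized relative cocycles of `M → P`. -/
def relCocycles (n : ℕ) (p : ℤ) : Submodule k (M.obj n (p + 1) × P.obj n p) where
  carrier := {x | x.1 ∈ M.normalized n (p + 1) ∧ x.2 ∈ P.normalized u n p ∧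
    M.d (rfl : p + 1 + 1 = p + 1 + 1) x.1 = 0 ∧ P.d rfl x.2 = M.ρ.map n (p + 1) x.1}
  zero_mem' := ⟨zero_mem _, zero_mem _, map_zero _, (map_zero _).trans (map_zero _).symm⟩
  add_mem' := by
    rintro x y ⟨h1, h2, h3, h4⟩ ⟨h1', h2', h3', h4'⟩
    refine ⟨add_mem h1 h1', add_mem h2 h2', ?_, ?_⟩
    · rw [Prod.fst_add, map_add, h3, h3', add_zero]
    · rw [Prod.fst_add, Prod.snd_add, map_add, map_add, h4, h4']
  smul_mem' := by
    rintro c x ⟨h1, h2, h3, h4⟩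
    refine ⟨Submodule.smul_mem _ c h1, Submodule.smul_mem _ c h2, ?_, ?_⟩
    · rw [Prod.smul_fst, map_smul, h3, smul_zero]
    · rw [Prod.smul_fst, Prod.smul_snd, map_smul, map_smul, h4]

/-- Differentials of normalized relative cochains of `M → P`. -/
def relCoboundaries (n : ℕ) (p : ℤ) : Submodule k (M.obj n (p + 1) × P.obj n p) where
  carrier := {x | ∃ w ∈ M.normalized n p, ∃ v ∈ P.normalized u n (p - 1),
    x = (M.d rfl w, M.ρ.map n p w + P.d (sub_add_cancel p 1) v)}
  zero_mem' := ⟨0, zero_mem _, 0, zero_mem _, by simp only [map_zero, add_zero]; rfl⟩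
  add_mem' := by
    rintro _ _ ⟨w, hw, v, hv, rfl⟩ ⟨w', hw', v', hv', rfl⟩
    refine ⟨w + w', add_mem hw hw', v + v', add_mem hv hv', Prod.ext (map_add _ _ _).symm ?_⟩
    simp only [map_add, Prod.snd_add]
    abel
  smul_mem' := by
    rintro c _ ⟨w, hw, v, hv, rfl⟩
    refine ⟨c • w, Submodule.smul_mem _ c hw, c • v, Submodule.smul_mem _ c hv,
      Prod.ext (map_smul _ _ _).symm ?_⟩
    simp only [map_smul, Prod.smul_snd, smul_add]

theorem mem_relCoboundaries {n : ℕ} {p t : ℤ} (ht : t + 1 = p) {w : M.obj n p}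
    (hw : w ∈ M.normalized n p) {v : P.obj n t} (hv : v ∈ P.normalized u n t) :
    (M.d rfl w, M.ρ.map n p w + P.d ht v) ∈ M.relCoboundaries n p := by
  obtain rfl : t = p - 1 := by omega
  exact ⟨w, hw, v, hv, rfl⟩

/-- The action of permutations on relative cocycles. -/
def relAct (n : ℕ) (p : ℤ) (σ : Equiv.Perm (Fin n)) : M.relCocycles n p →ₗ[k] M.relCocycles n p :=
  ((M.act σ).prodMap (P.act σ)).restrict (by
    rintro ⟨a, b⟩ ⟨h1, h2, h3, h4⟩
    refine ⟨M.act_mem_normalized σ h1, P.act_mem_normalized σ h2, ?_, ?_⟩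
    · change M.d _ (M.act σ a) = 0
      rw [M.d_act, h3, map_zero]
    · change P.d _ (P.act σ b) = M.ρ.map n (p + 1) (M.act σ a)
      rw [P.d_act, h4, M.ρ.map_act])

/-- Normalized relative cohomology of `M → P`. -/
def relCohomology : GradedSigmaModule k where
  obj n p := M.relCocycles n p ⧸ (M.relCoboundaries n p).submoduleOf (M.relCocycles n p)
  act {n p} σ := Submodule.mapQ _ _ (M.relAct n p σ) (by
    rintro x ⟨w, hw, v, hv, hx⟩
    refine ⟨M.act σ w, M.act_mem_normalized σ hw, P.act σ v, P.act_mem_normalized σ hv, ?_⟩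
    refine (congrArg ((M.act σ).prodMap (P.act σ)) hx).trans (Prod.ext ?_ ?_)
    · exact (M.d_act _ σ w).symm
    · change P.act σ (M.ρ.map n p w + P.d _ v) = M.ρ.map n p (M.act σ w) + P.d _ (P.act σ v)
      rw [map_add, M.ρ.map_act, P.d_act])
  act_one x := by
    obtain ⟨x, rfl⟩ := Submodule.mkQ_surjective _ x
    exact congrArg (Submodule.mkQ _) (Subtype.ext (Prod.ext (M.act_one _) (P.act_one _)))
  act_mul σ τ x := by
    obtain ⟨x, rfl⟩ := Submodule.mkQ_surjective _ x
    exact congrArg (Submodule.mkQ _) (Subtype.ext (Prod.ext (M.act_mul _ _ _) (P.act_mul _ _ _)))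

/-- The class of a relative cocycle. -/
def relClass (n : ℕ) (p : ℤ) : M.relCocycles n p →ₗ[k] M.relCohomology.obj n p :=
  Submodule.mkQ _

theorem relClass_surjective (n : ℕ) (p : ℤ) : Function.Surjective (M.relClass n p) :=
  Submodule.mkQ_surjective _

theorem relClass_eq_zero_iff {n : ℕ} {p : ℤ} (x : M.relCocycles n p) :
    M.relClass n p x = 0 ↔ x.1 ∈ M.relCoboundaries n p :=
  Submodule.Quotient.mk_eq_zero _

/-- An equivariant choice of representatives; it makes the differentials and the images in `P` of
the new generators equivariant. -/
theorem exists_relSection [CharZero k] (n : ℕ) (p : ℤ) :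
    ∃ s : M.relCohomology.obj n p →ₗ[k] M.relCocycles n p,
      (∀ x, M.relClass n p (s x) = x) ∧ ∀ σ x, s (M.relCohomology.act σ x) = M.relAct n p σ (s x) :=
  exists_equivariant_lift M.relCohomology.act (M.relAct n p) M.relCohomology.act
    M.relCohomology.act_mul
    (fun σ τ x => Subtype.ext (Prod.ext (M.act_mul _ _ _) (P.act_mul _ _ _)))
    M.relCohomology.act_mul M.relCohomology.act_one (M.relClass n p) (fun σ x => rfl) LinearMap.id
    (fun σ x => rfl) (M.relClass_surjective n p)

/-- The part of arity `n` of a graded `Σ`-module. -/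
def _root_.OperadModels.GradedSigmaModule.part (X : GradedSigmaModule k) (n : ℕ) :
    GradedSigmaModule k where
  obj m p := supportedOn k (X.obj m p) (m = n)
  act σ := (X.act σ).restrict fun x hx hc => by rw [hx hc, map_zero]
  act_one x := Subtype.ext (X.act_one _)
  act_mul σ τ x := Subtype.ext (X.act_mul _ _ _)

/-- The new generators are the normalized relative classes of arity `n` themselves. A class
represented by `(a, b)` gets the differential `a` and the image `b`; the hypothesis `hM` guarantees
that `a` lies in the stage below. -/
theorem exists_isComplete [CharZero k] {n : ℕ}
    (hM : ∀ p, ∀ x ∈ M.normalized n p, M.toDGOperad.StageBelow M.E n x) :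
    ∃ V : ExtensionData M n, V.IsComplete := by
  choose s hs hsσ using M.exists_relSection
  let V : ExtensionData M n :=
    { X := M.relCohomology.part n
      eq_zero := fun hm x => Subtype.ext (x.2 hm)
      dX := fun m p => (LinearMap.fst k _ _).comp ((M.relCocycles m p).subtype.comp
        ((s m p).comp (Submodule.subtype _)))
      dX_act := fun m p σ x => congrArg (fun y => y.1.1) (hsσ m p σ x.1)
      d_dX := fun m p x => (s m p x.1).2.2.2.1
      dX_below := fun m p x => by
        by_cases hm : m = n
        · subst hm
          exact hM _ _ (s m p x.1).2.1
        · obtain rfl : x = 0 := Subtype.ext (x.2 hm)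
          rw [map_zero]
          exact .zero
      res_dX := fun h i x => (s _ _ x.1).2.1 _ h i
      ρX := fun m p => (LinearMap.snd k _ _).comp ((M.relCocycles m p).subtype.comp
        ((s m p).comp (Submodule.subtype _)))
      ρX_act := fun m p σ x => congrArg (fun y => y.1.2) (hsσ m p σ x.1)
      d_ρX := fun m p x => (s m p x.1).2.2.2.2
      circ_ρX := fun h i x => (s _ _ x.1).2.2.1 _ h i }
  refine ⟨V, ?_, ?_⟩
  · intro p x w v hw hv h1 h2
    refine Subtype.ext ?_
    change x.1 = 0
    rw [← hs n (p + 1) x.1, relClass_eq_zero_iff]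
    have : (s n (p + 1) x.1).1 = (M.d rfl w, M.ρ.map n (p + 1) w + P.d rfl v) := Prod.ext h1 h2
    rw [this]
    exact M.mem_relCoboundaries rfl hw hv
  · intro p t ht a b ha hb hda hdb
    obtain rfl : t = p - 1 := by omega
    let z : M.relCocycles n p := ⟨(a, b), ha, hb, hda, hdb⟩
    have : (s n p (M.relClass n p z) - z).1 ∈ M.relCoboundaries n p := by
      rw [← relClass_eq_zero_iff, map_sub, hs, sub_self]
    obtain ⟨w, hw, v, hv, h⟩ := this
    have h1 : (s n p (M.relClass n p z)).1.1 = a + M.d rfl w :=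
      eq_add_of_sub_eq' (congrArg Prod.fst h)
    have h2 : (s n p (M.relClass n p z)).1.2 = b + (M.ρ.map n p w + P.d ht v) :=
      eq_add_of_sub_eq' (congrArg Prod.snd h)
    exact ⟨⟨M.relClass n p z, fun h => absurd rfl h⟩, w, v, h1, h2.trans (add_assoc _ _ _).symm⟩

end PartialModel
end OperadModels

/-! ### Stages and towers of partial models. -/

namespace OperadModels

variable {k : Type u} [Field k]

open GradedOperad

/-- Partial models that have generators in arities below `n` only (and possibly in arity `2`), and
that are correct in arities below `n`. -/
structure PartialModel.IsStage {P : DGOperad k} {u : P.obj 0 0} (M : PartialModel P u) (n : ℕ) :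
    Prop where
  relLifts : ∀ m, m ≠ 0 → m < n → M.ρ.RelLifts m
  below : ∀ p, ∀ x ∈ M.normalized n p, M.toDGOperad.StageBelow M.E n x
  eq_bot : ∀ m, n ≤ m → m ≠ 2 → ∀ p, M.E m p = ⊥
  hasUnitalCocycle : M.HasUnitalCocycle

theorem PartialModel.stageBelow_of_eq_bot {P : DGOperad k} {u : P.obj 0 0} (M : PartialModel P u)
    {n : ℕ} {p : ℤ} (hE : M.E n p = ⊥) (x : M.obj n p) : M.toDGOperad.StageBelow M.E n x := by
  obtain ⟨y, hy, e, he, rfl⟩ := M.isMinimalPresentation.free.exists_below_add M.isReduced x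
  rw [hE] at he
  obtain rfl : e = 0 := he
  rw [add_zero]
  exact hy

/-- After the extension there are no generators of arity `n + 1 ≥ 3`, so every operation of that
arity, normalized or not, comes from the stage below. -/
theorem ExtensionData.IsComplete.isStage {P : DGOperad k} {u : P.obj 0 0} {M : PartialModel P u}
    {n : ℕ} {V : ExtensionData M n} (hV : V.IsComplete) (hn : 2 ≤ n) (hM : M.IsStage n)
    (hu : P.d (zero_add 1) u = 0) : (V.model hn).IsStage (n + 1) where
  relLifts m hm hmn := by
    obtain hmn | rfl := Nat.lt_succ_iff_lt_or_eq.1 hmn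
    · exact V.relLifts_of_lt hn hmn (hM.relLifts m hm hmn)
    · exact hV.relLifts hn hM.hasUnitalCocycle hu
        (V.relLifts_of_lt hn (by omega) (hM.relLifts (m - 1) (by omega) (by omega)))
  below p x _ := (V.model hn).stageBelow_of_eq_bot (V.range_freeGen_eq_bot (by omega)
    (hM.eq_bot (n + 1) (by omega) (by omega)) p) x
  eq_bot m hm hm2 := V.range_freeGen_eq_bot (by omega) (hM.eq_bot m (by omega) hm2)
  hasUnitalCocycle := V.hasUnitalCocycle hn hM.hasUnitalCocycle

/-- Arity `2` already contains a generator, so normalized elements have to be inspected: an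
operation of arity `2` is a multiple of the generator, its restrictions are the same multiple of the
identity, and so a normalized one is zero. -/
theorem BinaryGenerator.model_isStage {P : DGOperad k} (m : P.obj 2 0) (hP : P.one ≠ 0)
    (hP' : P.IsCohomologicallyConnected) (u : P.obj 0 0)
    (hm : ∀ σ, P.act σ m = m) (hd : P.d (zero_add 1) m = 0)
    (hmu : ∀ (h : 1 + 1 = 2 + 0) (i : Fin 2), P.circ h (add_zero 0) i m u = P.one) :
    (BinaryGenerator.model m hP u hm hd hmu).IsStage 2 where
  relLifts n h0 h2 := by
    obtain rfl : n = 1 := by omega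
    exact (BinaryGenerator.model m hP u hm hd hmu).relLifts_one hP'
  below p x hx := by
    let M := BinaryGenerator.model m hP u hm hd hmu
    obtain ⟨y, hy, e, ⟨z, hz⟩, hxe⟩ :=
      M.isMinimalPresentation.free.exists_below_add M.isReduced x
    have hy0 : y = 0 := by
      have : M.IsScalar y := hy.isScalar (by
        rintro n q e ⟨hn, he⟩
        have hn2 : n ≠ 2 := hn.ne
        exact (congrArg (e ∈ ·) (range_freeGen_eq_bot hn2 q)).mp he)
      cases this
      rfl
    rw [hy0, zero_add, ← hz] at hxe
    have hz0 : z = 0 := by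
      by_cases hp : p = 0
      · subst hp
        have h1 := (congrArg (M.res rfl 0) hxe).symm.trans (hx 1 rfl 0)
        have h2 := (operad_res_gen (one_ne_zero m hP hm) rfl 0 z).symm.trans h1
        exact Subtype.ext ((smul_eq_zero.1 h2).resolve_right (one_ne_zero m hP hm))
      · exact binary_eq_zero (fun h => hp h.2) z
    rw [hz0] at hxe
    have hx0 : x = 0 := hxe.trans (map_zero (freeGen (binary k) 2 p))
    refine (congrArg (M.toDGOperad.StageBelow M.E 2) hx0).mpr ?_
    exact .zero
  eq_bot n _ hn := range_freeGen_eq_bot hn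
  hasUnitalCocycle := ⟨freeGen (binary k) 2 0 (gen k), operad_d_gen _ _ _, fun h i =>
    (operad_res_gen _ h i (gen k)).trans (one_smul k (free (binary k)).one)⟩

/-- Sequences of partial models that become stationary in every arity. -/
structure Tower (P : DGOperad k) (u : P.obj 0 0) where
  stage : ℕ → PartialModel P u
  next : ∀ N, (stage N).toDGOperad.Hom (stage (N + 1)).toDGOperad
  next_res : ∀ (N : ℕ) {m l : ℕ} {p : ℤ} (h : l + 1 = m + 0) (i : Fin m) (x : (stage N).obj m p),
    (next N).map l p ((stage N).res h i x) = (stage (N + 1)).res h i ((next N).map m p x)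
  ρ_next : ∀ (N : ℕ) {m : ℕ} {p : ℤ} (x : (stage N).obj m p),
    (stage (N + 1)).ρ.map m p ((next N).map m p x) = (stage N).ρ.map m p x
  next_bijective : ∀ {N m : ℕ}, m ≤ N → ∀ p, Function.Bijective ((next N).map m p)
  next_mem : ∀ {N m : ℕ} {p : ℤ} {e : (stage N).obj m p}, e ∈ (stage N).E m p →
    (next N).map m p e ∈ (stage (N + 1)).E m p
  mem_of_next : ∀ {N m : ℕ} {p : ℤ} {e : (stage N).obj m p}, m ≤ N →
    (next N).map m p e ∈ (stage (N + 1)).E m p → e ∈ (stage N).E m p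

theorem ExtensionData.inclusion_mem {P : DGOperad k} {u : P.obj 0 0} {M : PartialModel P u} {n : ℕ}
    (V : ExtensionData M n) {m : ℕ} {p : ℤ} {e : M.obj m p} (he : e ∈ M.E m p) :
    V.inclusion.map m p e ∈ LinearMap.range (freeGen V.generators m p) :=
  ⟨_, (V.inclusion_gen m p e he).symm⟩

theorem ExtensionData.mem_of_inclusion {P : DGOperad k} {u : P.obj 0 0} {M : PartialModel P u}
    {n : ℕ} (V : ExtensionData M n) {m : ℕ} (hm : m ≠ n) {p : ℤ} {e : M.obj m p}
    (he : V.inclusion.map m p e ∈ LinearMap.range (freeGen V.generators m p)) : e ∈ M.E m p := by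
  obtain ⟨⟨e', v⟩, h⟩ := he
  obtain rfl : v = 0 := V.eq_zero hm v
  obtain rfl : e' = e := V.inclusion_injective m p ((V.inclusion_gen m p e' e'.2).trans h)
  exact e'.2

theorem exists_tower [CharZero k] {P : DGOperad k} {u : P.obj 0 0} (hu : P.d (zero_add 1) u = 0)
    (M : PartialModel P u) (hM : M.IsStage 2) :
    ∃ T : Tower P u, ∀ n, n ≠ 0 → (T.stage n).ρ.RelLifts n := by
  have hex (N : ℕ) (M : {M : PartialModel P u // M.IsStage (N + 2)}) :
      ∃ V : ExtensionData M.1 (N + 2), V.IsComplete := M.1.exists_isComplete M.2.below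
  choose V hV using hex
  -- Stage `N` is finished in the nonzero arities below `N + 2`, and the next one only adds
  -- generators of arity `N + 2`. The shift by `2` makes the passage bijective in the arities up to
  -- `N` required by `Tower`.
  let S : ∀ N, {M : PartialModel P u // M.IsStage (N + 2)} := fun N => Nat.rec ⟨M, hM⟩
    (fun N M => ⟨(V N M).model (by omega), (hV N M).isStage (by omega) M.2 hu⟩) N
  exact ⟨{
    stage := fun N => (S N).1
    next := fun N => (V N (S N)).inclusionHom (by omega)
    next_res := fun N => (V N (S N)).inclusion_res (by omega)
    ρ_next := fun N => (V N (S N)).ρGraded_inclusion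
    next_bijective := fun {N m} h p => (V N (S N)).inclusion_bijective (by omega) (by omega) p
    next_mem := fun {N m p e} he => (V N (S N)).inclusion_mem he
    mem_of_next := fun {N m p e} hm he => (V N (S N)).mem_of_inclusion (by omega) he },
    fun n hn => (S n).2.relLifts n hn (by omega)⟩

end OperadModels

/-! ### The colimit of a tower, and its freeness. -/

namespace OperadModels

variable {k : Type u} [Field k]

open GradedOperad

namespace Tower

variable {P : DGOperad k} {u : P.obj 0 0} (T : Tower P u)

/-- The morphisms between the stages. -/
def trans {N N' : ℕ} (h : N ≤ N') : (T.stage N).toDGOperad.Hom (T.stage N').toDGOperad :=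
  Nat.leRec (motive := fun N' _ => (T.stage N).toDGOperad.Hom (T.stage N').toDGOperad)
    (DGOperad.Hom.id _) (fun N' _ f => (T.next N').comp f) h

theorem trans_self {N m : ℕ} {p : ℤ} (x : (T.stage N).obj m p) :
    (T.trans le_rfl).map m p x = x := by
  rw [trans, Nat.leRec_self]
  rfl

theorem trans_succ {N N' m : ℕ} (h : N ≤ N') {p : ℤ} (x : (T.stage N).obj m p) :
    (T.trans (h.trans N'.le_succ)).map m p x = (T.next N').map m p ((T.trans h).map m p x) := by
  rw [trans, Nat.leRec_succ _ _ h]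
  rfl

theorem trans_trans {N N' N'' m : ℕ} (h : N ≤ N') (h' : N' ≤ N'') {p : ℤ}
    (x : (T.stage N).obj m p) :
    (T.trans h').map m p ((T.trans h).map m p x) = (T.trans (h.trans h')).map m p x := by
  induction N'', h' using Nat.le_induction with
  | base => rw [trans_self]
  | succ N'' h' ih => rw [trans_succ _ h', ih, trans_succ _ (h.trans h')]

theorem trans_res {N N' : ℕ} (h : N ≤ N') {m l : ℕ} {p : ℤ} (hl : l + 1 = m + 0) (i : Fin m)
    (x : (T.stage N).obj m p) : (T.trans h).map l p ((T.stage N).res hl i x) =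
      (T.stage N').res hl i ((T.trans h).map m p x) := by
  induction N', h using Nat.le_induction with
  | base => rw [trans_self, trans_self]
  | succ N' h ih => rw [trans_succ _ h, ih, trans_succ _ h, T.next_res]

theorem ρ_trans {N N' : ℕ} (h : N ≤ N') {m : ℕ} {p : ℤ} (x : (T.stage N).obj m p) :
    (T.stage N').ρ.map m p ((T.trans h).map m p x) = (T.stage N).ρ.map m p x := by
  induction N', h using Nat.le_induction with
  | base => rw [trans_self]
  | succ N' h ih => rw [trans_succ _ h, T.ρ_next, ih]

theorem trans_bijective {N N' m : ℕ} (h : N ≤ N') (hm : m ≤ N) (p : ℤ) :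
    Function.Bijective ((T.trans h).map m p) := by
  induction N', h using Nat.le_induction with
  | base =>
    have : ⇑((T.trans (le_refl N)).map m p) = id := funext fun x => T.trans_self x
    rw [this]
    exact Function.bijective_id
  | succ N' h ih =>
    have : ⇑((T.trans (h.trans N'.le_succ)).map m p) =
      (T.next N').map m p ∘ (T.trans h).map m p := funext fun x => T.trans_succ h x
    rw [this]
    exact (T.next_bijective (hm.trans h) p).comp ih

theorem trans_mem {N N' m : ℕ} (h : N ≤ N') {p : ℤ} {e : (T.stage N).obj m p}
    (he : e ∈ (T.stage N).E m p) : (T.trans h).map m p e ∈ (T.stage N').E m p := by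
  induction N', h using Nat.le_induction with
  | base => rwa [trans_self]
  | succ N' h ih =>
    rw [trans_succ _ h]
    exact T.next_mem ih

theorem mem_of_trans {N N' m : ℕ} (h : N ≤ N') (hm : m ≤ N) {p : ℤ} {e : (T.stage N).obj m p}
    (he : (T.trans h).map m p e ∈ (T.stage N').E m p) : e ∈ (T.stage N).E m p := by
  induction N', h using Nat.le_induction with
  | base => rwa [trans_self] at he
  | succ N' h ih =>
    rw [trans_succ _ h] at he
    exact ih (T.mem_of_next (hm.trans h) he)

/-- The underlying `Σ`-module of the colimit: in arity `m` it is that of the `m`-th stage. -/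
def colimitModule : GradedSigmaModule k where
  obj m p := (T.stage m).obj m p
  act := (T.stage _).act
  act_one := (T.stage _).act_one
  act_mul := (T.stage _).act_mul

/-- The identification of the colimit with later stages. -/
def toStage {m N : ℕ} (h : m ≤ N) (p : ℤ) : T.colimitModule.obj m p →ₗ[k] (T.stage N).obj m p :=
  (T.trans h).map m p

theorem toStage_bijective {m N : ℕ} (h : m ≤ N) (p : ℤ) : Function.Bijective (T.toStage h p) :=
  T.trans_bijective h le_rfl p

/-- The map from the stages to the colimit. -/
noncomputable def of (N m : ℕ) (p : ℤ) : (T.stage N).obj m p →ₗ[k] T.colimitModule.obj m p :=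
  (LinearEquiv.ofBijective (T.toStage (le_max_right N m) p)
    (T.toStage_bijective (le_max_right N m) p)).symm.toLinearMap.comp
    ((T.trans (le_max_left N m)).map m p)

theorem trans_toStage {m N N' : ℕ} (h : m ≤ N) (h' : N ≤ N') {p : ℤ}
    (x : T.colimitModule.obj m p) :
    (T.trans h').map m p (T.toStage h p x) = T.toStage (h.trans h') p x :=
  T.trans_trans h h' _

/-- Elements of the colimit are compared by their images in a stage that is late enough; this
computes such images for elements coming from any stage. -/
theorem toStage_of {m N N' : ℕ} (h : m ≤ N') (h' : N ≤ N') {p : ℤ} (x : (T.stage N).obj m p) :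
    T.toStage h p (T.of N m p x) = (T.trans h').map m p x := by
  have e : T.toStage (le_max_right N m) p (T.of N m p x) = (T.trans (le_max_left N m)).map m p x :=
    LinearEquiv.apply_symm_apply (LinearEquiv.ofBijective (T.toStage (le_max_right N m) p)
      (T.toStage_bijective (le_max_right N m) p)) _
  rw [← T.trans_toStage (le_max_right N m) (max_le h' h), e, trans_trans]

theorem of_trans {m N N' : ℕ} (h : N ≤ N') {p : ℤ} (x : (T.stage N).obj m p) :
    T.of N' m p ((T.trans h).map m p x) = T.of N m p x := by
  apply (T.toStage_bijective (le_max_right N' m) p).1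
  rw [T.toStage_of _ (le_max_left N' m), T.toStage_of _ (h.trans (le_max_left N' m)), trans_trans]

theorem of_toStage {m N : ℕ} (h : m ≤ N) {p : ℤ} (x : T.colimitModule.obj m p) :
    T.of N m p (T.toStage h p x) = x := by
  apply (T.toStage_bijective h p).1
  rw [T.toStage_of h le_rfl, trans_self]

theorem exists_of {m N : ℕ} (h : m ≤ N) {p : ℤ} (x : T.colimitModule.obj m p) :
    ∃ y, T.of N m p y = x := ⟨_, T.of_toStage h x⟩

theorem of_act {N m : ℕ} {p : ℤ} (σ : Equiv.Perm (Fin m)) (x : (T.stage N).obj m p) :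
    T.of N m p ((T.stage N).act σ x) = T.colimitModule.act σ (T.of N m p x) := by
  apply (T.toStage_bijective (le_max_right N m) p).1
  rw [T.toStage_of _ (le_max_left N m), (T.trans _).map_act, ← T.toStage_of (le_max_right N m)]
  exact ((T.trans _).map_act σ _).symm

/-- Partial compositions in the colimit. -/
noncomputable def colimitCirc {m n l : ℕ} {p q r : ℤ} (h : l + 1 = m + n) (hr : p + q = r)
    (i : Fin m) : T.colimitModule.obj m p →ₗ[k] T.colimitModule.obj n q →ₗ[k]
      T.colimitModule.obj l r :=
  (((T.stage (m + n)).circ h hr i).compl₁₂ (T.toStage (Nat.le_add_right m n) p)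
    (T.toStage (Nat.le_add_left n m) q)).compr₂ (T.of (m + n) l r)

/-- Compositions in the colimit are defined in stage `m + n`, but any other stage gives the same
result, as one sees in a stage beyond both. -/
theorem of_circ {N m n l : ℕ} {p q r : ℤ} (h : l + 1 = m + n) (hr : p + q = r) (i : Fin m)
    (x : (T.stage N).obj m p) (y : (T.stage N).obj n q) :
    T.of N l r ((T.stage N).circ h hr i x y) =
      T.colimitCirc h hr i (T.of N m p x) (T.of N n q y) := by
  have e : T.colimitCirc h hr i (T.of N m p x) (T.of N n q y) = T.of (m + n) l r
    ((T.stage (m + n)).circ h hr i (T.toStage (Nat.le_add_right m n) p (T.of N m p x))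
      (T.toStage (Nat.le_add_left n m) q (T.of N n q y))) := rfl
  have h1 : m + n ≤ N + (m + n) := by omega
  have h2 : N ≤ N + (m + n) := by omega
  rw [e, ← T.of_trans h1, (T.trans h1).map_circ, trans_toStage, trans_toStage, T.toStage_of _ h2,
    T.toStage_of _ h2, ← (T.trans h2).map_circ, of_trans]

theorem of_one {N N' : ℕ} (h : N ≤ N') : T.of N' 1 0 (T.stage N').one = T.of N 1 0 (T.stage N).one := by
  rw [← T.of_trans h]
  exact congrArg _ (T.trans h).map_one.symm

/-- The underlying graded operad of the colimit. -/
noncomputable abbrev colimitOperad : GradedOperad k where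
  toGradedSigmaModule := T.colimitModule
  one := T.of 0 1 0 (T.stage 0).one
  circ := T.colimitCirc
  -- Each axiom involves finitely many operations and is verified in one stage to which all of them
  -- lift.
  one_circ {n p} h hp x := by
    obtain ⟨x, rfl⟩ := T.exists_of (N := n) le_rfl x
    rw [← T.of_one (Nat.zero_le n), ← of_circ, (T.stage n).one_circ]
  circ_one {n p} h hp i x := by
    obtain ⟨x, rfl⟩ := T.exists_of (N := n) le_rfl x
    rw [← T.of_one (Nat.zero_le n), ← of_circ, (T.stage n).circ_one]
  circ_circ_inner {a b c _ _ _ _ _ _ _ _ _} h₁ h₂ h₃ h₄ e₁ e₂ e₃ e₄ i j x y z := by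
    obtain ⟨x, rfl⟩ := T.exists_of (N := a + b + c) (by omega) x
    obtain ⟨y, rfl⟩ := T.exists_of (N := a + b + c) (by omega) y
    obtain ⟨z, rfl⟩ := T.exists_of (N := a + b + c) (by omega) z
    rw [← of_circ, ← of_circ, ← of_circ, ← of_circ,
      (T.stage _).circ_circ_inner h₁ h₂ h₃ h₄ e₁ e₂ e₃ e₄]
  circ_circ_outer {a b c _ _ _ _ _ _ _ _ _} h₁ h₂ h₃ h₄ e₁ e₂ e₃ e₄ i j hij x y z := by
    obtain ⟨x, rfl⟩ := T.exists_of (N := a + b + c) (by omega) x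
    obtain ⟨y, rfl⟩ := T.exists_of (N := a + b + c) (by omega) y
    obtain ⟨z, rfl⟩ := T.exists_of (N := a + b + c) (by omega) z
    rw [← of_circ, ← of_circ, ← of_circ, ← of_circ,
      (T.stage _).circ_circ_outer h₁ h₂ h₃ h₄ e₁ e₂ e₃ e₄ i j hij, Units.smul_def, map_zsmul,
      Units.smul_def]
  circ_act {m n _ _ _ _} h hr i σ τ x y := by
    obtain ⟨x, rfl⟩ := T.exists_of (N := m + n) (by omega) x
    obtain ⟨y, rfl⟩ := T.exists_of (N := m + n) (by omega) y
    rw [← of_act, ← of_act, ← of_circ, ← of_circ, ← of_act, (T.stage _).circ_act]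

/-- The morphism from a stage to the colimit. -/
noncomputable def ofHom (N : ℕ) : GradedOperad.Hom (T.stage N).toGradedOperad T.colimitOperad where
  map := T.of N
  map_act := T.of_act
  map_one := T.of_one (Nat.zero_le N)
  map_circ := T.of_circ

/-- The differential of the colimit. -/
noncomputable def colimitD {m : ℕ} {p q : ℤ} (h : p + 1 = q) :
    T.colimitModule.obj m p →ₗ[k] T.colimitModule.obj m q :=
  (T.of m m q).comp (((T.stage m).d h).comp (T.toStage le_rfl p))

theorem of_d {N m : ℕ} {p q : ℤ} (h : p + 1 = q) (x : (T.stage N).obj m p) :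
    T.of N m q ((T.stage N).d h x) = T.colimitD h (T.of N m p x) := by
  have e : T.colimitD h (T.of N m p x) =
    T.of m m q ((T.stage m).d h (T.toStage le_rfl p (T.of N m p x))) := rfl
  rw [e, ← T.of_trans (le_max_right N m), (T.trans _).map_d, trans_toStage,
    T.toStage_of _ (le_max_left N m), ← (T.trans _).map_d, of_trans]

/-- The restrictions of the colimit. -/
noncomputable def colimitRes {m l : ℕ} {p : ℤ} (h : l + 1 = m + 0) (i : Fin m) :
    T.colimitModule.obj m p →ₗ[k] T.colimitModule.obj l p :=
  (T.of m l p).comp (((T.stage m).res h i).comp (T.toStage le_rfl p))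

theorem of_res {N m l : ℕ} {p : ℤ} (h : l + 1 = m + 0) (i : Fin m) (x : (T.stage N).obj m p) :
    T.of N l p ((T.stage N).res h i x) = T.colimitRes h i (T.of N m p x) := by
  have e : T.colimitRes h i (T.of N m p x) =
    T.of m l p ((T.stage m).res h i (T.toStage le_rfl p (T.of N m p x))) := rfl
  rw [e, ← T.of_trans (le_max_right N m), T.trans_res, trans_toStage,
    T.toStage_of _ (le_max_left N m), ← T.trans_res, of_trans]

/-- The underlying dg operad of the colimit. -/
noncomputable abbrev colimitDG : DGOperad k where
  toGradedOperad := T.colimitOperad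
  d := T.colimitD
  d_d {n p q r} h h' x := by
    obtain ⟨x, rfl⟩ := T.exists_of (N := n) le_rfl x
    refine (congrArg (T.colimitD h') (T.of_d h x).symm).trans ?_
    rw [← of_d, (T.stage n).d_d, map_zero]
  d_act {n p q} h σ x := by
    obtain ⟨x, rfl⟩ := T.exists_of (N := n) le_rfl x
    refine (congrArg (T.colimitD h) (T.of_act σ x).symm).trans ?_
    refine Eq.trans ?_ (congrArg (T.colimitModule.act σ) (T.of_d h x))
    rw [← of_d, ← of_act, (T.stage n).d_act]
  d_circ {m n l p q r p' q' r'} h hr hp' hq' hr' e₁ e₂ i x y := by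
    obtain ⟨x, rfl⟩ := T.exists_of (N := m + n) (by omega) x
    obtain ⟨y, rfl⟩ := T.exists_of (N := m + n) (by omega) y
    refine (congrArg (T.colimitD hr') (T.of_circ h hr i x y).symm).trans ?_
    rw [← of_d, ← of_d, ← of_d, (T.stage _).d_circ h hr hp' hq' hr' e₁ e₂, map_add, Units.smul_def,
      map_zsmul, of_circ, of_circ]
    rfl

/-- The generators of the colimit. -/
def colimitE (m : ℕ) (p : ℤ) : Submodule k (T.colimitModule.obj m p) :=
  ((T.stage m).E m p).comap (T.toStage le_rfl p)

theorem toStage_mem_iff {m N : ℕ} (h : m ≤ N) {p : ℤ} (x : T.colimitModule.obj m p) :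
    T.toStage h p x ∈ (T.stage N).E m p ↔ x ∈ T.colimitE m p := by
  rw [← T.trans_toStage le_rfl h]
  exact ⟨T.mem_of_trans h le_rfl, T.trans_mem h⟩

theorem of_mem {N m : ℕ} {p : ℤ} {e : (T.stage N).obj m p} (he : e ∈ (T.stage N).E m p) :
    T.of N m p e ∈ T.colimitE m p := by
  rw [← T.toStage_mem_iff (le_max_right N m), T.toStage_of _ (le_max_left N m)]
  exact T.trans_mem _ he

theorem act_mem {m : ℕ} {p : ℤ} (σ : Equiv.Perm (Fin m)) {e : T.colimitModule.obj m p}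
    (he : e ∈ T.colimitE m p) : T.colimitModule.act σ e ∈ T.colimitE m p := by
  rw [← T.of_toStage le_rfl e, ← of_act]
  exact T.of_mem ((T.stage m).isMinimalPresentation.free.1 _ _ σ _ he)

/-- Freeness of the stages gives morphisms `φ N` with the prescribed values on generators. They are
compatible with the transition maps, because generators go to generators, and glue to the colimit;
uniqueness is checked on each stage. -/
theorem colimit_isFreeOn : T.colimitOperad.IsFreeOn T.colimitE := by
  refine ⟨fun m p σ e he => T.act_mem σ he, fun Q f hf => ?_⟩
  have hφ (N : ℕ) := (T.stage N).isMinimalPresentation.free.2 Q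
    (fun m p => (f m p).comp (((T.of N m p).comp ((T.stage N).E m p).subtype).codRestrict
      (T.colimitE m p) (fun e => T.of_mem e.2))) (by
        intro m p σ e e' he
        refine hf m p σ _ _ ?_
        change T.of N m p e'.1 = T.colimitModule.act σ (T.of N m p e.1)
        rw [he, of_act])
  choose φ hφ hφ' using hφ
  have hφe (N m : ℕ) (p : ℤ) (e : (T.stage N).obj m p) (he : e ∈ (T.stage N).E m p) :
    (φ N).map m p e = f m p ⟨T.of N m p e, T.of_mem he⟩ := hφ N m p ⟨e, he⟩
  have hgen (N m : ℕ) (p : ℤ) (x : (T.stage N).obj m p) :=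
    (T.stage N).isMinimalPresentation.free.generated x
  have hφt {N N' : ℕ} (h : N ≤ N') {m : ℕ} {p : ℤ} (x : (T.stage N).obj m p) :
      (φ N').map m p ((T.trans h).map m p x) = (φ N).map m p x := by
    refine Generated.hom_eq ((φ N').comp (T.trans h).toHom) (φ N) (fun m p e he => ?_)
      (hgen N m p x)
    rw [Hom.comp_map, hφe N' m p _ (T.trans_mem h he), hφe N m p e he]
    exact congrArg _ (Subtype.ext (T.of_trans h e))
  let ψ (m : ℕ) (p : ℤ) : T.colimitModule.obj m p →ₗ[k] Q.obj m p :=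
    ((φ m).map m p).comp (T.toStage le_rfl p)
  have hψ {N m : ℕ} {p : ℤ} (x : (T.stage N).obj m p) :
      ψ m p (T.of N m p x) = (φ N).map m p x := by
    change (φ m).map m p (T.toStage le_rfl p (T.of N m p x)) = _
    rw [← hφt (le_max_right N m), trans_toStage, T.toStage_of _ (le_max_left N m), hφt]
  refine ⟨{
    map := ψ
    map_act := ?_
    map_one := ?_
    map_circ := ?_ }, fun m p e => ?_, fun χ hχ => Hom.ext' fun m p x => ?_⟩
  · intro n p σ x
    obtain ⟨x, rfl⟩ := T.exists_of (N := n) le_rfl x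
    refine (congrArg (ψ n p) (T.of_act σ x).symm).trans ?_
    rw [hψ, hψ, (φ n).map_act]
  · exact (hψ _).trans (φ 0).map_one
  · intro m n l p q r h hr i x y
    obtain ⟨x, rfl⟩ := T.exists_of (N := m + n) (by omega) x
    obtain ⟨y, rfl⟩ := T.exists_of (N := m + n) (by omega) y
    refine (congrArg (ψ l r) (T.of_circ h hr i x y).symm).trans ?_
    rw [hψ, hψ, hψ, (φ _).map_circ]
  · refine (hφe m m p _ e.2).trans (congrArg _ (Subtype.ext (T.of_toStage le_rfl e.1)))
  · obtain ⟨x, rfl⟩ := T.exists_of (N := m) le_rfl x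
    refine Eq.trans ?_ (hψ x).symm
    refine Generated.hom_eq (χ.comp (T.ofHom m)) (φ m) (fun n p e he => ?_) (hgen m m p x)
    rw [Hom.comp_map, hφe m n p e he]
    exact hχ n p ⟨T.of m n p e, T.of_mem he⟩

end Tower
end OperadModels

/-! ### The colimit as a partial model, and the main theorem. -/

namespace OperadModels

variable {k : Type u} [Field k]

open GradedOperad

namespace Tower

variable {P : DGOperad k} {u : P.obj 0 0} (T : Tower P u)

theorem colimitE_eq_bot {m : ℕ} {p : ℤ} (h : (T.stage m).E m p = ⊥) : T.colimitE m p = ⊥ := by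
  refine (Submodule.eq_bot_iff _).2 fun x hx => (T.toStage_bijective le_rfl p).1 ?_
  rw [map_zero]
  exact (Submodule.mem_bot k).1 (h ▸ hx)

theorem colimitE_zero (p : ℤ) : T.colimitE 0 p = ⊥ :=
  T.colimitE_eq_bot ((T.stage 0).isMinimalPresentation.arity_zero p)

theorem colimitE_one (p : ℤ) : T.colimitE 1 p = ⊥ :=
  T.colimitE_eq_bot ((T.stage 1).isMinimalPresentation.arity_one p)

theorem colimit_isReduced : T.colimitOperad.IsReduced :=
  T.colimit_isFreeOn.isReduced T.colimitE_zero T.colimitE_one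

/-- The colimit, with its restrictions. -/
noncomputable abbrev colimitRestricted : RestrictedOperad k where
  toDGOperad := T.colimitDG
  isReduced := T.colimit_isReduced
  one_ne_zero h := by
    have h1 := congrArg (T.toStage (le_refl 1) 0) ((T.of_one (Nat.zero_le 1)).trans h)
    rw [T.toStage_of _ le_rfl, trans_self, map_zero] at h1
    exact (T.stage 1).one_ne_zero h1
  res := T.colimitRes
  res_act {m l p} h i σ x := by
    obtain ⟨x, rfl⟩ := T.exists_of (N := m) le_rfl x
    rw [← of_act, ← of_res, ← of_res, (T.stage m).res_act, of_act]
  res_outer {m n l m' l' p q r} h hm hl h' hr i a ha x y := by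
    obtain ⟨x, rfl⟩ := T.exists_of (N := m + n) (by omega) x
    obtain ⟨y, rfl⟩ := T.exists_of (N := m + n) (by omega) y
    rw [← of_circ, ← of_res, ← of_res, ← of_circ, (T.stage _).res_outer h hm hl h' hr i a ha]
  res_inner {m n l m' l' p q r} h hn hl h' hr i j hn1 x y := by
    obtain ⟨x, rfl⟩ := T.exists_of (N := m + n) (by omega) x
    obtain ⟨y, rfl⟩ := T.exists_of (N := m + n) (by omega) y
    rw [← of_circ, ← of_res, ← of_res, ← of_circ, (T.stage _).res_inner h hn hl h' hr i j hn1]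
  res_res {m m' m'' p} hm hm' i j hij x := by
    obtain ⟨x, rfl⟩ := T.exists_of (N := m) le_rfl x
    rw [← of_res, ← of_res, ← of_res, ← of_res, (T.stage _).res_res hm hm' i j hij]
  res_two {p} x h i j := by
    obtain ⟨x, rfl⟩ := T.exists_of (N := 2) le_rfl x
    rw [← of_res, ← of_res, (T.stage _).res_two x h i j]
  d_res {m m' p q} hm hq i x := by
    obtain ⟨x, rfl⟩ := T.exists_of (N := m) le_rfl x
    rw [← of_res, ← of_d, ← of_d, ← of_res, (T.stage _).d_res]

/-- The morphism from the colimit to `P`. -/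
def colimitρ (m : ℕ) (p : ℤ) : T.colimitModule.obj m p →ₗ[k] P.obj m p :=
  ((T.stage m).ρ.map m p).comp (T.toStage le_rfl p)

theorem colimitρ_of {N m : ℕ} {p : ℤ} (x : (T.stage N).obj m p) :
    T.colimitρ m p (T.of N m p x) = (T.stage N).ρ.map m p x := by
  change (T.stage m).ρ.map m p (T.toStage le_rfl p (T.of N m p x)) = _
  rw [← T.ρ_trans (le_max_right N m), trans_toStage, T.toStage_of _ (le_max_left N m), ρ_trans]

/-- The morphism of dg operads from the colimit to `P`. -/
noncomputable def colimitρHom : T.colimitDG.Hom P where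
  map := T.colimitρ
  map_act {m p} σ x := by
    obtain ⟨x, rfl⟩ := T.exists_of (N := m) le_rfl x
    rw [← of_act, colimitρ_of, colimitρ_of, (T.stage m).ρ.map_act]
  map_one := (T.colimitρ_of _).trans (T.stage 0).ρ.map_one
  map_circ {m n l p q r} h hr i x y := by
    obtain ⟨x, rfl⟩ := T.exists_of (N := m + n) (by omega) x
    obtain ⟨y, rfl⟩ := T.exists_of (N := m + n) (by omega) y
    rw [← of_circ, colimitρ_of, colimitρ_of, colimitρ_of, (T.stage _).ρ.map_circ]
  map_d {m p q} h x := by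
    obtain ⟨x, rfl⟩ := T.exists_of (N := m) le_rfl x
    rw [← of_d, colimitρ_of, colimitρ_of, (T.stage m).ρ.map_d]

theorem of_below {N n m : ℕ} {p : ℤ} {x : (T.stage N).obj m p}
    (hx : (T.stage N).toDGOperad.StageBelow (T.stage N).E n x) :
    T.colimitDG.StageBelow T.colimitE n (T.of N m p x) :=
  Generated.map (T.ofHom N) (fun l q y hy => Generated.of (P := T.colimitOperad) _
    (show l < n ∧ T.of N l q y ∈ T.colimitE l q from ⟨hy.1, T.of_mem hy.2⟩)) hx

/-- The colimit of a tower of partial models. -/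
noncomputable def colimit : PartialModel P u where
  toRestrictedOperad := T.colimitRestricted
  E := T.colimitE
  isMinimalPresentation :=
    { arity_zero := T.colimitE_zero
      arity_one := T.colimitE_one
      free := T.colimit_isFreeOn
      d_mem := fun h _ he => T.of_below ((T.stage _).isMinimalPresentation.d_mem h _ he) }
  res_mem h i _ he := T.of_below ((T.stage _).res_mem h i _ he)
  ρ := T.colimitρHom
  ρ_res {m l p} h i x hl := by
    obtain ⟨x, rfl⟩ := T.exists_of (N := m) le_rfl x
    change T.colimitρ l p (T.colimitRes h i _) = P.circ h (add_zero p) i (T.colimitρ m p _) u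
    rw [← of_res, colimitρ_of, colimitρ_of, (T.stage m).ρ_res h i x hl]

/-- In arity `n` the colimit is stage `n`, with the same differential and the same map to `P`. -/
theorem colimit_relLifts {n : ℕ} (hn : (T.stage n).ρ.RelLifts n) : T.colimit.ρ.RelLifts n := by
  intro p q t h ht a b ha hb
  obtain ⟨a, rfl⟩ := T.exists_of (N := n) le_rfl a
  have ha' : (T.stage n).d (rfl : q + 1 = q + 1) a = 0 := by
    have h1 := congrArg (T.toStage (le_refl n) (q + 1)) ((T.of_d rfl a).trans ha)
    rw [T.toStage_of _ le_rfl, trans_self] at h1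
    exact h1.trans (map_zero _)
  obtain ⟨a', b', h1, h2⟩ := hn h ht a b ha' (hb.trans (T.colimitρ_of a))
  exact ⟨T.of n n p a', b', (T.of_d h a').symm.trans (congrArg _ h1), (T.colimitρ_of a').trans h2⟩

end Tower

/-- Operads with a unitary multiplication have unitary Sullivan minimal models. -/
theorem DGOperad.HasUnitaryMultiplication.exists_isUnitaryMinimalModel [CharZero k]
    {P : DGOperad k} (hP : P.HasUnitaryMultiplication) (hP₀ : P.IsCohomologicallyUnitary)
    (hP₁ : P.IsCohomologicallyConnected) :
    ∃ (S : DGOperad k) (ρS : S.Hom P), ρS.IsUnitaryMinimalModel := by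
  obtain ⟨m, u, hm, hd, hu, hmu⟩ := hP.exists_symmetric
  obtain ⟨T, hT⟩ := exists_tower hu _
    (BinaryGenerator.model_isStage m hP₁.one_ne_zero hP₁ u hm hd hmu)
  exact T.colimit.exists_isUnitaryMinimalModel hP₀ hu (P.d_ne_unit hP₁ hd hmu)
    fun n hn => T.colimit_relLifts (hT n hn)

end OperadModels

theorem mainTheorem6 {k : Type u} [Field k] [CharZero k] (P : OperadModels.DGOperad k)
    (hP₀ : P.IsCohomologicallyUnitary) (hP₁ : P.IsCohomologicallyConnected) :
    (P.HasUnitaryMultiplication →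
      ∃ (S : OperadModels.DGOperad k) (ρS : S.Hom P), ρS.IsUnitaryMinimalModel) ∧
    ∀ (S : OperadModels.DGOperad k) (ρS : S.Hom P), ρS.IsUnitaryMinimalModel →
      (∃ (M : OperadModels.DGOperad k) (ρM : M.Hom P.truncation), ρM.IsMinimalModel) ∧
      ∀ (M : OperadModels.DGOperad k) (ρM : M.Hom P.truncation), ρM.IsMinimalModel →
        (∃ (Mp : OperadModels.DGOperad k) (i : M.Hom Mp), i.IsUnitaryExtension ∧
          (∃ ρp : Mp.Hom P, ρp.IsUnitaryMinimalModel) ∧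
          ∃ φ : S.Hom Mp, φ.IsIso) ∧
        ∃ ψ : S.toDGSigmaModule.Hom
            (M.toDGSigmaModule.directSum (OperadModels.DGSigmaModule.groundInArityZero k)),
          ψ.IsIso := by
  exact ⟨fun hP => hP.exists_isUnitaryMinimalModel hP₀ hP₁, fun S ρS hρS =>
    ⟨⟨S.truncation, ρS.truncation, hρS.truncation⟩, fun M ρM hρM => hρS.comparison M ρM hρM⟩⟩
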